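/- Let $k$ be an algebraically closed field of characteristic zero. For $I\subset(0,1]$ let $I_+$ be the set of finite sums of elements of $I$ that are less than one (including the empty sum $0$). Let $N_1(I)$ be the set of numbers $c\in(0,1]$ for which there are a complete normal curve $X$ over $k$ (an integral, normal, one-dimensional scheme, proper over $k$) and an effective $\mathbb R$-divisor $\Delta=\sum_i d_i\Delta_i$ on $X$, with distinct components $\Delta_i$ and coefficients $d_i>0$, such that $(X,\Delta)$ is log canonical (that is, $d_i\le 1$ for all $i$), $K_X+\Delta$ is numerically trivial (that is, has degree $0$), and $c$ is associated to $\Delta$: there are integers $m_i\ge 1$ and $k_i\ge 0$, not all $k_i$ zero, and $f_i\in I_+$ with $$d_i=\frac{m_i-1}{m_i}+\frac{f_i}{m_i}+\frac{k_i c}{m_i}\qquad\text{for all } i.$$ **Lemma 4.6.** Let $N_1=N_1(1)$ be the set $N_1(I)$ for $I=\{1\}$. Then $N_1$ is exactly the set of $a\in(0,1]$ for which there are finitely many integers $m_i\ge 1$ and $k_i\ge 0$, with at least one $k_i\ne 0$, such that $$\sum_i\left(\frac{m_i-1}{m_i}+\frac{k_i a}{m_i}\right)=2$$ and each term $\frac{m_i-1}{m_i}+\frac{k_i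 a}{m_i}$ of the sum is at most one. In particular, the largest element of $N_1$ other than $1$ is $5/6$. -/

import Mathlib

open AlgebraicGeometry CategoryTheory

universe u

noncomputable section

/-- The structure of a `k`-algebra on the function field of an integral `k`-scheme
`p : X ⟶ Spec k`. -/
@[reducible] def functionFieldAlgebra {k : Type u} [Field k] {X : Scheme.{u}} [IsIntegral X]
    (p : X ⟶ Spec (.of k)) : Algebra k X.functionField :=
  RingHom.toAlgebra
    ((Scheme.ΓSpecIso (.of k)).inv ≫ p.appTop ≫
      X.presheaf.germ ⊤ (genericPoint X) trivial).hom

/-- `p : X ⟶ Spec k` is a complete normal curve over `k`: an integral scheme, proper over `k`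
(in particular separated and of finite type), of dimension one, all of whose local rings are
integrally closed domains. -/
structure IsCompleteNormalCurve {k : Type u} [Field k] {X : Scheme.{u}}
    (p : X ⟶ Spec (.of k)) : Prop where
  isIntegral : IsIntegral X
  isProper : IsProper p
  isNormal : ∀ x : X, IsIntegrallyClosed (X.presheaf.stalk x)
  dim_eq_one : topologicalKrullDim X = 1

/-- Weil divisors with coefficients in `R` on a curve; the prime divisors of a curve are its
closed points. -/
abbrev CurveDivisor (X : Scheme.{u}) (R : Type*) [Zero R] := closedPoints X →₀ R

/-- The degree of a divisor on a curve over an algebraically closed field, where every closed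
point has degree one. -/
def CurveDivisor.deg {X : Scheme.{u}} {R : Type*} [AddCommMonoid R] (D : CurveDivisor X R) : R :=
  D.sum fun _ d => d

/-- The rational differential `ω` on the curve `X` has order `n` at the point `x`:
for a local parameter `t` at `x` we have `ω = v t ^ n dt`, where `v` is a unit at `x`. -/
def HasOrderAt {k : Type u} [Field k] {X : Scheme.{u}} [IsIntegral X] (p : X ⟶ Spec (.of k))
    (ω : letI := functionFieldAlgebra p; KaehlerDifferential k X.functionField)
    (x : X) (n : ℤ) : Prop :=
  letI := functionFieldAlgebra p
  ∃ (t : X.presheaf.stalk x) (v : (X.presheaf.stalk x)ˣ),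
    IsLocalRing.maximalIdeal (X.presheaf.stalk x) = Ideal.span {t} ∧
    ω = (algebraMap (X.presheaf.stalk x) X.functionField v *
          algebraMap (X.presheaf.stalk x) X.functionField t ^ n) •
        KaehlerDifferential.D k X.functionField
          (algebraMap (X.presheaf.stalk x) X.functionField t)

/-- `K` is a canonical divisor of the curve `X`, that is, the divisor of a nonzero rational
differential. -/
def IsCanonicalDivisor {k : Type u} [Field k] {X : Scheme.{u}} [IsIntegral X]
    (p : X ⟶ Spec (.of k)) (K : CurveDivisor X ℤ) : Prop :=
  letI := functionFieldAlgebra p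
  ∃ ω : KaehlerDifferential k X.functionField, ω ≠ 0 ∧
    ∀ x : closedPoints X, HasOrderAt p ω (x : X) (K x)

/-- The pair `(X, Δ)`, with `X` a normal curve, is log canonical with `Δ` effective.
Every divisor over a normal curve is a closed point of the curve itself, and its log discrepancy
is one minus its coefficient in `Δ`. -/
def IsLogCanonicalBoundary {X : Scheme.{u}} (Δ : CurveDivisor X ℝ) : Prop :=
  ∀ x, 0 ≤ Δ x ∧ 0 ≤ 1 - Δ x

/-- `K_X + Δ` is numerically trivial; on a complete curve this means that its degree is zero. -/
def IsLogNumericallyTrivial {k : Type u} [Field k] {X : Scheme.{u}} [IsIntegral X]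
    (p : X ⟶ Spec (.of k)) (Δ : CurveDivisor X ℝ) : Prop :=
  ∃ K : CurveDivisor X ℤ, IsCanonicalDivisor p K ∧ ((K.deg : ℤ) : ℝ) + Δ.deg = 0

/-- `I_+`: the finite sums of elements of `I` that are less than one (the empty sum included). -/
def finiteSums (I : Set ℝ) : Set ℝ :=
  {s | ∃ M : Multiset ℝ, (∀ x ∈ M, x ∈ I) ∧ M.sum = s ∧ s < 1}

/-- The finite sequence `c` is associated to `Δ`, relative to the set `I`. The components of `Δ`
are the points of its support. -/
def IsAssociated (I : Set ℝ) {r : ℕ} (c : Fin r → ℝ) {X : Scheme.{u}}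
    (Δ : CurveDivisor X ℝ) : Prop :=
  ∃ (m : closedPoints X → ℕ) (f : closedPoints X → ℝ) (k : closedPoints X → Fin r → ℕ),
    (∀ x ∈ Δ.support, 1 ≤ m x ∧ f x ∈ finiteSums I ∧
      Δ x = ((m x : ℝ) - 1) / m x + f x / m x + ∑ j, (k x j : ℝ) * c j / m x) ∧
    ∀ j, ∃ x ∈ Δ.support, k x j ≠ 0

/-- `N_1(I)`, over the field `k`: the numbers `c ∈ (0,1]` that are associated to `Δ` for some
log canonical pair `(X, Δ)`, where `X` is a complete curve and `K_X + Δ` is numerically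
trivial. -/
def N₁ (k : Type u) [Field k] (I : Set ℝ) : Set ℝ :=
  {c | c ∈ Set.Ioc (0 : ℝ) 1 ∧
    ∃ (X : Scheme.{u}) (_ : IsIntegral X) (p : X ⟶ Spec (.of k)) (Δ : CurveDivisor X ℝ),
      IsCompleteNormalCurve p ∧ IsLogCanonicalBoundary Δ ∧ IsLogNumericallyTrivial p Δ ∧
      IsAssociated I ![c] Δ}

end

/-! The substance is that a canonical divisor on a complete normal curve has degree `-2` or a
nonnegative degree (`deg_canonical`). Given this, a nonzero effective `Δ` with `deg (K + Δ) = 0`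
forces `deg K < 0`, hence `deg K = -2` and `deg Δ = 2`; as sums of ones below one are empty, the
coefficients have the required form (`N₁_subset`). Conversely, a solution of the equation is
realized by putting its terms at distinct closed points of the projective line, which carries a
canonical divisor of degree `-2` (`LineGluing.stdSet_subset`, `ProjLine.lineGluing`).

The dichotomy is proved in the function field `F`, whose places are the local rings at closed
points; `PlaceSystem.sum_canonical` is the algebraic statement. Fix a nonconstant `x` and let `n =
[F : k(x)]`, which is the number of zeros and the number of poles of `x`. The functions regular away
from the poles of `x` have a `k[x]`-basis `w j`, with pole bounds `N j` times those of `x`, that is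
adapted to infinity (`exists_reduced_span`); geometrically, the direct image of the structure sheaf
on the line splits as the sum of the `O(-N j)`. If some `N l ≥ 2`, the vector of the trace-dual
basis belonging to `l`, times `dx`, is a nonzero differential without poles; tameness of
ramification in characteristic zero gives the required bound (`ge_of_forall_ge_trace`).

If `deg K < 0`, no such differential exists, so all `N j ≤ 1`, and some `N l = 0` because of the
function `1`. This yields `n + 1` independent functions with poles bounded by a divisor of degree
`n`, and imposing zeros one at a time leaves a function `z` with one simple pole. Then `F = k(z)`,
and `dz` has a double pole and no other zero or pole, so the degree is `-2`.

For `5/6 < a < 1` each term is `0`, `1/2` or at least `2/3`, is less than `1`, and exceeds `5/6` if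
it involves `a`; such terms cannot add up to `2` (`sum_stdCoeff_ne_two`). The value `5/6` occurs in
`1/2 + 2/3 + 5/6 = 2`. -/

/-! ### Places of a function field and orders of functions. -/

/-- The places of a function field `F` of one variable over `k`, indexed by `ι`: discrete
valuation rings with residue field `k` that exhaust the nontrivial valuation rings over `k`. -/
structure PlaceSystem (k F ι : Type*) [Field k] [Field F] [Algebra k F] where
  O : ι → ValuationSubring F
  injective : Function.Injective O
  algebraMap_mem : ∀ i c, algebraMap k F c ∈ O i
  exists_eq : ∀ V : ValuationSubring F, (∀ c, algebraMap k F c ∈ V) → V ≠ ⊤ → ∃ i, O i = V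
  unif : ι → F
  unif_mem : ∀ i, unif i ∈ O i
  inv_unif_notMem : ∀ i, (unif i)⁻¹ ∉ O i
  exists_eq_mul_zpow : ∀ i f, f ≠ 0 →
    ∃ (n : ℤ) (u : F), u ∈ O i ∧ u⁻¹ ∈ O i ∧ u ≠ 0 ∧ f = u * unif i ^ n
  exists_residue : ∀ i, ∀ f ∈ O i, ∃ c : k, (f - algebraMap k F c) * (unif i)⁻¹ ∈ O i
  finite_adjoin : ∀ x : F, x ∉ Set.range (algebraMap k F) →
    FiniteDimensional (IntermediateField.adjoin k {x}) F

namespace PlaceSystem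

variable {k F ι : Type*} [Field k] [Field F] [Algebra k F] (S : PlaceSystem k F ι)

lemma unif_ne_zero (i : ι) : S.unif i ≠ 0 := fun h =>
  S.inv_unif_notMem i (by rw [h, inv_zero]; exact (S.O i).zero_mem)

/-- `f` has order at least `n` at the place `i`. -/
def Ge (i : ι) (n : ℤ) (f : F) : Prop := f * S.unif i ^ (-n) ∈ S.O i

open Classical in
/-- The order of `f` at the place `i` (zero for `f = 0`). -/
noncomputable def ord (i : ι) (f : F) : ℤ :=
  if h : f = 0 then 0 else (S.exists_eq_mul_zpow i f h).choose

lemma unif_zpow_mem_iff (i : ι) (n : ℤ) : S.unif i ^ n ∈ S.O i ↔ 0 ≤ n := by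
  constructor
  · intro h
    by_contra hn
    push Not at hn
    apply S.inv_unif_notMem i
    obtain ⟨m, hm⟩ := Int.eq_ofNat_of_zero_le (show 0 ≤ -n - 1 by omega)
    have : (S.unif i)⁻¹ = S.unif i ^ n * S.unif i ^ m := by
      rw [← zpow_natCast, ← zpow_add₀ (S.unif_ne_zero i), ← hm,
        show n + (-n - 1) = -1 by ring, zpow_neg_one]
    rw [this]
    exact mul_mem h (pow_mem (S.unif_mem i) _)
  · intro h
    lift n to ℕ using h
    rw [zpow_natCast]
    exact pow_mem (S.unif_mem i) _

lemma unit_mul_zpow_mem_iff (i : ι) {u : F} (hu : u ∈ S.O i) (hu' : u⁻¹ ∈ S.O i) (h0 : u ≠ 0)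
    (n : ℤ) : u * S.unif i ^ n ∈ S.O i ↔ 0 ≤ n := by
  rw [← S.unif_zpow_mem_iff i n]
  refine ⟨fun h => ?_, fun h => mul_mem hu h⟩
  have := mul_mem hu' h
  rwa [inv_mul_cancel_left₀ h0] at this

lemma exists_unit_ord (i : ι) {f : F} (hf : f ≠ 0) :
    ∃ u : F, u ∈ S.O i ∧ u⁻¹ ∈ S.O i ∧ u ≠ 0 ∧ f = u * S.unif i ^ S.ord i f := by
  rw [ord, dif_neg hf]
  exact (S.exists_eq_mul_zpow i f hf).choose_spec

lemma ge_iff (i : ι) {f : F} (hf : f ≠ 0) (n : ℤ) : S.Ge i n f ↔ n ≤ S.ord i f := by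
  obtain ⟨u, hu, hu', h0, h⟩ := S.exists_unit_ord i hf
  rw [Ge]
  nth_rewrite 1 [h]
  rw [mul_assoc, ← zpow_add₀ (S.unif_ne_zero i), S.unit_mul_zpow_mem_iff i hu hu' h0]
  omega

lemma ge_zero_iff (i : ι) (f : F) : S.Ge i 0 f ↔ f ∈ S.O i := by simp [Ge]

/-- The zero function satisfies every bound, although `ord` assigns it the default value `0`.
Estimates are therefore stated with `Ge` and passed to `ord` only for nonzero functions. -/
lemma ge_zero' (i : ι) (n : ℤ) : S.Ge i n 0 := by simp [Ge, (S.O i).zero_mem]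

lemma mem_iff (i : ι) {f : F} (hf : f ≠ 0) : f ∈ S.O i ↔ 0 ≤ S.ord i f := by
  rw [← S.ge_zero_iff, S.ge_iff i hf]

lemma ord_eq_of (i : ι) {f u : F} (hu : u ∈ S.O i) (hu' : u⁻¹ ∈ S.O i) (h0 : u ≠ 0) {n : ℤ}
    (h : f = u * S.unif i ^ n) : S.ord i f = n := by
  have hf : f ≠ 0 := by rw [h]; exact mul_ne_zero h0 (zpow_ne_zero _ (S.unif_ne_zero i))
  have key : ∀ m : ℤ, m ≤ S.ord i f ↔ m ≤ n := by
    intro m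
    rw [← S.ge_iff i hf, Ge, h, mul_assoc, ← zpow_add₀ (S.unif_ne_zero i),
      S.unit_mul_zpow_mem_iff i hu hu' h0]
    omega
  exact le_antisymm ((key _).1 le_rfl) ((key _).2 le_rfl)

@[simp] lemma ord_zero (i : ι) : S.ord i 0 = 0 := by simp [ord]

@[simp] lemma ord_one (i : ι) : S.ord i 1 = 0 :=
  S.ord_eq_of i (u := 1) (S.O i).one_mem (by simp) one_ne_zero (by simp)

@[simp] lemma ord_unif (i : ι) : S.ord i (S.unif i) = 1 :=
  S.ord_eq_of i (u := 1) (S.O i).one_mem (by simp) one_ne_zero (by simp)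

lemma ord_mul (i : ι) {f g : F} (hf : f ≠ 0) (hg : g ≠ 0) :
    S.ord i (f * g) = S.ord i f + S.ord i g := by
  obtain ⟨u, hu, hu', h0, h⟩ := S.exists_unit_ord i hf
  obtain ⟨v, hv, hv', h0', h'⟩ := S.exists_unit_ord i hg
  refine S.ord_eq_of i (u := u * v) (mul_mem hu hv) (by rw [mul_inv]; exact mul_mem hu' hv')
    (mul_ne_zero h0 h0') ?_
  rw [zpow_add₀ (S.unif_ne_zero i)]
  nth_rewrite 1 [h, h']
  ring

lemma ord_inv (i : ι) (f : F) : S.ord i f⁻¹ = - S.ord i f := by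
  by_cases hf : f = 0
  · simp [hf]
  have := S.ord_mul i hf (inv_ne_zero hf)
  rw [mul_inv_cancel₀ hf, ord_one] at this
  omega

lemma ord_pow (i : ι) {f : F} (hf : f ≠ 0) (n : ℕ) : S.ord i (f ^ n) = n * S.ord i f := by
  induction n with
  | zero => simp
  | succ n ih => rw [pow_succ, S.ord_mul i (pow_ne_zero _ hf) hf, ih]; push_cast; ring

lemma ord_zpow (i : ι) {f : F} (hf : f ≠ 0) (n : ℤ) : S.ord i (f ^ n) = n * S.ord i f := by
  obtain ⟨m, rfl | rfl⟩ := n.eq_nat_or_neg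
  · rw [zpow_natCast, S.ord_pow i hf]
  · rw [zpow_neg, zpow_natCast, ord_inv, S.ord_pow i hf]; ring

lemma ord_algebraMap (i : ι) (c : k) : S.ord i (algebraMap k F c) = 0 := by
  by_cases hc : c = 0
  · simp [hc]
  refine S.ord_eq_of i (u := algebraMap k F c) (S.algebraMap_mem i c) ?_ (by simpa using hc)
    (by simp)
  rw [← map_inv₀]
  exact S.algebraMap_mem i _

lemma ord_neg (i : ι) (f : F) : S.ord i (-f) = S.ord i f := by
  by_cases hf : f = 0
  · simp [hf]
  have := S.ord_mul i (f := algebraMap k F (-1)) (g := f) (by simp) hf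
  rw [ord_algebraMap] at this
  simpa using this

variable {S}

lemma Ge.add {i : ι} {n : ℤ} {f g : F} (hf : S.Ge i n f) (hg : S.Ge i n g) : S.Ge i n (f + g) := by
  rw [Ge, add_mul]; exact add_mem hf hg

lemma Ge.neg {i : ι} {n : ℤ} {f : F} (hf : S.Ge i n f) : S.Ge i n (-f) := by
  rw [Ge, neg_mul]; exact neg_mem hf

lemma Ge.sub {i : ι} {n : ℤ} {f g : F} (hf : S.Ge i n f) (hg : S.Ge i n g) : S.Ge i n (f - g) := by
  rw [sub_eq_add_neg]; exact hf.add hg.neg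

lemma Ge.mul {i : ι} {m n : ℤ} {f g : F} (hf : S.Ge i m f) (hg : S.Ge i n g) :
    S.Ge i (m + n) (f * g) := by
  have := mul_mem hf hg
  rw [Ge, show -(m + n) = -m + -n by ring, zpow_add₀ (S.unif_ne_zero i)]
  convert this using 1
  ring

lemma Ge.mono {i : ι} {m n : ℤ} {f : F} (hf : S.Ge i n f) (h : m ≤ n) : S.Ge i m f := by
  by_cases h0 : f = 0
  · rw [h0]; exact S.ge_zero' i m
  rw [S.ge_iff i h0] at *
  exact h.trans hf

lemma ge_algebraMap (i : ι) (c : k) : S.Ge i 0 (algebraMap k F c) := by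
  rw [ge_zero_iff]; exact S.algebraMap_mem i c

lemma Ge.sum {α : Type*} {i : ι} {n : ℤ} {s : Finset α} {f : α → F}
    (h : ∀ a ∈ s, S.Ge i n (f a)) : S.Ge i n (∑ a ∈ s, f a) := by
  classical
  induction s using Finset.induction_on with
  | empty => simpa using S.ge_zero' i n
  | insert a s ha ih =>
    rw [Finset.sum_insert ha]
    exact (h a (Finset.mem_insert_self _ _)).add (ih fun b hb => h b (Finset.mem_insert_of_mem hb))

lemma Ge.pow {i : ι} {n : ℤ} {f : F} (hf : S.Ge i n f) (m : ℕ) : S.Ge i (m * n) (f ^ m) := by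
  induction m with
  | zero => simp [ge_zero_iff]
  | succ m ih => rw [pow_succ, Nat.cast_succ, add_mul, one_mul]; exact ih.mul hf

lemma Ge.algebraMap_mul {i : ι} {n : ℤ} {f : F} (hf : S.Ge i n f) (c : k) :
    S.Ge i n (algebraMap k F c * f) := by
  simpa using (ge_algebraMap i c).mul hf

variable (S)

lemma ge_ord (i : ι) (f : F) : S.Ge i (S.ord i f) f := by
  by_cases h : f = 0
  · rw [h]; exact S.ge_zero' i _
  · rw [S.ge_iff i h]

lemma exists_residue_ge (i : ι) {f : F} (hf : S.Ge i 0 f) :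
    ∃ c : k, S.Ge i 1 (f - algebraMap k F c) := by
  rw [ge_zero_iff] at hf
  simpa [Ge] using S.exists_residue i f hf

lemma not_ge_one_algebraMap (i : ι) {c : k} (hc : c ≠ 0) : ¬ S.Ge i 1 (algebraMap k F c) := by
  rw [S.ge_iff i (by simpa using hc), ord_algebraMap]; omega

lemma residue_unique (i : ι) {f : F} {c d : k} (hc : S.Ge i 1 (f - algebraMap k F c))
    (hd : S.Ge i 1 (f - algebraMap k F d)) : c = d := by
  by_contra h
  apply S.not_ge_one_algebraMap i (sub_ne_zero.2 (Ne.symm h))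
  have := hc.sub hd
  rw [map_sub]
  convert this using 1
  ring

/-- A discrete valuation ring is maximal among proper subrings of its field: with one element of
negative order, powers of that element reach everything. -/
lemma eq_of_le {i j : ι} (h : S.O i ≤ S.O j) : i = j := by
  apply S.injective
  refine le_antisymm h fun f hf => ?_
  by_contra hfi
  have h0 : f ≠ 0 := by rintro rfl; exact hfi (S.O i).zero_mem
  apply S.inv_unif_notMem j
  have hn : S.ord i f < 0 := by
    by_contra hn
    exact hfi ((S.mem_iff i h0).2 (by omega))
  -- the inverse uniformizer at `i` lies in `O j`
  have key : ∀ g : F, g ∈ S.O j := by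
    intro g
    by_cases hg : g = 0
    · rw [hg]; exact (S.O j).zero_mem
    obtain ⟨m, hm⟩ : ∃ m : ℕ, 0 ≤ S.ord i g - m * S.ord i f := by
      refine ⟨(S.ord i g).natAbs, ?_⟩
      have : ((S.ord i g).natAbs : ℤ) = |S.ord i g| := by simp
      rw [this]
      have h1 := neg_abs_le (S.ord i g)
      have h2 := abs_nonneg (S.ord i g)
      nlinarith
    have h1 : g * (f ^ m)⁻¹ ∈ S.O i := by
      rw [S.mem_iff i (mul_ne_zero hg (inv_ne_zero (pow_ne_zero _ h0))),
        S.ord_mul i hg (inv_ne_zero (pow_ne_zero _ h0)), ord_inv, S.ord_pow i h0]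
      linarith
    have := mul_mem (h h1) (pow_mem hf m)
    rwa [inv_mul_cancel_right₀ (pow_ne_zero _ h0)] at this
  exact key _

/-- Over a subring `R` containing `k`, integrality is checked at the places that contain `R`. -/
lemma isIntegral_iff (R : Subalgebra k F) (f : F) :
    IsIntegral R f ↔ ∀ i, R.toSubring ≤ (S.O i).toSubring → f ∈ S.O i := by
  -- The integral closure of a subring of a field is the intersection of the valuation rings above
  -- it. The only one over `k` that is not a place is `F` itself, which imposes no condition.
  have h := iInf_valuationSubring_superset (s := (R : Set F))
  have hR : Subring.closure (R : Set F) = R.toSubring := Subring.closure_eq R.toSubring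
  have h1 : f ∈ (integralClosure (Subring.closure (R : Set F)) F).toSubring ↔ IsIntegral R f := by
    rw [hR]; exact Iff.rfl
  rw [← h1, ← h]
  simp only [Subring.mem_iInf, Subtype.forall]
  constructor
  · intro H i hi
    exact H (S.O i) (fun r hr => hi hr)
  · intro H V hV
    by_cases hVt : V = ⊤
    · rw [hVt]; trivial
    obtain ⟨i, rfl⟩ := S.exists_eq V (fun c => hV (R.algebraMap_mem c)) hVt
    exact H i (fun r hr => hV hr)

end PlaceSystem

/-! ### Zeros and poles, counted by the degree of the field extension. -/

lemma transcendental_of_notMem_range {k F : Type*} [Field k] [IsAlgClosed k] [Field F] [Algebra k F]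
    {x : F} (hx : x ∉ Set.range (algebraMap k F)) : Transcendental k x := fun h =>
  hx (minpoly.mem_range_of_degree_eq_one k x (IsAlgClosed.degree_eq_one_of_irreducible k
    (minpoly.irreducible h.isIntegral)))

lemma isPrincipalIdealRing_adjoin {k F : Type*} [Field k] [Field F] [Algebra k F] (x : F) :
    IsPrincipalIdealRing (Algebra.adjoin k {x}) := by
  rw [Algebra.adjoin_singleton_eq_range_aeval]
  exact IsPrincipalIdealRing.of_surjective (Polynomial.aeval x).rangeRestrict
    (Polynomial.aeval x).rangeRestrict_surjective

/-- An element of `k[x]` is a constant plus a multiple of `x`. -/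
lemma exists_eq_algebraMap_add_mul {k F : Type*} [Field k] [Field F] [Algebra k F] (x : F)
    (r : Algebra.adjoin k {x}) : ∃ (c : k) (s : Algebra.adjoin k {x}),
      r = algebraMap k _ c + s * ⟨x, Algebra.self_mem_adjoin_singleton k x⟩ := by
  obtain ⟨r, hr⟩ := r
  obtain ⟨p, rfl⟩ := (Algebra.adjoin_singleton_eq_range_aeval k x) ▸ hr
  refine ⟨p.coeff 0, ⟨Polynomial.aeval x p.divX, Polynomial.aeval_mem_adjoin_singleton _ _⟩, ?_⟩
  apply Subtype.ext
  have := congrArg (Polynomial.aeval x) (Polynomial.divX_mul_X_add p)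
  simp only [map_add, map_mul, Polynomial.aeval_X, Polynomial.aeval_C] at this
  rw [add_comm] at this
  exact this.symm

set_option linter.deprecated false in
lemma inertiaDeg'_eq_one_of_forall_exists_sub_mem {R A : Type*} [CommRing R] [CommRing A]
    [Algebra R A] {p : Ideal R} [p.IsMaximal] {P : Ideal A} [P.LiesOver p] (hP : P ≠ ⊤)
    (h : ∀ a : A, ∃ r : R, a - algebraMap R A r ∈ P) : p.inertiaDeg' P = 1 := by
  rw [Ideal.inertiaDeg'_algebraMap]
  let _ : Field (R ⧸ p) := Ideal.Quotient.field p
  have hnt : Nontrivial (A ⧸ P) := Ideal.Quotient.nontrivial_iff.2 hP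
  apply finrank_eq_one (1 : A ⧸ P) one_ne_zero
  intro w
  obtain ⟨a, rfl⟩ := Ideal.Quotient.mk_surjective w
  obtain ⟨r, hr⟩ := h a
  refine ⟨Ideal.Quotient.mk p r, ?_⟩
  rw [Algebra.smul_def, mul_one]
  change Ideal.Quotient.mk P (algebraMap R A r) = _
  rw [eq_comm, Ideal.Quotient.mk_eq_mk_iff_sub_mem]
  exact hr

namespace PlaceSystem

section
variable {k F ι : Type*} [Field k] [Field F] [Algebra k F] (S : PlaceSystem k F ι)

lemma adjoin_le_iff (i : ι) (x : F) :
    (Algebra.adjoin k {x}).toSubring ≤ (S.O i).toSubring ↔ x ∈ S.O i := by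
  constructor
  · intro h
    exact h (Algebra.self_mem_adjoin_singleton k x)
  · intro h
    let B : Subalgebra k F := { (S.O i).toSubring with algebraMap_mem' := S.algebraMap_mem i }
    have : Algebra.adjoin k {x} ≤ B := Algebra.adjoin_le (by rintro _ rfl; exact h)
    exact this

open WithZero in
/-- A normalized discrete valuation with valuation ring `O i` is given by `ord i`. -/
lemma valuation_eq_exp_neg_ord {i : ι} {w : Valuation F ℤᵐ⁰}
    (hw : S.O i = w.valuationSubring) {π : F} (hπ : w π = exp (-1 : ℤ)) {f : F} (hf : f ≠ 0) :
    w f = exp (-S.ord i f) := by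
  have hmem : ∀ g, g ∈ S.O i ↔ w g ≤ 1 := fun g => by rw [hw, Valuation.mem_valuationSubring_iff]
  have hunit : ∀ u, u ∈ S.O i → u⁻¹ ∈ S.O i → u ≠ 0 → w u = 1 := by
    intro u h1 h2 h0
    rw [hmem] at h1 h2
    have h3 : w u ≠ 0 := (Valuation.ne_zero_iff w).2 h0
    rw [map_inv₀] at h2
    exact le_antisymm h1 ((inv_le_one₀ (zero_lt_iff.2 h3)).1 h2)
  have hpow : ∀ g, g ≠ 0 → w g = w (S.unif i) ^ S.ord i g := by
    intro g hg
    obtain ⟨u, h1, h2, h0, h⟩ := S.exists_unit_ord i hg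
    conv_lhs => rw [h, map_mul, hunit u h1 h2 h0, one_mul, map_zpow₀]
  have ht0 : w (S.unif i) ≠ 0 := (Valuation.ne_zero_iff w).2 (S.unif_ne_zero i)
  obtain ⟨a, ha⟩ : ∃ a : ℤ, w (S.unif i) = exp a := ⟨log (w (S.unif i)), (exp_log ht0).symm⟩
  have ha0 : a < 0 := by
    by_contra h
    apply S.inv_unif_notMem i
    rw [hmem, map_inv₀, ha, ← exp_neg, ← exp_zero, exp_le_exp]
    omega
  have hπ0 : π ≠ 0 := by
    rintro rfl
    rw [map_zero] at hπ
    exact exp_ne_zero hπ.symm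
  have h1 := hpow π hπ0
  rw [hπ, ha, ← exp_zsmul, exp_inj, smul_eq_mul] at h1
  -- The value `exp (-1)` is attained, so the exponent `a` of the uniformizer divides `-1`, and it
  -- is negative.
  have : a = -1 := by
    have h2 : a ∣ -1 := ⟨S.ord i π, by rw [h1]; ring⟩
    rcases Int.isUnit_iff.1 (isUnit_of_dvd_unit h2 (by decide)) with h | h <;> omega
  rw [hpow f hf, ha, this, ← exp_zsmul, smul_eq_mul]
  congr 1
  ring

end

variable {k F ι : Type*} [Field k] [IsAlgClosed k] [CharZero k] [Field F] [Algebra k F]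
  (S : PlaceSystem k F ι)

open IntermediateField.algebraAdjoinAdjoin

set_option maxHeartbeats 1000000 in
set_option linter.deprecated false in
open IsDedekindDomain Ideal WithZero in
/-- The zeros of a nonconstant function `x`, counted with multiplicity, number `[F : k(x)]`. -/
theorem exists_sum_ord_eq_finrank {x : F} (hx : x ∉ Set.range (algebraMap k F)) :
    ∃ s : Finset ι, (∀ i, i ∈ s ↔ 0 < S.ord i x) ∧
      ∑ i ∈ s, S.ord i x = Module.finrank (IntermediateField.adjoin k {x}) F := by
  classical
  have hx0 : x ≠ 0 := by rintro rfl; exact hx ⟨0, map_zero _⟩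
  -- The zeros of `x` are the primes over `(x)` in the integral closure `A` of `k[x]`. In the
  -- formula `∑ e f = n` the ramification index `e` is the order of `x`, and `f = 1` because all
  -- residues lie in `k`.
  let R := Algebra.adjoin k {x}
  let K := IntermediateField.adjoin k {x}
  let A := integralClosure R F
  have : FiniteDimensional K F := S.finite_adjoin x hx
  have : IsPrincipalIdealRing R := isPrincipalIdealRing_adjoin x
  have : CharZero K := charZero_of_injective_algebraMap (algebraMap k K).injective
  have : IsDedekindDomain A := integralClosure.isDedekindDomain R K F
  have : IsFractionRing A F := integralClosure.isFractionRing_of_finite_extension K F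
  have : Module.Finite R A := IsIntegralClosure.finite R K F A
  let xR : R := ⟨x, Algebra.self_mem_adjoin_singleton k x⟩
  have hxR0 : xR ≠ 0 := fun h => hx0 (congrArg Subtype.val h)
  let p : Ideal R := span {xR}
  have hp0 : p ≠ ⊥ := by simpa [p, span_singleton_eq_bot] using hxR0
  have hxi : x⁻¹ ∉ R := by
    intro h
    obtain ⟨q, hq⟩ := (Algebra.adjoin_singleton_eq_range_aeval k x) ▸ (show x⁻¹ ∈ Algebra.adjoin k {x} from h)
    have ht := transcendental_of_notMem_range hx
    have h1 : Polynomial.aeval x (Polynomial.X * q - 1) = 0 := by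
      simp only [map_sub, map_mul, Polynomial.aeval_X, map_one]
      erw [hq]
      rw [mul_inv_cancel₀ hx0, sub_self]
    have h2 := (transcendental_iff.1 ht) _ h1
    have h3 := congrArg (Polynomial.eval 0) h2
    simp at h3
  have hpmax : p.IsMaximal := by
    rw [Ideal.isMaximal_iff]
    refine ⟨?_, fun J a hJ ha haJ => ?_⟩
    · intro h
      obtain ⟨b, hb⟩ := mem_span_singleton'.1 h
      apply hxi
      have := congrArg Subtype.val hb
      have h3 : x⁻¹ = b.1 := by
        rw [eq_comm]
        exact eq_inv_of_mul_eq_one_left this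
      rw [h3]
      exact b.2
    · obtain ⟨c, s, hs⟩ := exists_eq_algebraMap_add_mul x a
      have hsx : s * xR ∈ p := mem_span_singleton'.2 ⟨s, rfl⟩
      have hc : c ≠ 0 := by
        rintro rfl
        apply ha
        rw [hs, map_zero, zero_add]
        exact hsx
      have h1 : algebraMap k R c ∈ J := by
        have : algebraMap k R c = a - s * xR := by rw [hs]; exact (add_sub_cancel_right _ _).symm
        rw [this]
        exact J.sub_mem haJ (hJ hsx)
      have h2 := J.mul_mem_left (algebraMap k R c⁻¹) h1
      rwa [← map_mul, inv_mul_cancel₀ hc, map_one] at h2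
  -- the place of a nonzero prime of `A`
  have hplace : ∀ v : HeightOneSpectrum A, ∃ i, S.O i = (v.valuation F).valuationSubring := by
    intro v
    apply S.exists_eq
    · intro c
      rw [Valuation.mem_valuationSubring_iff]
      exact v.valuation_le_one (algebraMap k A c)
    · rw [ne_eq, Valuation.valuationSubring_eq_top_iff, not_not]
      infer_instance
  choose pl hpl using hplace
  have hval : ∀ (v : HeightOneSpectrum A) {f : F}, f ≠ 0 →
      v.valuation F f = exp (-S.ord (pl v) f) := by
    intro v f hf
    obtain ⟨π, hπ⟩ := v.intValuation_exists_uniformizer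
    exact S.valuation_eq_exp_neg_ord (hpl v) (π := algebraMap A F π)
      (by rw [v.valuation_of_algebraMap, hπ]) hf
  have hmemv : ∀ (v : HeightOneSpectrum A) (a : A) (n : ℕ),
      a ∈ v.asIdeal ^ n ↔ S.Ge (pl v) n (a : F) := by
    intro v a n
    by_cases ha : a = 0
    · subst ha
      simpa using S.ge_zero' _ _
    have ha' : (a : F) ≠ 0 := fun h => ha (Subtype.ext h)
    rw [← v.intValuation_le_pow_iff_mem, ← v.valuation_of_algebraMap (K := F), S.ge_iff _ ha']
    have := hval v ha'
    erw [this]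
    rw [exp_le_exp]
    omega
  have hprime : ∀ P : Ideal A, P ∈ IsDedekindDomain.primesOverFinset p A →
      ∃ v : HeightOneSpectrum A, v.asIdeal = P := by
    intro P hP
    obtain ⟨h1, h2⟩ := (IsDedekindDomain.mem_primesOverFinset_iff hp0 A).1 hP
    exact ⟨⟨P, h1, ne_bot_of_liesOver_of_ne_bot hp0 P⟩, rfl⟩
  have hfaith : FaithfulSMul R A := (faithfulSMul_iff_algebraMap_injective R A).2 fun a b h =>
    Subtype.ext (congrArg (fun c : A => (c : F)) h)
  obtain ⟨Q, hQ, hQl⟩ := exists_maximal_ideal_liesOver_of_isIntegral (S := A) p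
  have hne : Nonempty (HeightOneSpectrum A) :=
    ⟨⟨Q, hQ.isPrime, ne_bot_of_liesOver_of_ne_bot hp0 Q⟩⟩
  choose! hv hhv using hprime
  have hxA : algebraMap R A xR = ⟨x, _⟩ := rfl
  have hram : ∀ P ∈ IsDedekindDomain.primesOverFinset p A, (ramificationIdx' p P : ℤ) = S.ord (pl (hv P)) x := by
    intro P hP
    have key : ∀ n : ℕ, map (algebraMap R A) p ≤ P ^ n ↔ (n : ℤ) ≤ S.ord (pl (hv P)) x := by
      intro n
      rw [map_span, Set.image_singleton, span_singleton_le_iff_mem]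
      nth_rewrite 1 [← hhv P hP]
      rw [hmemv]
      exact S.ge_iff _ hx0 _
    have hnn : 0 ≤ S.ord (pl (hv P)) x := by simpa using (key 0).1 (by simp)
    lift S.ord (pl (hv P)) x to ℕ using hnn with m hm
    have : ramificationIdx' p P = m := by
      apply ramificationIdx'_spec
      · rw [key]
      · rw [key]; push_cast; omega
    rw [this]
  have hinertia : ∀ P ∈ IsDedekindDomain.primesOverFinset p A, inertiaDeg' p P = 1 := by
    intro P hP
    obtain ⟨h1, h2⟩ := (IsDedekindDomain.mem_primesOverFinset_iff hp0 A).1 hP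
    refine inertiaDeg'_eq_one_of_forall_exists_sub_mem h1.ne_top fun a => ?_
    have ha : S.Ge (pl (hv P)) 0 (a : F) := by
      rw [← Nat.cast_zero, ← hmemv]
      simp
    obtain ⟨c, hc⟩ := S.exists_residue_ge _ ha
    refine ⟨algebraMap k R c, ?_⟩
    rw [← hhv P hP, ← pow_one (hv P).asIdeal, hmemv]
    exact hc
  have hsum := sum_ramification_inertia A (p := p) K F hp0
  have hinj : Set.InjOn (fun P => pl (hv P)) (IsDedekindDomain.primesOverFinset p A) := by
    intro P hP Q hQ h
    simp only at h
    rw [← hhv P hP, ← hhv Q hQ, ← pow_one (hv P).asIdeal, ← pow_one (hv Q).asIdeal]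
    ext a
    rw [hmemv, hmemv, h]
  refine ⟨(IsDedekindDomain.primesOverFinset p A).image (fun P => pl (hv P)), ?_, ?_⟩
  · intro i
    rw [Finset.mem_image]
    constructor
    · rintro ⟨P, hP, rfl⟩
      rw [← hram P hP]
      obtain ⟨h1, h2⟩ := (IsDedekindDomain.mem_primesOverFinset_iff hp0 A).1 hP
      have := IsDedekindDomain.ramificationIdx'_ne_zero_of_liesOver P hp0
      omega
    -- A zero of `x` contains `A`, and its maximal ideal cuts out a prime `P` over `(x)`.
    · intro hi
      have hxO : x ∈ S.O i := (S.mem_iff i hx0).2 hi.le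
      have hAO : ∀ a : A, (a : F) ∈ S.O i := fun a =>
        (S.isIntegral_iff R a).1 a.2 i ((S.adjoin_le_iff i x).2 hxO)
      let φ : A →+* S.O i := (algebraMap A F).codRestrict (S.O i).toSubring hAO
      let P : Ideal A := (IsLocalRing.maximalIdeal (S.O i)).comap φ
      have hPmem : ∀ a : A, a ∈ P ↔ S.Ge i 1 (a : F) := by
        intro a
        by_cases ha : a = 0
        · subst ha; simpa using S.ge_zero' _ _
        have ha' : (a : F) ≠ 0 := fun h => ha (Subtype.ext h)
        rw [mem_comap, ← ValuationSubring.coe_mem_nonunits_iff,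
          ValuationSubring.mem_nonunits_iff_or]
        have h1 : ((φ a : S.O i) : F) = a := rfl
        rw [h1, S.mem_iff i (inv_ne_zero ha'), ord_inv, S.ge_iff i ha']
        simp only [ha', false_or]
        omega
      have hPp : P.IsPrime := comap_isPrime _ _
      have hxP : algebraMap R A xR ∈ P := (hPmem _).2 ((S.ge_iff i hx0 _).2 (by exact hi))
      have hPl : P.LiesOver p := by
        constructor
        refine hpmax.eq_of_le (IsPrime.ne_top (IsPrime.under R P)) ?_
        rw [span_singleton_le_iff_mem]
        exact hxP
      have hP : P ∈ IsDedekindDomain.primesOverFinset p A := (IsDedekindDomain.mem_primesOverFinset_iff hp0 A).2 ⟨hPp, hPl⟩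
      refine ⟨P, hP, ?_⟩
      -- The localization of `A` at `P` is a place contained in `O i`, and distinct places are
      -- incomparable.
      apply S.eq_of_le
      intro f hf
      rw [hpl, Valuation.mem_valuationSubring_iff] at hf
      obtain ⟨a, d, h⟩ := (hv P).exists_primeCompl_mul_eq_of_integer f hf
      have hd : ¬ S.Ge i 1 (d.1 : F) := by
        rw [← hPmem]
        intro hdP
        exact d.2 ((hhv P hP).ge hdP)
      have hd0 : (d.1 : F) ≠ 0 := by
        intro h0
        rw [h0] at hd
        exact hd (S.ge_zero' _ _)
      have hdi : (d.1 : F)⁻¹ ∈ S.O i := by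
        rw [S.ge_iff i hd0] at hd
        rw [S.mem_iff i (inv_ne_zero hd0), ord_inv]
        omega
      have : f = (a : F) * (d.1 : F)⁻¹ := by
        rw [eq_mul_inv_iff_mul_eq₀ hd0]
        exact h
      rw [this]
      exact mul_mem (hAO a) hdi
  · rw [Finset.sum_image hinj]
    have : (Module.finrank K F : ℤ) = ∑ P ∈ IsDedekindDomain.primesOverFinset p A, (ramificationIdx' p P : ℤ) := by
      rw [← hsum]
      push_cast
      refine Finset.sum_congr rfl fun P hP => ?_
      rw [hinertia P hP]
      simp
    rw [this]
    exact Finset.sum_congr rfl fun P hP => (hram P hP).symm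

end PlaceSystem

lemma inv_notMem_range_algebraMap {k F : Type*} [Field k] [Field F] [Algebra k F] {x : F}
    (hx : x ∉ Set.range (algebraMap k F)) : x⁻¹ ∉ Set.range (algebraMap k F) := by
  rintro ⟨c, hc⟩
  exact hx ⟨c⁻¹, by rw [map_inv₀, hc, inv_inv]⟩

lemma sub_algebraMap_notMem_range {k F : Type*} [Field k] [Field F] [Algebra k F] {x : F}
    (hx : x ∉ Set.range (algebraMap k F)) (c : k) :
    x - algebraMap k F c ∉ Set.range (algebraMap k F) := by
  rintro ⟨d, hd⟩
  exact hx ⟨d + c, by rw [map_add, hd, sub_add_cancel]⟩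

lemma adjoin_inv_eq {k F : Type*} [Field k] [Field F] [Algebra k F] (x : F) :
    IntermediateField.adjoin k {x⁻¹} = IntermediateField.adjoin k {x} := by
  apply le_antisymm
  · rw [IntermediateField.adjoin_simple_le_iff]
    exact inv_mem (IntermediateField.mem_adjoin_simple_self k x)
  · rw [IntermediateField.adjoin_simple_le_iff]
    simpa using inv_mem (IntermediateField.mem_adjoin_simple_self k x⁻¹)

lemma adjoin_sub_algebraMap_eq {k F : Type*} [Field k] [Field F] [Algebra k F] (x : F) (c : k) :
    IntermediateField.adjoin k {x - algebraMap k F c} = IntermediateField.adjoin k {x} := by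
  apply le_antisymm
  · rw [IntermediateField.adjoin_simple_le_iff]
    exact sub_mem (IntermediateField.mem_adjoin_simple_self k x) (IntermediateField.algebraMap_mem _ c)
  · rw [IntermediateField.adjoin_simple_le_iff]
    have := add_mem (IntermediateField.mem_adjoin_simple_self k (x - algebraMap k F c))
      (IntermediateField.algebraMap_mem _ c)
    rwa [sub_add_cancel] at this

namespace PlaceSystem

variable {k F ι : Type*} [Field k] [IsAlgClosed k] [CharZero k] [Field F] [Algebra k F]
  (S : PlaceSystem k F ι)

/-- The poles of a nonconstant function `x`, counted with multiplicity, number `[F : k(x)]`. -/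
theorem exists_sum_neg_ord_eq_finrank {x : F} (hx : x ∉ Set.range (algebraMap k F)) :
    ∃ s : Finset ι, (∀ i, i ∈ s ↔ S.ord i x < 0) ∧
      ∑ i ∈ s, -S.ord i x = Module.finrank (IntermediateField.adjoin k {x}) F := by
  obtain ⟨s, h1, h2⟩ := S.exists_sum_ord_eq_finrank (inv_notMem_range_algebraMap hx)
  refine ⟨s, fun i => by rw [h1, ord_inv]; omega, ?_⟩
  rw [adjoin_inv_eq] at h2
  rw [← h2]
  exact Finset.sum_congr rfl fun i _ => (S.ord_inv i x).symm

omit [IsAlgClosed k] [CharZero k] in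
lemma finrank_adjoin_pos (P : PlaceSystem k F ι) {x : F} (hx : x ∉ Set.range (algebraMap k F)) :
    0 < Module.finrank (IntermediateField.adjoin k {x}) F := by
  have := P.finite_adjoin x hx
  exact Module.finrank_pos

theorem finite_setOf_ord_ne_zero (f : F) : {i | S.ord i f ≠ 0}.Finite := by
  classical
  by_cases hf : f ∈ Set.range (algebraMap k F)
  · obtain ⟨c, rfl⟩ := hf
    simp [ord_algebraMap]
  obtain ⟨s, h1, -⟩ := S.exists_sum_ord_eq_finrank hf
  obtain ⟨t, h2, -⟩ := S.exists_sum_neg_ord_eq_finrank hf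
  refine (s ∪ t).finite_toSet.subset fun i hi => ?_
  simp only [Finset.coe_union, Set.mem_union, Finset.mem_coe, h1, h2]
  have : S.ord i f ≠ 0 := hi
  omega

/-- A principal divisor has degree zero. -/
theorem sum_ord_eq_zero (f : F) {T : Finset ι} (hT : ∀ i, S.ord i f ≠ 0 → i ∈ T) :
    ∑ i ∈ T, S.ord i f = 0 := by
  classical
  by_cases hf : f ∈ Set.range (algebraMap k F)
  · obtain ⟨c, rfl⟩ := hf
    simp [ord_algebraMap]
  obtain ⟨s, h1, h1'⟩ := S.exists_sum_ord_eq_finrank hf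
  obtain ⟨t, h2, h2'⟩ := S.exists_sum_neg_ord_eq_finrank hf
  have hd : Disjoint s t := by
    rw [Finset.disjoint_left]
    intro i hi hi'
    rw [h1] at hi; rw [h2] at hi'
    omega
  have hsub : s ∪ t ⊆ T := by
    intro i hi
    apply hT
    rw [Finset.mem_union, h1, h2] at hi
    omega
  rw [← Finset.sum_subset hsub, Finset.sum_union hd, h1', ← h2', ← Finset.sum_add_distrib]
  · simp
  · intro i _ hi
    rw [Finset.mem_union, h1, h2] at hi
    omega

theorem exists_ord_neg {f : F} (hf : f ∉ Set.range (algebraMap k F)) : ∃ i, S.ord i f < 0 := by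
  obtain ⟨t, h2, h2'⟩ := S.exists_sum_neg_ord_eq_finrank hf
  by_contra h
  push Not at h
  have : t = ∅ := by
    rw [Finset.eq_empty_iff_forall_notMem]
    intro i hi
    have := h i
    rw [h2] at hi
    omega
  rw [this, Finset.sum_empty] at h2'
  have := S.finrank_adjoin_pos hf
  omega

/-- A function regular at all places is constant. -/
theorem mem_range_of_forall_ge {f : F} (h : ∀ i, S.Ge i 0 f) : f ∈ Set.range (algebraMap k F) := by
  by_contra hf
  obtain ⟨i, hi⟩ := S.exists_ord_neg hf
  have h0 : f ≠ 0 := by rintro rfl; exact hf ⟨0, map_zero _⟩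
  have := (S.ge_iff i h0 0).1 (h i)
  omega

theorem eq_zero_of_forall_ge {f : F} (h : ∀ i, S.Ge i 0 f) {i : ι} (hi : S.Ge i 1 f) : f = 0 := by
  obtain ⟨c, rfl⟩ := S.mem_range_of_forall_ge h
  by_contra h0
  exact S.not_ge_one_algebraMap i (by rintro rfl; simp at h0) hi

omit [IsAlgClosed k] [CharZero k] in
lemma ord_eq_zero_of_residue {i : ι} {f : F} {c : k} (hc : c ≠ 0)
    (h : S.Ge i 1 (f - algebraMap k F c)) : f ≠ 0 ∧ S.ord i f = 0 := by
  have h0 : f ≠ 0 := by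
    rintro rfl
    apply S.not_ge_one_algebraMap i hc
    simpa using h.neg
  refine ⟨h0, ?_⟩
  have h1 : S.Ge i 0 f := by
    have := (h.mono zero_le_one).add (ge_algebraMap i c)
    rwa [sub_add_cancel] at this
  have h2 : ¬ S.Ge i 1 f := by
    intro h2
    apply S.not_ge_one_algebraMap i hc
    have := h2.sub h
    rwa [sub_sub_cancel] at this
  rw [S.ge_iff i h0] at h1 h2
  omega

/-! ### Separation of places and weak approximation. -/

omit [CharZero k] in
/-- Two distinct places are separated by a function that is regular on a given finite set. -/
lemma exists_separating {i j : ι} (hij : i ≠ j) (T : Finset ι) :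
    ∃ g : F, (∀ l ∈ T, S.Ge l 0 g) ∧ S.Ge i 1 (g - 1) ∧ S.Ge j 1 g := by
  classical
  obtain ⟨a, ha, ha'⟩ := SetLike.not_le_iff_exists.1 (fun h => hij (S.eq_of_le (i := i) (j := j) h))
  obtain ⟨b, hb, hb'⟩ := SetLike.not_le_iff_exists.1
    (fun h => hij.symm (S.eq_of_le (i := j) (j := i) h))
  have ha0 : a ≠ 0 := by rintro rfl; exact ha' (S.O j).zero_mem
  have hb0 : b ≠ 0 := by rintro rfl; exact hb' (S.O i).zero_mem
  rw [S.mem_iff _ ha0] at ha ha'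
  rw [S.mem_iff _ hb0] at hb hb'
  set f := a * b⁻¹ with hf
  have hf0 : f ≠ 0 := mul_ne_zero ha0 (inv_ne_zero hb0)
  have hfi : 0 < S.ord i f := by
    rw [hf, S.ord_mul _ ha0 (inv_ne_zero hb0), ord_inv]; omega
  have hfj : S.ord j f < 0 := by
    rw [hf, S.ord_mul _ ha0 (inv_ne_zero hb0), ord_inv]; omega
  -- the values to be avoided
  have hres : ∀ l : ι, ∃ c : k, S.Ge l 0 f → S.Ge l 1 (f - algebraMap k F c) := by
    intro l
    by_cases h : S.Ge l 0 f
    · obtain ⟨c, hc⟩ := S.exists_residue_ge l h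
      exact ⟨c, fun _ => hc⟩
    · exact ⟨0, fun h' => absurd h' h⟩
  choose r hr using hres
  -- As `f` has a zero at `i` and a pole at `j`, the function `c / (c - f)` takes the values `1` and
  -- `0` there. It is regular on `T` once `c` avoids the residues of `f`.
  obtain ⟨c, hc⟩ := Infinite.exists_notMem_finset (insert 0 (T.image r))
  rw [Finset.mem_insert, not_or] at hc
  obtain ⟨hc0, hcT⟩ := hc
  have hc0' : algebraMap k F c ≠ 0 := by simpa using hc0
  set h := algebraMap k F c - f with hh
  have hh0 : h ≠ 0 := by
    rw [hh, sub_ne_zero]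
    intro h'
    rw [← h', ord_algebraMap] at hfi
    omega
  refine ⟨algebraMap k F c * h⁻¹, ?_, ?_, ?_⟩
  · intro l hl
    apply Ge.algebraMap_mul
    rw [S.ge_iff _ (inv_ne_zero hh0), ord_inv]
    by_cases hlf : S.Ge l 0 f
    · have h1 : r l - c ≠ 0 := by
        rw [sub_ne_zero]
        rintro h'
        exact hcT (Finset.mem_image.2 ⟨l, hl, h'⟩)
      have h2 : S.Ge l 1 (f - algebraMap k F c - algebraMap k F (r l - c)) := by
        have := hr l hlf
        rw [map_sub]
        convert this using 1
        ring
      have h3 := (S.ord_eq_zero_of_residue h1 h2).2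
      have h4 : S.ord l h = S.ord l (f - algebraMap k F c) := by
        rw [← S.ord_neg, hh, neg_sub]
      omega
    · have h1 : ¬ S.Ge l 0 h := by
        intro h1
        apply hlf
        have := (ge_algebraMap (S := S) l c).sub h1
        rwa [hh, sub_sub_cancel] at this
      rw [S.ge_iff _ hh0] at h1
      omega
  · have h1 : algebraMap k F c * h⁻¹ - 1 = f * h⁻¹ := by
      field_simp
      rw [hh]; ring
    rw [h1]
    have h2 : S.Ge i 1 (h - algebraMap k F c) := by
      have : h - algebraMap k F c = - f := by rw [hh]; ring
      rw [this]
      exact ((S.ge_iff i hf0 1).2 hfi).neg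
    have h3 := (S.ord_eq_zero_of_residue hc0 h2).2
    rw [S.ge_iff _ (mul_ne_zero hf0 (inv_ne_zero hh0)), S.ord_mul _ hf0 (inv_ne_zero hh0),
      ord_inv, h3]
    omega
  · apply Ge.algebraMap_mul
    rw [S.ge_iff _ (inv_ne_zero hh0), ord_inv]
    have h1 : ¬ S.Ge j 0 h := by
      intro h1
      have := (ge_algebraMap (S := S) j c).sub h1
      rw [hh, sub_sub_cancel, S.ge_iff _ hf0] at this
      omega
    rw [S.ge_iff _ hh0] at h1
    omega

-- Multiply separating functions, one for each place of `T` other than `i`.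
omit [CharZero k] in
lemma exists_separating_finset (i : ι) (T : Finset ι) :
    ∃ g : F, (∀ l ∈ T, S.Ge l 0 g) ∧ S.Ge i 0 g ∧ S.Ge i 1 (g - 1) ∧
      ∀ j ∈ T, j ≠ i → S.Ge j 1 g := by
  classical
  suffices h : ∀ U : Finset ι, i ∉ U → ∃ g : F, (∀ l ∈ insert i T, S.Ge l 0 g) ∧
      S.Ge i 1 (g - 1) ∧ ∀ j ∈ U, j ∈ T → S.Ge j 1 g by
    obtain ⟨g, h1, h2, h3⟩ := h (T.erase i) (Finset.notMem_erase _ _)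
    exact ⟨g, fun l hl => h1 l (Finset.mem_insert_of_mem hl), h1 i (Finset.mem_insert_self _ _), h2,
      fun j hj hji => h3 j (Finset.mem_erase.2 ⟨hji, hj⟩) hj⟩
  intro U
  induction U using Finset.induction_on with
  | empty =>
    intro _
    refine ⟨1, fun l _ => ?_, ?_, by simp⟩
    · rw [ge_zero_iff]; exact (S.O l).one_mem
    · rw [sub_self]; exact S.ge_zero' _ _
  | insert a U ha ih =>
    intro hi
    rw [Finset.mem_insert, not_or] at hi
    obtain ⟨g, h1, h2, h3⟩ := ih hi.2
    obtain ⟨g', h1', h2', h3'⟩ := S.exists_separating hi.1 (insert i T)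
    refine ⟨g * g', fun l hl => by simpa using (h1 l hl).mul (h1' l hl), ?_, ?_⟩
    · have : g * g' - 1 = (g - 1) * g' + (g' - 1) := by ring
      rw [this]
      refine Ge.add ?_ h2'
      simpa using h2.mul (h1' i (Finset.mem_insert_self _ _))
    · intro j hj hjT
      rcases Finset.mem_insert.1 hj with rfl | hj
      · simpa using (h1 j (Finset.mem_insert_of_mem hjT)).mul h3'
      · simpa using (h3 j hj hjT).mul (h1' j (Finset.mem_insert_of_mem hjT))

omit [CharZero k] in
/-- Weak approximation: a function with prescribed order at `i` and large order at finitely many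
other places. -/
lemma exists_ord_eq_and_ge (i : ι) (T : Finset ι) (n : ℤ) (M : ι → ℤ) :
    ∃ b : F, b ≠ 0 ∧ S.ord i b = n ∧ ∀ j ∈ T, j ≠ i → S.Ge j (M j) b := by
  classical
  obtain ⟨g, -, -, h2, h3⟩ := S.exists_separating_finset i T
  obtain ⟨hg0, hgi⟩ := S.ord_eq_zero_of_residue (one_ne_zero (α := k)) (by simpa using h2)
  obtain ⟨N, hN⟩ : ∃ N : ℕ, ∀ j ∈ T, M j - S.ord j (S.unif i ^ n) ≤ N := by
    refine ⟨∑ j ∈ T, (M j - S.ord j (S.unif i ^ n)).natAbs, fun j hj => ?_⟩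
    have := Finset.single_le_sum (f := fun j => (M j - S.ord j (S.unif i ^ n)).natAbs)
      (fun _ _ => Nat.zero_le _) hj
    omega
  have hu := zpow_ne_zero n (S.unif_ne_zero i)
  -- The power of `g` is a unit at `i`, so the order there is `n`, while at the other places of `T`
  -- it raises the order by at least `N`.
  refine ⟨g ^ N * S.unif i ^ n, mul_ne_zero (pow_ne_zero _ hg0) hu, ?_, fun j hj hji => ?_⟩
  · rw [S.ord_mul _ (pow_ne_zero _ hg0) hu, S.ord_pow _ hg0, hgi,
      S.ord_zpow _ (S.unif_ne_zero i), ord_unif]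
    ring
  · have h1 := ((h3 j hj hji).pow N).mul (S.ge_ord j (S.unif i ^ n))
    refine h1.mono ?_
    have := hN j hj
    linarith

end PlaceSystem

/-! ### Traces to `k(z)` and tame ramification. -/

/-- This is applied to the residues of a function over `z = 0`: in characteristic zero the nonzero
number `r` remains nonzero in the field. -/
lemma Multiset.exists_sum_eq_natCast_of_forall_eq_zero_or_one {κ : Type*} [Semiring κ]
    (s : Multiset κ) (h : ∀ a ∈ s, a = 0 ∨ a = 1) :
    ∃ r : ℕ, s.sum = r ∧ ((∃ a ∈ s, a ≠ 0) → r ≠ 0) := by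
  induction s using Multiset.induction_on with
  | empty => exact ⟨0, by simp, by simp⟩
  | cons a s ih =>
    obtain ⟨r, h1, h2⟩ := ih fun b hb => h b (Multiset.mem_cons_of_mem hb)
    rcases h a (Multiset.mem_cons_self a s) with rfl | rfl
    · refine ⟨r, by simpa using h1, fun ⟨b, hb, hb0⟩ => h2 ⟨b, ?_, hb0⟩⟩
      rcases Multiset.mem_cons.1 hb with rfl | hb
      · exact absurd rfl hb0
      · exact hb
    · exact ⟨r + 1, by simp [h1, add_comm], fun _ => by omega⟩

/-- The constant of a polynomial that kills the shift of a unit divides one. -/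
lemma isUnit_eval_minpoly_of_isIntegral_inv {V F : Type*} [CommRing V] [IsDomain V]
    [IsIntegrallyClosed V] [Field F] [Algebra V F] [FaithfulSMul V F] {f : F} {c : V}
    (hf : IsIntegral V f) (h0 : f - algebraMap V F c ≠ 0)
    (hg : IsIntegral V (f - algebraMap V F c)⁻¹) :
    IsUnit ((minpoly V f).eval c) := by
  obtain ⟨l, hl, hlg⟩ := hg
  have h1 : Polynomial.eval₂ (algebraMap V F) (f - algebraMap V F c) l.reverse = 0 := by
    have : Invertible (f - algebraMap V F c)⁻¹ := invertibleOfNonzero (inv_ne_zero h0)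
    have h := (Polynomial.eval₂_reverse_eq_zero_iff (algebraMap V F) (f - algebraMap V F c)⁻¹ l).2
      hlg
    rwa [invOf_eq_inv, inv_inv] at h
  have h2 : Polynomial.aeval f (l.reverse.comp (Polynomial.X - Polynomial.C c)) = 0 := by
    rw [Polynomial.aeval_comp]
    simpa [Polynomial.aeval_def] using h1
  obtain ⟨q, hq⟩ := minpoly.isIntegrallyClosed_dvd hf h2
  have h3 := congrArg (Polynomial.eval c) hq
  rw [Polynomial.eval_mul, Polynomial.eval_comp] at h3
  simp only [Polynomial.eval_sub, Polynomial.eval_X, Polynomial.eval_C, sub_self,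
    ← Polynomial.coeff_zero_eq_eval_zero, Polynomial.coeff_zero_reverse, hl.leadingCoeff] at h3
  exact IsUnit.of_mul_eq_one _ h3.symm

namespace PlaceSystem

section
variable {k F ι : Type*} [Field k] [Field F] [Algebra k F] (S : PlaceSystem k F ι)

/-- Nonzero elements of `k(z)` behave uniformly at the zeros of `z`. -/
lemma exists_zpow_residue {z q : F} (hz : z ≠ 0)
    (hq : q ∈ IntermediateField.adjoin k {z}) (hq0 : q ≠ 0) :
    ∃ (m : ℤ) (c : k), c ≠ 0 ∧ ∀ i, 0 < S.ord i z → S.Ge i 1 (q * z ^ (-m) - algebraMap k F c) := by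
  -- A nonzero polynomial in `z` is a power of `z` times a polynomial with nonzero constant term
  -- `c`, and the latter has residue `c` at every zero of `z`.
  have hpoly : ∀ p : Polynomial k, p ≠ 0 → ∃ (m : ℕ) (c : k) (u : F), c ≠ 0 ∧
      Polynomial.aeval z p = u * z ^ m ∧
      ∀ i, 0 < S.ord i z → S.Ge i 1 (u - algebraMap k F c) := by
    intro p hp
    obtain ⟨r, hr, hr'⟩ := Polynomial.exists_eq_pow_rootMultiplicity_mul_and_not_dvd p hp 0
    rw [map_zero, sub_zero] at hr hr'
    refine ⟨p.rootMultiplicity 0, r.coeff 0, Polynomial.aeval z r, fun h => hr' (Polynomial.X_dvd_iff.2 h), ?_,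
      fun i hi => ?_⟩
    · conv_lhs => rw [hr]
      rw [map_mul, map_pow, Polynomial.aeval_X, mul_comm]
    · have h1 := congrArg (Polynomial.aeval z) (Polynomial.divX_mul_X_add r)
      simp only [map_add, map_mul, Polynomial.aeval_X, Polynomial.aeval_C] at h1
      have h2 : Polynomial.aeval z r - algebraMap k F (r.coeff 0) = z * Polynomial.aeval z r.divX := by
        rw [← h1]; ring
      rw [h2]
      have h3 : S.Ge i 0 (Polynomial.aeval z r.divX) := by
        rw [ge_zero_iff]
        exact (S.adjoin_le_iff i z).2 ((S.mem_iff i hz).2 hi.le)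
          (Polynomial.aeval_mem_adjoin_singleton k z)
      simpa using ((S.ge_iff i hz 1).2 hi).mul h3
  obtain ⟨a, b, rfl⟩ := IntermediateField.mem_adjoin_simple_iff k q |>.1 hq
  have ha0 : a ≠ 0 := by rintro rfl; simp at hq0
  have hb0 : b ≠ 0 := by rintro rfl; simp at hq0
  obtain ⟨m, c, u, hc, hu, hi⟩ := hpoly a ha0
  obtain ⟨m', c', u', hc', hu', hi'⟩ := hpoly b hb0
  refine ⟨m - m', c / c', div_ne_zero hc hc', fun i hiz => ?_⟩
  obtain ⟨hu0, hou⟩ := S.ord_eq_zero_of_residue hc (hi i hiz)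
  obtain ⟨hu0', hou'⟩ := S.ord_eq_zero_of_residue hc' (hi' i hiz)
  have hcc : algebraMap k F c' ≠ 0 := by simpa using hc'
  have h1 : Polynomial.aeval z a / Polynomial.aeval z b * z ^ (-((m : ℤ) - m')) -
      algebraMap k F (c / c') =
      ((u - algebraMap k F c) * algebraMap k F c' - algebraMap k F c * (u' - algebraMap k F c')) *
        (u' * algebraMap k F c')⁻¹ := by
    rw [hu, hu', map_div₀, neg_sub, zpow_sub₀ hz, zpow_natCast, zpow_natCast]
    field_simp
    ring
  rw [h1]
  have h2 : S.Ge i 0 (u' * algebraMap k F c')⁻¹ := by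
    rw [S.ge_iff _ (inv_ne_zero (mul_ne_zero hu0' hcc)), ord_inv, S.ord_mul _ hu0' hcc, hou',
      ord_algebraMap]
    simp
  have h3 : S.Ge i 1 ((u - algebraMap k F c) * algebraMap k F c') := by
    simpa using (hi i hiz).mul (ge_algebraMap i c')
  simpa using (h3.sub ((hi' i hiz).algebraMap_mul c)).mul h2

variable {z : F} (hz : z ∉ Set.range (algebraMap k F))
include hz

/-- At the zeros of `z` an element of `k(z)` has order `m * ord z` with a common `m`. A bound beyond
`(n - 1) * ord z` at one zero thus rounds up to `n ≤ m` and holds at all of them. -/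
lemma ge_mul_ord_of_ge {q : F} (hq : q ∈ IntermediateField.adjoin k {z}) {i : ι}
    (hi : 0 < S.ord i z) {n : ℤ} (h : S.Ge i ((n - 1) * S.ord i z + 1) q) {j : ι}
    (hj : 0 < S.ord j z) : S.Ge j (n * S.ord j z) q := by
  have hz0 : z ≠ 0 := by rintro rfl; exact hz ⟨0, map_zero _⟩
  by_cases hq0 : q = 0
  · rw [hq0]; exact S.ge_zero' _ _
  obtain ⟨m, c, hc, hm⟩ := S.exists_zpow_residue hz0 hq hq0
  have hord : ∀ l, 0 < S.ord l z → S.ord l q = m * S.ord l z := by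
    intro l hl
    have := (S.ord_eq_zero_of_residue hc (hm l hl)).2
    rw [S.ord_mul _ hq0 (zpow_ne_zero _ hz0), S.ord_zpow _ hz0] at this
    linarith
  rw [S.ge_iff _ hq0, hord _ hi] at h
  rw [S.ge_iff _ hq0, hord _ hj]
  have : n ≤ m := by
    by_contra hmn
    push Not at hmn
    have : m ≤ n - 1 := by omega
    nlinarith
  nlinarith

lemma exists_pow_mul_ge {q : F} (hq : q ∈ IntermediateField.adjoin k {z}) :
    ∃ m : ℕ, ∀ i, 0 < S.ord i z → S.Ge i 0 (z ^ m * q) := by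
  have hz0 : z ≠ 0 := by rintro rfl; exact hz ⟨0, map_zero _⟩
  by_cases hq0 : q = 0
  · exact ⟨0, fun i _ => by rw [hq0, mul_zero]; exact S.ge_zero' _ _⟩
  obtain ⟨m, c, hc, hm⟩ := S.exists_zpow_residue hz0 hq hq0
  refine ⟨m.natAbs, fun i hi => ?_⟩
  have := (S.ord_eq_zero_of_residue hc (hm i hi)).2
  rw [S.ord_mul _ hq0 (zpow_ne_zero _ hz0), S.ord_zpow _ hz0] at this
  rw [S.ge_iff _ (mul_ne_zero (pow_ne_zero _ hz0) hq0), S.ord_mul _ (pow_ne_zero _ hz0) hq0,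
    S.ord_pow _ hz0]
  have h1 : 0 ≤ (m.natAbs : ℤ) + m := by omega
  nlinarith

lemma exists_const_ge {q : F} (hq : q ∈ IntermediateField.adjoin k {z}) {i : ι}
    (hi : 0 < S.ord i z) (h : S.Ge i 0 q) :
    ∃ c : k, ∀ j, 0 < S.ord j z → S.Ge j (S.ord j z) (q - algebraMap k F c) := by
  obtain ⟨c, hc⟩ := S.exists_residue_ge i h
  refine ⟨c, fun j hj => ?_⟩
  have := S.ge_mul_ord_of_ge hz (sub_mem hq (IntermediateField.algebraMap_mem _ c)) hi (n := 1)
    (by simpa using hc) hj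
  simpa using this

end


section trace

variable {k F ι : Type*} [Field k] [IsAlgClosed k] [CharZero k] [Field F] [Algebra k F]
  (S : PlaceSystem k F ι) {z : F} (hz : z ∉ Set.range (algebraMap k F))
  {E : IntermediateField k F} (hE : E = IntermediateField.adjoin k {z})
include hz hE

-- The pulled-back ring is the valuation ring of `k(z)` at `z = 0`, and the places above it are
-- zeros of `z`; integrality is therefore regularity at these zeros.
omit [IsAlgClosed k] [CharZero k] in
lemma isIntegral_comap {i : ι} (hi : 0 < S.ord i z)
    [Algebra ((S.O i).comap (algebraMap E F)) F]
    [IsScalarTower ((S.O i).comap (algebraMap E F)) E F] {f : F}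
    (hf : ∀ j, 0 < S.ord j z → S.Ge j 0 f) :
    IsIntegral ((S.O i).comap (algebraMap E F)) f := by
  have hz0 : z ≠ 0 := by rintro rfl; exact hz ⟨0, map_zero _⟩
  have hzE : z ∈ E := hE ▸ IntermediateField.mem_adjoin_simple_self k z
  let B : Subalgebra k F := { (S.O i).toSubring with algebraMap_mem' := S.algebraMap_mem i }
  let R : Subalgebra k F := E.toSubalgebra ⊓ B
  have hint : IsIntegral R f := by
    rw [S.isIntegral_iff]
    intro j hj
    rw [← ge_zero_iff]
    apply hf
    have hzR : z ∈ R := ⟨hzE, (S.mem_iff i hz0).2 hi.le⟩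
    have hzj : z ∈ S.O j := hj hzR
    rw [← ge_zero_iff] at hzj
    obtain ⟨c, hc⟩ := S.exists_residue_ge j hzj
    by_cases hc0 : c = 0
    · rw [hc0, map_zero, sub_zero, S.ge_iff _ hz0] at hc
      omega
    -- If `z` had a nonzero value `c` at `j`, then `(z - c)⁻¹` would lie in `R`, since `z` vanishes
    -- at `i`, but would have a pole at `j`.
    · exfalso
      have h1 : S.Ge i 1 ((z - algebraMap k F c) - algebraMap k F (-c)) := by
        rw [map_neg, sub_neg_eq_add, sub_add_cancel]
        exact (S.ge_iff _ hz0 _).2 hi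
      obtain ⟨h2, h3⟩ := S.ord_eq_zero_of_residue (neg_ne_zero.2 hc0) h1
      have h4 : (z - algebraMap k F c)⁻¹ ∈ R :=
        ⟨E.inv_mem (sub_mem hzE (E.algebraMap_mem c)),
          (S.mem_iff i (inv_ne_zero h2)).2 (by rw [ord_inv, h3]; rfl)⟩
      have h5 := (S.mem_iff j (inv_ne_zero h2)).1 (hj h4)
      rw [ord_inv] at h5
      rw [S.ge_iff _ h2] at hc
      omega
  let φ : R →+* (S.O i).comap (algebraMap E F) :=
    { toFun := fun r => ⟨⟨r.1, r.2.1⟩, r.2.2⟩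
      map_one' := rfl
      map_mul' := fun _ _ => rfl
      map_zero' := rfl
      map_add' := fun _ _ => rfl }
  refine IsIntegral.map_of_comp_eq φ (RingHom.id F) ?_ hint
  ext r
  simp only [RingHom.comp_apply, RingHom.id_apply]
  rw [IsScalarTower.algebraMap_apply ((S.O i).comap (algebraMap E F)) E F]
  rfl

set_option maxHeartbeats 1000000 in
/-- A function with residues `0` and `1` over `z = 0`, not all zero, has a trace to `k(z)` that
does not vanish at `z = 0`. -/
theorem not_ge_one_trace {f : F} (hf : ∀ j, 0 < S.ord j z → S.Ge j 1 f ∨ S.Ge j 1 (f - 1))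
    {i : ι} (hi : 0 < S.ord i z) (hfi : S.Ge i 1 (f - 1)) :
    ¬ S.Ge i 1 (algebraMap E F (Algebra.trace E F f)) := by
  have : FiniteDimensional E F := by rw [hE]; exact S.finite_adjoin z hz
  let V := (S.O i).comap (algebraMap E F)
  let _ : Algebra V F := ((algebraMap E F).comp (algebraMap V E)).toAlgebra
  have htower : IsScalarTower V E F := IsScalarTower.of_algebraMap_eq fun _ => rfl
  have hfs : FaithfulSMul V F := (faithfulSMul_iff_algebraMap_injective V F).2
    ((algebraMap E F).injective.comp Subtype.val_injective)
  have hreg : ∀ j, 0 < S.ord j z → S.Ge j 0 f := by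
    intro j hj
    rcases hf j hj with h | h
    · exact h.mono zero_le_one
    · have := (h.mono zero_le_one).add (ge_algebraMap j 1)
      rwa [map_one, sub_add_cancel] at this
  have hint : IsIntegral V f := S.isIntegral_comap hz hE hi hreg
  -- membership in the maximal ideal of `V`
  have hmax : ∀ v : V, v ∈ IsLocalRing.maximalIdeal V ↔ S.Ge i 1 (algebraMap V F v) := by
    intro v
    by_cases hv : v = 0
    · subst hv
      simpa using S.ge_zero' i 1
    have hv' : algebraMap V F v ≠ 0 := by
      rwa [ne_eq, FaithfulSMul.algebraMap_eq_zero_iff]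
    have hvE : (v : E) ≠ 0 := fun h => hv (Subtype.ext h)
    rw [← ValuationSubring.coe_mem_nonunits_iff, ValuationSubring.mem_nonunits_iff_or,
      ValuationSubring.mem_comap, map_inv₀]
    have h1 : algebraMap E F (v : E) = algebraMap V F v := rfl
    have h2 := S.mem_iff i hv'
    have h3 := v.2
    rw [ValuationSubring.mem_comap, h1, h2] at h3
    rw [h1, S.mem_iff i (inv_ne_zero hv'), ord_inv, S.ge_iff i hv']
    simp only [hvE, false_or]
    omega
  let kV : k →+* V := (algebraMap k E).codRestrict V.toSubring fun c => by
    change algebraMap E F (algebraMap k E c) ∈ S.O i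
    exact S.algebraMap_mem i c
  have hkV : ∀ c, algebraMap V F (kV c) = algebraMap k F c := fun c => rfl
  let κ := IsLocalRing.ResidueField V
  let ρ₀ : V →+* κ := IsLocalRing.residue V
  have hρ₀ : ∀ v, ρ₀ v = 0 ↔ S.Ge i 1 (algebraMap V F v) := fun v => by
    rw [← hmax, IsLocalRing.residue_eq_zero_iff]
  have hsurj : Function.Surjective (ρ₀.comp kV) := by
    intro w
    obtain ⟨v, rfl⟩ := IsLocalRing.residue_surjective w
    have hv : S.Ge i 0 (algebraMap V F v) := by
      rw [ge_zero_iff]; exact v.2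
    obtain ⟨c, hc⟩ := S.exists_residue_ge i hv
    refine ⟨c, ?_⟩
    rw [eq_comm, ← sub_eq_zero, RingHom.comp_apply, ← map_sub]
    change ρ₀ _ = 0
    rw [hρ₀, map_sub, hkV]
    exact hc
  -- The residue field of `V` is `k`, so the reduced minimal polynomial of `f` splits.
  let e : k ≃+* κ := RingEquiv.ofBijective (ρ₀.comp kV) ⟨(ρ₀.comp kV).injective, hsurj⟩
  let ρ : V →+* k := (e.symm : κ →+* k).comp ρ₀
  have hρ : ∀ v, ρ v = 0 ↔ S.Ge i 1 (algebraMap V F v) := fun v => by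
    rw [← hρ₀]
    exact e.symm.map_eq_zero_iff
  have hρk : ∀ c, ρ (kV c) = c := fun c => e.symm_apply_apply c
  let μ : Polynomial V := minpoly V f
  have hμ : μ.Monic := minpoly.monic hint
  let μ' : Polynomial k := μ.map ρ
  have hμ' : μ'.Monic := hμ.map ρ
  -- For `c` other than `0` and `1`, `f - c` is a unit at all zeros of `z`, so the value of `μ` at
  -- `c` is a unit of `V` and does not reduce to zero.
  have hroots : ∀ w ∈ μ'.roots, w = 0 ∨ w = 1 := by
    intro c hw
    by_contra hcon
    push Not at hcon
    obtain ⟨hc0, hc1⟩ := hcon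
    have hunit : ∀ j, 0 < S.ord j z → f - algebraMap k F c ≠ 0 ∧
        S.ord j (f - algebraMap k F c) = 0 := by
      intro j hj
      rcases hf j hj with h | h
      · apply S.ord_eq_zero_of_residue (neg_ne_zero.2 hc0)
        rwa [map_neg, sub_neg_eq_add, sub_add_cancel]
      · apply S.ord_eq_zero_of_residue (sub_ne_zero.2 hc1.symm)
        rw [map_sub, map_one]
        convert h using 1
        ring
    have h1 : IsUnit (μ.eval (kV c)) := by
      apply isUnit_eval_minpoly_of_isIntegral_inv hint
      · rw [hkV]; exact (hunit i hi).1
      · rw [hkV]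
        apply S.isIntegral_comap hz hE hi
        intro j hj
        rw [S.ge_iff _ (inv_ne_zero (hunit j hj).1), ord_inv, (hunit j hj).2]
        rfl
    have h2 : μ'.eval c = 0 := (Polynomial.mem_roots'.1 hw).2
    rw [← hρk c, Polynomial.eval_map, Polynomial.eval₂_hom] at h2
    exact (h1.map ρ).ne_zero h2
  have hsplit : μ'.Splits := IsAlgClosed.splits μ'
  -- Were all roots zero, `μ` would reduce to a power of the variable and a power of `f` would
  -- vanish at `i`, where `f` has value `1`.
  have hne : ∃ w ∈ μ'.roots, w ≠ 0 := by
    by_contra hcon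
    push Not at hcon
    have h1 : μ' = Polynomial.X ^ μ'.natDegree := by
      have h2 := hsplit.eq_prod_roots_of_monic hμ'
      have h3 : μ'.roots = Multiset.replicate μ'.natDegree 0 :=
        Multiset.eq_replicate.2 ⟨hsplit.natDegree_eq_card_roots.symm, hcon⟩
      rw [h3] at h2
      simpa using h2
    -- hence a power of `f` vanishes at `i`
    have h4 : ∀ m, S.Ge i 1 (algebraMap V F ((μ - Polynomial.X ^ μ.natDegree).coeff m)) := by
      intro m
      rw [← hρ, ← Polynomial.coeff_map, Polynomial.map_sub, Polynomial.map_pow, Polynomial.map_X]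
      change (μ' - _).coeff m = 0
      have h5 : μ'.natDegree = μ.natDegree := hμ.natDegree_map ρ
      rw [← h5, ← h1, sub_self, Polynomial.coeff_zero]
    have h6 : Polynomial.aeval f (μ - Polynomial.X ^ μ.natDegree) = - f ^ μ.natDegree := by
      rw [map_sub, minpoly.aeval, map_pow, Polynomial.aeval_X, zero_sub]
    have h7 : S.Ge i 1 (Polynomial.aeval f (μ - Polynomial.X ^ μ.natDegree)) := by
      rw [Polynomial.aeval_eq_sum_range]
      refine Ge.sum fun m _ => ?_
      rw [Algebra.smul_def]
      simpa using (h4 m).mul ((hreg i hi).pow m)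
    rw [h6] at h7
    obtain ⟨h8, h9⟩ := S.ord_eq_zero_of_residue (i := i) (f := f) (one_ne_zero (α := k))
      (by simpa using hfi)
    have h10 := h7.neg
    rw [neg_neg, S.ge_iff _ (pow_ne_zero _ h8), S.ord_pow _ h8, h9] at h10
    simp at h10
  obtain ⟨r, hr, hr0⟩ := Multiset.exists_sum_eq_natCast_of_forall_eq_zero_or_one _ hroots
  have hnext : ρ μ.nextCoeff = - (r : k) := by
    have h1 := hsplit.nextCoeff_eq_neg_sum_roots_of_monic hμ'
    rw [hr] at h1
    rw [← h1]
    exact (Polynomial.nextCoeff_map_of_leadingCoeff_ne_zero ρ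
      (by rw [hμ.leadingCoeff, map_one]; exact one_ne_zero)).symm
  -- The trace is `[F : E(f)]` times the sum of the roots, so its residue is a product of two
  -- positive integers, nonzero in characteristic zero.
  have htr : Algebra.trace E F f = algebraMap V E
      (Module.finrank (IntermediateField.adjoin E {f}) F * -μ.nextCoeff) := by
    rw [trace_eq_finrank_mul_minpoly_nextCoeff]
    have h1 : minpoly E f = μ.map (algebraMap V E) :=
      minpoly.isIntegrallyClosed_eq_field_fractions E F hint
    rw [h1, Polynomial.nextCoeff_map (FaithfulSMul.algebraMap_injective V E), map_mul, map_neg,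
      map_natCast]
  rw [htr, ← IsScalarTower.algebraMap_apply V E F, ← hρ, map_mul, map_natCast, map_neg, hnext,
    neg_neg, ← Nat.cast_mul, Nat.cast_eq_zero, mul_eq_zero, not_or]
  exact ⟨Module.finrank_pos.ne', hr0 hne⟩

end trace

end PlaceSystem

namespace PlaceSystem

variable {k F ι : Type*} [Field k] [IsAlgClosed k] [CharZero k] [Field F] [Algebra k F]
  (S : PlaceSystem k F ι)

/-- Tameness: the dual, for the trace form over `k(z)`, of the functions regular over `z = 0`
consists of functions whose poles are of order less than the ramification index. -/
theorem ge_of_forall_ge_trace {z : F} (hz : z ∉ Set.range (algebraMap k F))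
    {E : IntermediateField k F} (hE : E = IntermediateField.adjoin k {z}) {y : F}
    (hy : ∀ b, (∀ j, 0 < S.ord j z → S.Ge j 0 b) →
      ∀ j, 0 < S.ord j z → S.Ge j 0 (algebraMap E F (Algebra.trace E F (y * b))))
    {i : ι} (hi : 0 < S.ord i z) : S.Ge i (1 - S.ord i z) y := by
  have hz0 : z ≠ 0 := by rintro rfl; exact hz ⟨0, map_zero _⟩
  have hzE : z ∈ E := hE ▸ IntermediateField.mem_adjoin_simple_self k z
  by_contra hcon
  have hy0 : y ≠ 0 := by rintro rfl; exact hcon (S.ge_zero' _ _)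
  rw [S.ge_iff i hy0] at hcon
  obtain ⟨T, hT, -⟩ := S.exists_sum_ord_eq_finrank hz
  have hzy := mul_ne_zero hz0 hy0
  -- If the claim fails, then `ord y ≤ -ord z` at `i`, so a function `b` of the order that makes `z
  -- * y * b` a unit at `i` is still regular there. At the other zeros of `z`, `b` is regular and `z
  -- * y * b` vanishes.
  obtain ⟨b, hb0, hbi, hbj⟩ := S.exists_ord_eq_and_ge i T (-S.ord i (z * y))
    (fun j => max 0 (1 - S.ord j (z * y)))
  have hf0 : S.ord i (z * y * b) = 0 := by rw [S.ord_mul i hzy hb0, hbi]; ring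
  have hfne := mul_ne_zero hzy hb0
  obtain ⟨c, hc⟩ := S.exists_residue_ge i ((S.ge_iff i hfne 0).2 hf0.ge)
  have hc0 : c ≠ 0 := by
    rintro rfl
    rw [map_zero, sub_zero, S.ge_iff i hfne] at hc
    omega
  have hcF : algebraMap k F c ≠ 0 := by simpa using hc0
  set b' := algebraMap k F c⁻¹ * b with hb'
  have hreg : ∀ j, 0 < S.ord j z → S.Ge j 0 b' := by
    intro j hj
    apply Ge.algebraMap_mul
    by_cases hji : j = i
    · subst hji
      rw [S.ge_iff _ hb0, hbi, S.ord_mul _ hz0 hy0]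
      omega
    · exact (hbj j ((hT j).2 hj) hji).mono (le_max_left _ _)
  have hfi : S.Ge i 1 (z * y * b' - 1) := by
    have h := hc.algebraMap_mul c⁻¹
    rw [mul_sub, ← map_mul, inv_mul_cancel₀ hc0, map_one] at h
    rw [hb']
    convert h using 1
    ring
  have hall : ∀ j, 0 < S.ord j z → S.Ge j 1 (z * y * b') ∨ S.Ge j 1 (z * y * b' - 1) := by
    intro j hj
    by_cases hji : j = i
    · subst hji; exact Or.inr hfi
    · left
      have h1 := (S.ge_ord j (z * y)).mul
        ((hbj j ((hT j).2 hj) hji).mono (le_max_right _ _))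
      have h2 := h1.algebraMap_mul c⁻¹
      rw [add_sub_cancel] at h2
      rw [hb']
      convert h2 using 1
      ring
  -- By linearity the trace of `z * y * b'` is `z` times a trace that is regular over `z = 0`, so it
  -- vanishes there.
  apply S.not_ge_one_trace hz hE hall hi hfi
  have h1 : z * y * b' = (⟨z, hzE⟩ : E) • (y * b') := by
    rw [Algebra.smul_def, mul_assoc]; rfl
  rw [h1, map_smul, smul_eq_mul, map_mul]
  have h2 := ((S.ge_iff i hz0 1).2 hi).mul (hy b' hreg i hi)
  simpa using h2

/-! ### Reduced bases over `k[x]`. -/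

section lattice

variable {x : F} (hx : x ∉ Set.range (algebraMap k F))
include hx

-- The functions in question form the integral closure of the principal ideal domain `k[x]` in `F`,
-- a free module of rank `[F : k(x)]`.
omit [IsAlgClosed k] in
lemma exists_span_regular : ∃ w : Fin (Module.finrank (IntermediateField.adjoin k {x}) F) → F,
    (∀ j i, 0 ≤ S.ord i x → S.Ge i 0 (w j)) ∧
    ∀ f, (∀ i, 0 ≤ S.ord i x → S.Ge i 0 f) →
      f ∈ Submodule.span (Algebra.adjoin k {x}) (Set.range w) := by
  open IntermediateField.algebraAdjoinAdjoin in
  have hx0 : x ≠ 0 := by rintro rfl; exact hx ⟨0, map_zero _⟩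
  let R := Algebra.adjoin k {x}
  let K := IntermediateField.adjoin k {x}
  let A := integralClosure R F
  have : FiniteDimensional K F := S.finite_adjoin x hx
  have : IsPrincipalIdealRing R := isPrincipalIdealRing_adjoin x
  have : CharZero K := charZero_of_injective_algebraMap (algebraMap k K).injective
  have hA : ∀ f, IsIntegral R f ↔ ∀ i, 0 ≤ S.ord i x → S.Ge i 0 f := by
    intro f
    rw [S.isIntegral_iff]
    refine forall_congr' fun i => ?_
    rw [S.adjoin_le_iff, S.mem_iff i hx0, ge_zero_iff]
  have hfree : Module.Free R A := IsIntegralClosure.module_free R K F A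
  have hfin : Module.Finite R A := IsIntegralClosure.finite R K F A
  have hrank : Module.finrank R A = Module.finrank K F := IsIntegralClosure.rank R K F A
  let b := Module.finBasisOfFinrankEq R A hrank
  refine ⟨fun j => (b j : F), fun j => (hA _).1 (b j).2, fun f hf => ?_⟩
  have h1 : (⟨f, (hA f).2 hf⟩ : A) ∈ Submodule.span R (Set.range b) := by
    rw [b.span_eq]; trivial
  have h2 := Submodule.mem_map_of_mem (f := A.val.toLinearMap.restrictScalars R) h1
  rw [Submodule.map_span, ← Set.range_comp] at h2
  exact h2

/-- A function is made regular outside the poles of `x`, without changing its order at the zeros of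
`x - a`, by a polynomial in `x`. -/
lemma exists_mul_regular (f : F) (a : k) : ∃ s ∈ Algebra.adjoin k {x}, s ≠ 0 ∧
    (∀ i, 0 < S.ord i (x - algebraMap k F a) → S.ord i s = 0) ∧
    ∀ i, 0 ≤ S.ord i x → (0 < S.ord i (x - algebraMap k F a) → S.Ge i 0 f) →
      S.Ge i 0 (s * f) := by
  classical
  have hx0 : x ≠ 0 := by rintro rfl; exact hx ⟨0, map_zero _⟩
  have hres : ∀ i, ∃ c, 0 ≤ S.ord i x → S.Ge i 1 (x - algebraMap k F c) := by
    intro i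
    by_cases h : 0 ≤ S.ord i x
    · obtain ⟨c, hc⟩ := S.exists_residue_ge i ((S.ge_iff i hx0 0).2 h)
      exact ⟨c, fun _ => hc⟩
    · exact ⟨0, fun h' => absurd h' h⟩
  choose r hr using hres
  have hxr : ∀ c, x - algebraMap k F c ≠ 0 := fun c h => hx ⟨c, (sub_eq_zero.1 h).symm⟩
  have hR : ∀ c, x - algebraMap k F c ∈ Algebra.adjoin k {x} := fun c =>
    sub_mem (Algebra.self_mem_adjoin_singleton k x) ((Algebra.adjoin k {x}).algebraMap_mem c)
  -- With `r j` the value of `x` at `j`, the factor `(x - r j) ^ |ord f|` clears a pole of `f` at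
  -- `j`; places over `a` are left out, so `s` is a unit there.
  let T := (S.finite_setOf_ord_ne_zero f).toFinset.filter (fun i => 0 ≤ S.ord i x ∧ r i ≠ a)
  have hfac : ∀ j, (x - algebraMap k F (r j)) ^ (S.ord j f).natAbs ≠ 0 := fun j =>
    pow_ne_zero _ (hxr _)
  refine ⟨∏ j ∈ T, (x - algebraMap k F (r j)) ^ (S.ord j f).natAbs,
    prod_mem fun j _ => pow_mem (hR _) _, Finset.prod_ne_zero_iff.2 fun j _ => hfac j,
    fun i hi => ?_, fun i hi hia => ?_⟩
  · have hprod : ∀ U ⊆ T, S.ord i (∏ j ∈ U, (x - algebraMap k F (r j)) ^ (S.ord j f).natAbs) = 0 := by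
      intro U
      induction U using Finset.induction_on with
      | empty => simp
      | insert b U hb ih =>
        intro hU
        rw [Finset.prod_insert hb, S.ord_mul i (hfac b) (Finset.prod_ne_zero_iff.2 fun j _ => hfac j),
          ih fun j hj => hU (Finset.mem_insert_of_mem hj), S.ord_pow i (hxr _), add_zero]
        have hbT := (Finset.mem_filter.1 (hU (Finset.mem_insert_self b U))).2.2
        have h1 : S.Ge i 1 (x - algebraMap k F (r b) - algebraMap k F (a - r b)) := by
          have := (S.ge_iff i (hxr a) 1).2 hi
          rw [map_sub]
          convert this using 1
          ring
        rw [(S.ord_eq_zero_of_residue (sub_ne_zero.2 hbT.symm) h1).2, mul_zero]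
    exact hprod T subset_rfl
  · by_cases hf0 : f = 0
    · rw [hf0, mul_zero]; exact S.ge_zero' _ _
    have hreg : ∀ j, S.Ge i 0 ((x - algebraMap k F (r j)) ^ (S.ord j f).natAbs) := by
      intro j
      rw [ge_zero_iff]
      exact (S.adjoin_le_iff i x).2 ((S.mem_iff i hx0).2 hi) (pow_mem (hR _) _)
    have hregp : ∀ U : Finset ι,
        S.Ge i 0 (∏ j ∈ U, (x - algebraMap k F (r j)) ^ (S.ord j f).natAbs) := by
      intro U
      rw [ge_zero_iff]
      exact prod_mem fun j _ => (S.ge_zero_iff _ _).1 (hreg j)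
    by_cases hiT : i ∈ T
    · rw [← Finset.mul_prod_erase T _ hiT]
      have h1 : S.Ge i ((S.ord i f).natAbs * 1) ((x - algebraMap k F (r i)) ^ (S.ord i f).natAbs) :=
        (hr i hi).pow _
      have h2 := (h1.mul (hregp (T.erase i))).mul (S.ge_ord i f)
      refine h2.mono ?_
      omega
    · have h1 : S.Ge i 0 f := by
        by_cases hri : r i = a
        · apply hia
          have := hr i hi
          rw [hri] at this
          exact (S.ge_iff i (hxr a) 1).1 this
        · rw [S.ge_iff i hf0]
          have : S.ord i f = 0 := by
            by_contra hne
            exact hiT (Finset.mem_filter.2 ⟨by simpa using hne, hi, hri⟩)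
          rw [this]
      simpa using (hregp T).mul h1

open IntermediateField.algebraAdjoinAdjoin in
/-- A spanning family of the functions regular away from the poles of `x` is a basis over
`k(x)`. -/
lemma exists_basis {w : Fin (Module.finrank (IntermediateField.adjoin k {x}) F) → F}
    (hw : ∀ f, (∀ i, 0 ≤ S.ord i x → S.Ge i 0 f) →
      f ∈ Submodule.span (Algebra.adjoin k {x}) (Set.range w)) :
    ∃ b : Module.Basis (Fin (Module.finrank (IntermediateField.adjoin k {x}) F))
      (IntermediateField.adjoin k {x}) F, ⇑b = w := by
  classical
  have hx0 : x ≠ 0 := by rintro rfl; exact hx ⟨0, map_zero _⟩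
  have hfin := S.finite_adjoin x hx
  have hspan : ⊤ ≤ Submodule.span (IntermediateField.adjoin k {x}) (Set.range w) := by
    intro f _
    have hres : ∀ i, ∃ c, 0 ≤ S.ord i x → S.Ge i 1 (x - algebraMap k F c) := by
      intro i
      by_cases h : 0 ≤ S.ord i x
      · obtain ⟨c, hc⟩ := S.exists_residue_ge i ((S.ge_iff i hx0 0).2 h)
        exact ⟨c, fun _ => hc⟩
      · exact ⟨0, fun h' => absurd h' h⟩
    choose r hr using hres
    -- For `a` outside the values of `x` at the zeros and poles of `f`, `f` is regular over `a`, and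
    -- the polynomial `s` clears all its other finite poles.
    obtain ⟨a, ha⟩ := Infinite.exists_notMem_finset
      ((S.finite_setOf_ord_ne_zero f).toFinset.image r)
    obtain ⟨s, hs, hs0, -, h⟩ := S.exists_mul_regular hx f a
    have hxa : x - algebraMap k F a ≠ 0 := fun h => hx ⟨a, (sub_eq_zero.1 h).symm⟩
    have h1 : s * f ∈ Submodule.span (Algebra.adjoin k {x}) (Set.range w) := by
      refine hw _ fun i hi => h i hi fun hia => ?_
      by_contra hcon
      apply ha
      refine Finset.mem_image.2 ⟨i, ?_, S.residue_unique i (hr i hi) ((S.ge_iff i hxa 1).2 hia)⟩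
      by_cases hf0 : f = 0
      · exact absurd (hf0 ▸ S.ge_zero' i 0) hcon
      rw [S.ge_iff i hf0] at hcon
      simp only [Set.Finite.mem_toFinset, Set.mem_ofPred_eq]
      omega
    have h2 := Submodule.span_le_restrictScalars (Algebra.adjoin k {x})
      (IntermediateField.adjoin k {x}) (Set.range w) h1
    rw [Submodule.restrictScalars_mem] at h2
    have hsK : s ∈ IntermediateField.adjoin k {x} :=
      IntermediateField.algebra_adjoin_le_adjoin k {x} hs
    have h3 := Submodule.smul_mem _ (⟨s, hsK⟩⁻¹ : IntermediateField.adjoin k {x}) h2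
    rw [Algebra.smul_def, map_inv₀] at h3
    have h4 : algebraMap (IntermediateField.adjoin k {x}) F ⟨s, hsK⟩ = s := rfl
    rwa [h4, inv_mul_cancel_left₀ hs0] at h3
  have hli := linearIndependent_of_top_le_span_of_card_eq_finrank hspan (by simp)
  exact ⟨Module.Basis.mk hli hspan, Module.Basis.coe_mk hli hspan⟩


/-- The functions regular away from the poles of `x` have a basis over `k[x]` which becomes, after
multiplication with powers of `1 / x`, a basis modulo `1 / x` of the functions regular at the
poles of `x`. -/
theorem exists_reduced_span : ∃ (w : Fin (Module.finrank (IntermediateField.adjoin k {x}) F) → F)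
    (N : Fin (Module.finrank (IntermediateField.adjoin k {x}) F) → ℕ),
    (∀ j i, 0 ≤ S.ord i x → S.Ge i 0 (w j)) ∧
    (∀ f, (∀ i, 0 ≤ S.ord i x → S.Ge i 0 f) →
      f ∈ Submodule.span (Algebra.adjoin k {x}) (Set.range w)) ∧
    (∀ j i, S.ord i x < 0 → S.Ge i (N j * S.ord i x) (w j)) ∧
    ∀ c : Fin (Module.finrank (IntermediateField.adjoin k {x}) F) → k,
      (∀ i, S.ord i x < 0 → S.Ge i (-S.ord i x) (∑ j, algebraMap k F (c j) * (w j * (x ^ N j)⁻¹))) →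
      c = 0 := by
  classical
  have hx0 : x ≠ 0 := by rintro rfl; exact hx ⟨0, map_zero _⟩
  set n := Module.finrank (IntermediateField.adjoin k {x}) F with hn
  -- A spanning family with the sum of the pole bounds minimal is reduced: a relation modulo `1 / x`
  -- would allow one bound to be lowered.
  let P : ℕ → Prop := fun s => ∃ (w : Fin n → F) (N : Fin n → ℕ),
    (∀ j i, 0 ≤ S.ord i x → S.Ge i 0 (w j)) ∧
    (∀ f, (∀ i, 0 ≤ S.ord i x → S.Ge i 0 f) →
      f ∈ Submodule.span (Algebra.adjoin k {x}) (Set.range w)) ∧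
    (∀ j i, S.ord i x < 0 → S.Ge i (N j * S.ord i x) (w j)) ∧ ∑ j, N j = s
  have hP : ∃ s, P s := by
    obtain ⟨w, h1, h2⟩ := S.exists_span_regular hx
    obtain ⟨T, hT, -⟩ := S.exists_sum_neg_ord_eq_finrank hx
    refine ⟨_, w, fun j => ∑ i ∈ T, (S.ord i (w j)).natAbs, h1, h2, fun j i hi => ?_, rfl⟩
    refine (S.ge_ord i (w j)).mono ?_
    have h3 := Finset.single_le_sum (f := fun i => (S.ord i (w j)).natAbs)
      (fun _ _ => Nat.zero_le _) ((hT i).2 hi)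
    have h4 : ((S.ord i (w j)).natAbs : ℤ) ≤ ((∑ i ∈ T, (S.ord i (w j)).natAbs : ℕ) : ℤ) := by
      exact_mod_cast h3
    have h5 : -((S.ord i (w j)).natAbs : ℤ) ≤ S.ord i (w j) := by omega
    nlinarith
  obtain ⟨w, N, h1, h2, h3, h4⟩ := Nat.find_spec hP
  refine ⟨w, N, h1, h2, h3, fun c hc => ?_⟩
  by_contra hc0
  have hne : (Finset.univ.filter fun j => c j ≠ 0).Nonempty := by
    by_contra hcon
    rw [Finset.not_nonempty_iff_eq_empty, Finset.filter_eq_empty_iff] at hcon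
    exact hc0 (funext fun j => not_not.1 (hcon (Finset.mem_univ j)))
  obtain ⟨l, hl, hmax⟩ := Finset.exists_max_image _ N hne
  rw [Finset.mem_filter] at hl
  have hmax' : ∀ j, c j ≠ 0 → N j ≤ N l := fun j hj =>
    hmax j (Finset.mem_filter.2 ⟨Finset.mem_univ _, hj⟩)
  -- Homogenizing the relation to the largest `N l` with `c l ≠ 0` gives a function `v` with pole
  -- bound `N l - 1` that can replace `w l` as a generator.
  set v := ∑ j, algebraMap k F (c j) * (x ^ (N l - N j) * w j) with hv
  have hvx : v * (x ^ N l)⁻¹ = ∑ j, algebraMap k F (c j) * (w j * (x ^ N j)⁻¹) := by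
    rw [hv, Finset.sum_mul]
    refine Finset.sum_congr rfl fun j _ => ?_
    by_cases hj : c j = 0
    · simp [hj]
    · have : x ^ N l = x ^ (N l - N j) * x ^ N j := by
        rw [← pow_add, Nat.sub_add_cancel (hmax' j hj)]
      rw [this]
      field_simp
  have hvfin : ∀ i, 0 ≤ S.ord i x → S.Ge i 0 v := by
    intro i hi
    refine Ge.sum fun j _ => Ge.algebraMap_mul ?_ _
    have := (((S.ge_iff i hx0 0).2 hi).pow (N l - N j)).mul (h1 j i hi)
    simpa using this
  have hvinf : ∀ i, S.ord i x < 0 → S.Ge i (-S.ord i x + N l * S.ord i x) v := by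
    intro i hi
    have := (hc i hi).mul ((S.ge_ord i x).pow (N l))
    rw [← hvx, inv_mul_cancel_right₀ (pow_ne_zero _ hx0)] at this
    exact this
  -- Nothing can be lowered if `N l = 0`; but then `v` is regular everywhere and vanishes at the
  -- poles of `x`, so `v = 0`, against linear independence.
  by_cases hNl : N l = 0
  · obtain ⟨i₀, hi₀⟩ := S.exists_ord_neg hx
    have hv0 : v = 0 := by
      refine S.eq_zero_of_forall_ge (fun i => ?_) (i := i₀) ?_
      · by_cases hi : 0 ≤ S.ord i x
        · exact hvfin i hi
        · refine (hvinf i (by omega)).mono ?_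
          rw [hNl]; push_cast; omega
      · refine (hvinf i₀ hi₀).mono ?_
        rw [hNl]; push_cast; omega
    obtain ⟨b, rfl⟩ := S.exists_basis hx h2
    have hli := Fintype.linearIndependent_iff.1 b.linearIndependent
      (fun j => ⟨algebraMap k F (c j) * x ^ (N l - N j),
        mul_mem (IntermediateField.algebraMap_mem _ _)
          (pow_mem (IntermediateField.mem_adjoin_simple_self k x) _)⟩)
    have h5 := hli (by
      rw [← hv0, hv]
      refine Finset.sum_congr rfl fun j _ => ?_
      rw [Algebra.smul_def, ← mul_assoc]
      rfl) l
    have h6 := congrArg (algebraMap (IntermediateField.adjoin k {x}) F) h5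
    rw [map_zero] at h6
    have h7 : algebraMap k F (c l) * x ^ (N l - N l) = 0 := h6
    rw [Nat.sub_self, pow_zero, mul_one] at h7
    exact hl.2 (by simpa using h7)
  · refine Nat.find_min hP (m := ∑ j, Function.update N l (N l - 1) j) ?_
      ⟨Function.update w l v, Function.update N l (N l - 1), ?_, ?_, ?_, rfl⟩
    · rw [← h4]
      apply Finset.sum_lt_sum
      · intro j _
        by_cases hj : j = l
        · subst hj; simp
        · simp [hj]
      · exact ⟨l, Finset.mem_univ _, by simp; omega⟩
    · intro j i hi
      by_cases hj : j = l
      · subst hj; simpa using hvfin i hi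
      · simpa [hj] using h1 j i hi
    · intro f hf
      refine Submodule.span_le.2 ?_ (h2 f hf)
      rintro _ ⟨j, rfl⟩
      have hmem : ∀ m, m ≠ l → w m ∈ Submodule.span (Algebra.adjoin k {x})
          (Set.range (Function.update w l v)) := fun m hm =>
        Submodule.subset_span ⟨m, by simp [hm]⟩
      have hvm : v ∈ Submodule.span (Algebra.adjoin k {x})
          (Set.range (Function.update w l v)) := Submodule.subset_span ⟨l, by simp⟩
      by_cases hj : j = l
      · subst hj
        have hsplit : w j = algebraMap k F (c j)⁻¹ *
            (v - ∑ m ∈ Finset.univ.erase j, algebraMap k F (c m) * (x ^ (N j - N m) * w m)) := by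
          rw [hv, ← Finset.add_sum_erase _ _ (Finset.mem_univ j)]
          simp only [Nat.sub_self, pow_zero, one_mul, add_sub_cancel_right]
          rw [← mul_assoc, ← map_mul, inv_mul_cancel₀ hl.2, map_one, one_mul]
        have hsm : ∀ (r : F) (hr : r ∈ Algebra.adjoin k {x}) (g : F), g ∈ Submodule.span
            (Algebra.adjoin k {x}) (Set.range (Function.update w j v)) → r * g ∈ Submodule.span
            (Algebra.adjoin k {x}) (Set.range (Function.update w j v)) := fun r hr g hg =>
          Submodule.smul_mem _ (⟨r, hr⟩ : Algebra.adjoin k {x}) hg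
        rw [SetLike.mem_coe, hsplit]
        refine hsm _ ((Algebra.adjoin k {x}).algebraMap_mem _) _ (sub_mem hvm (sum_mem fun m hm => ?_))
        exact hsm _ ((Algebra.adjoin k {x}).algebraMap_mem _) _
          (hsm _ (pow_mem (Algebra.self_mem_adjoin_singleton k x) _) _
            (hmem m (Finset.ne_of_mem_erase hm)))
      · exact hmem j hj
    · intro j i hi
      by_cases hj : j = l
      · subst hj
        simp only [Function.update_self]
        refine (hvinf i hi).mono (le_of_eq ?_)
        rw [Nat.cast_sub (by omega)]
        push_cast
        ring
      · simpa [hj] using h3 j i hi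

end lattice

end PlaceSystem

/-! ### The trace-dual basis and regular differentials. -/

lemma trace_traceDual_mul_eq_repr {K L α : Type*} [Field K] [Field L] [Algebra K L]
    [FiniteDimensional K L] [Algebra.IsSeparable K L] [Finite α] [DecidableEq α]
    (b : Module.Basis α K L) (l : α) (f : L) :
    Algebra.trace K L (b.traceDual l * f) = b.repr f l := by
  have := Fintype.ofFinite α
  conv_lhs => rw [← b.sum_repr f]
  rw [Finset.mul_sum, map_sum]
  simp only [mul_smul_comm, map_smul, Module.Basis.trace_traceDual_mul, smul_eq_mul]
  simp

namespace PlaceSystem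

variable {k F ι : Type*} [Field k] [IsAlgClosed k] [CharZero k] [Field F] [Algebra k F]
  (S : PlaceSystem k F ι) {x : F} (hx : x ∉ Set.range (algebraMap k F))
  (b : Module.Basis (Fin (Module.finrank (IntermediateField.adjoin k {x}) F))
    (IntermediateField.adjoin k {x}) F)
include hx

-- A polynomial in `x` that is a unit over `a` carries `f` into the `k[x]`-span, where coordinates
-- are polynomials in `x`.
open IntermediateField.algebraAdjoinAdjoin in
lemma ge_repr_of_ge
    (hb : ∀ f, (∀ i, 0 ≤ S.ord i x → S.Ge i 0 f) →
      f ∈ Submodule.span (Algebra.adjoin k {x}) (Set.range b))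
    {f : F} {a : k} (hf : ∀ i, 0 < S.ord i (x - algebraMap k F a) → S.Ge i 0 f) (l)
    {i : ι} (hi : 0 < S.ord i (x - algebraMap k F a)) :
    S.Ge i 0 (algebraMap (IntermediateField.adjoin k {x}) F (b.repr f l)) := by
  have hx0 : x ≠ 0 := by rintro rfl; exact hx ⟨0, map_zero _⟩
  obtain ⟨s, hs, hs0, hs1, h⟩ := S.exists_mul_regular hx f a
  have hsf := hb (s * f) fun i hi => h i hi (hf i)
  have h1 := (b.mem_span_iff_repr_mem (Algebra.adjoin k {x}) (s * f)).1 hsf l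
  obtain ⟨r, hr⟩ := h1
  have hsK : s ∈ IntermediateField.adjoin k {x} :=
    IntermediateField.algebra_adjoin_le_adjoin k {x} hs
  have h2 : s * f = (⟨s, hsK⟩ : IntermediateField.adjoin k {x}) • f := rfl
  rw [h2, map_smul, Finsupp.smul_apply, smul_eq_mul] at hr
  have h3 := congrArg (algebraMap (IntermediateField.adjoin k {x}) F) hr
  rw [map_mul] at h3
  have h4 : (r : F) = s * algebraMap (IntermediateField.adjoin k {x}) F (b.repr f l) := h3
  have h5 : algebraMap (IntermediateField.adjoin k {x}) F (b.repr f l) = s⁻¹ * r := by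
    rw [h4, inv_mul_cancel_left₀ hs0]
  have h6 : S.Ge i 0 x := by
    have h7 : x - algebraMap k F a ≠ 0 := fun h => hx ⟨a, (sub_eq_zero.1 h).symm⟩
    have := ((S.ge_iff i h7 0).2 hi.le).add (ge_algebraMap i a)
    rwa [sub_add_cancel] at this
  have h8 : S.Ge i 0 (r : F) := by
    rw [ge_zero_iff] at h6 ⊢
    exact (S.adjoin_le_iff i x).2 h6 r.2
  have h9 : S.Ge i 0 s⁻¹ := by rw [S.ge_iff i (inv_ne_zero hs0), ord_inv, hs1 i hi]; rfl
  rw [h5]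
  simpa using h9.mul h8

-- The counterpart at infinity. Take the least power `m` of `1 / x` that makes all rescaled
-- coordinates regular. If `m > 0`, their constant terms satisfy a relation excluded by `hred`,
-- hence vanish, and a smaller power would do.
omit [CharZero k] [IsAlgClosed k] in
lemma ge_pow_mul_repr_of_ge
    (N : Fin (Module.finrank (IntermediateField.adjoin k {x}) F) → ℕ)
    (hN : ∀ j i, S.ord i x < 0 → S.Ge i (N j * S.ord i x) (b j))
    (hred : ∀ c : Fin (Module.finrank (IntermediateField.adjoin k {x}) F) → k,
      (∀ i, S.ord i x < 0 → S.Ge i (-S.ord i x) (∑ j, algebraMap k F (c j) * (b j * (x ^ N j)⁻¹))) →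
      c = 0)
    {f : F} (hf : ∀ i, S.ord i x < 0 → S.Ge i 0 f) (l) {i : ι} (hi : S.ord i x < 0) :
    S.Ge i 0 (x ^ N l * algebraMap (IntermediateField.adjoin k {x}) F (b.repr f l)) := by
  classical
  have hx0 : x ≠ 0 := by rintro rfl; exact hx ⟨0, map_zero _⟩
  have hxi := inv_notMem_range_algebraMap hx
  set q : Fin (Module.finrank (IntermediateField.adjoin k {x}) F) → F := fun l =>
    x ^ N l * algebraMap (IntermediateField.adjoin k {x}) F (b.repr f l) with hq
  have hqE : ∀ j, q j ∈ IntermediateField.adjoin k {x⁻¹} := by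
    intro j
    rw [adjoin_inv_eq]
    exact mul_mem (pow_mem (IntermediateField.mem_adjoin_simple_self k x) _) (b.repr f j).2
  have hfq : f = ∑ j, q j * (b j * (x ^ N j)⁻¹) := by
    conv_lhs => rw [← b.sum_repr f]
    refine Finset.sum_congr rfl fun j _ => ?_
    rw [Algebra.smul_def, hq]
    field_simp
  have hpos : ∀ j, 0 < S.ord j x⁻¹ ↔ S.ord j x < 0 := fun j => by rw [ord_inv]; omega
  have hex : ∃ m : ℕ, ∀ j i, S.ord i x < 0 → S.Ge i 0 ((x⁻¹) ^ m * q j) := by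
    choose M hM using fun j => S.exists_pow_mul_ge hxi (hqE j)
    refine ⟨∑ j, M j, fun j i hi => ?_⟩
    have h1 : M j ≤ ∑ j, M j := Finset.single_le_sum (fun _ _ => Nat.zero_le _) (Finset.mem_univ j)
    have h2 : (x⁻¹) ^ (∑ j, M j) * q j = (x⁻¹) ^ (∑ j, M j - M j) * ((x⁻¹) ^ M j * q j) := by
      rw [← mul_assoc (x⁻¹ ^ (∑ j, M j - M j)), ← pow_add, Nat.sub_add_cancel h1]
    rw [h2]
    have h3 : S.Ge i 0 x⁻¹ := (S.ge_iff i (inv_ne_zero hx0) 0).2 ((hpos i).2 hi).le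
    simpa using (h3.pow (∑ j, M j - M j)).mul (hM j i ((hpos i).2 hi))
  suffices h : Nat.find hex = 0 by
    have := Nat.find_spec hex l i hi
    rwa [h, pow_zero, one_mul] at this
  by_contra hm
  set m := Nat.find hex with hmdef
  have hspec : ∀ j i, S.ord i x < 0 → S.Ge i 0 ((x⁻¹) ^ m * q j) := Nat.find_spec hex
  have hmE : ∀ j, (x⁻¹) ^ m * q j ∈ IntermediateField.adjoin k {x⁻¹} := fun j =>
    mul_mem (pow_mem (IntermediateField.mem_adjoin_simple_self k _) _) (hqE j)
  choose c hc using fun j => S.exists_const_ge hxi (hmE j) ((hpos i).2 hi) (hspec j i hi)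
  have hbj : ∀ j i, S.ord i x < 0 → S.Ge i 0 (b j * (x ^ N j)⁻¹) := by
    intro j i hi
    have h1 := (hN j i hi).mul (S.ge_ord i (x ^ N j)⁻¹)
    rw [ord_inv, S.ord_pow i hx0] at h1
    simpa using h1
  have hc0 : c = 0 := by
    apply hred
    intro i hi
    have h1 : ∑ j, algebraMap k F (c j) * (b j * (x ^ N j)⁻¹) = (x⁻¹) ^ m * f -
        ∑ j, ((x⁻¹) ^ m * q j - algebraMap k F (c j)) * (b j * (x ^ N j)⁻¹) := by
      conv_rhs => rw [hfq]
      rw [Finset.mul_sum, ← Finset.sum_sub_distrib]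
      refine Finset.sum_congr rfl fun j _ => ?_
      ring
    rw [h1]
    refine Ge.sub ?_ (Ge.sum fun j _ => ?_)
    · have h2 := ((S.ge_ord i x⁻¹).pow m).mul (hf i hi)
      refine h2.mono ?_
      rw [ord_inv]
      have : (1 : ℤ) ≤ m := by omega
      nlinarith
    · have h2 := (hc j i ((hpos i).2 hi)).mul (hbj j i hi)
      rwa [ord_inv, add_zero] at h2
  refine Nat.find_min hex (m := m - 1) (by omega) fun j i hi => ?_
  have h1 := hc j i ((hpos i).2 hi)
  rw [hc0, Pi.zero_apply, map_zero, sub_zero] at h1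
  have h2 := h1.mul (S.ge_ord i x)
  rw [ord_inv, neg_add_cancel] at h2
  have h3 : x⁻¹ ^ m * q j * x = x⁻¹ ^ (m - 1) * q j := by
    obtain ⟨m', hm'⟩ : ∃ m', m = m' + 1 := ⟨m - 1, by omega⟩
    rw [hm', Nat.add_sub_cancel, pow_succ]
    field_simp
  rwa [h3] at h2

/-- If no nonzero function `y` satisfies the conditions that express regularity of `y dx`, then
some family of generators of the functions regular away from the poles of `x` has poles bounded by
those of `x`. -/
lemma exists_basis_ge_ord
    (hreg : ∀ y : F, (∀ a i, 0 < S.ord i (x - algebraMap k F a) →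
        S.Ge i (1 - S.ord i (x - algebraMap k F a)) y) →
      (∀ i, S.ord i x < 0 → S.Ge i (1 - S.ord i x) y) → y = 0) :
    ∃ (b : Module.Basis (Fin (Module.finrank (IntermediateField.adjoin k {x}) F))
      (IntermediateField.adjoin k {x}) F) (l : Fin (Module.finrank (IntermediateField.adjoin k {x}) F)),
      (∀ j i, 0 ≤ S.ord i x → S.Ge i 0 (b j)) ∧ (∀ j i, S.ord i x < 0 → S.Ge i (S.ord i x) (b j)) ∧
      ∀ i, S.Ge i 0 (b l) := by
  classical
  have hx0 : x ≠ 0 := by rintro rfl; exact hx ⟨0, map_zero _⟩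
  obtain ⟨w, N, h1, h2, h3, h4⟩ := S.exists_reduced_span hx
  obtain ⟨b, rfl⟩ := S.exists_basis hx h2
  have hfin := S.finite_adjoin x hx
  have : CharZero (IntermediateField.adjoin k {x}) :=
    charZero_of_injective_algebraMap (algebraMap k (IntermediateField.adjoin k {x})).injective
  -- Otherwise the dual vector of `b l` is a nonzero `y` as in `hreg`. At infinity tameness bounds
  -- `x ^ N l * y`, and dividing by `x ^ N l` with `N l ≥ 2` gives order at least `1 - ord x`.
  have hN : ∀ j, N j ≤ 1 := by
    intro l
    by_contra hl
    have hy : b.traceDual l = 0 := by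
      apply hreg
      · intro a i hi
        refine S.ge_of_forall_ge_trace (sub_algebraMap_notMem_range hx a)
          (adjoin_sub_algebraMap_eq x a).symm (fun f hf j hj => ?_) hi
        rw [trace_traceDual_mul_eq_repr]
        exact S.ge_repr_of_ge hx b h2 hf l hj
      · intro i hi
        have hxi : 0 < S.ord i x⁻¹ := by rw [ord_inv]; omega
        have h5 : S.Ge i (1 - S.ord i x⁻¹) (x ^ N l * b.traceDual l) := by
          refine S.ge_of_forall_ge_trace (inv_notMem_range_algebraMap hx)
            (adjoin_inv_eq x).symm (fun f hf j hj => ?_) hxi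
          have h6 : x ^ N l * b.traceDual l * f =
              (IntermediateField.AdjoinSimple.gen k x ^ N l) • (b.traceDual l * f) := by
            rw [Algebra.smul_def, mul_assoc, map_pow, IntermediateField.AdjoinSimple.algebraMap_gen]
          rw [h6, map_smul, trace_traceDual_mul_eq_repr, smul_eq_mul, map_mul, map_pow,
            IntermediateField.AdjoinSimple.algebraMap_gen]
          refine S.ge_pow_mul_repr_of_ge hx b N h3 h4 (fun i hi => hf i ?_) l ?_
          · rw [ord_inv]; omega
          · rw [ord_inv] at hj; omega
        have h6 := h5.mul (S.ge_ord i (x ^ N l)⁻¹)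
        have h7 : x ^ N l * b.traceDual l * (x ^ N l)⁻¹ = b.traceDual l := by
          field_simp
        rw [h7] at h6
        refine h6.mono ?_
        rw [ord_inv, ord_inv, S.ord_pow i hx0]
        have : (2 : ℤ) ≤ N l := by omega
        nlinarith
    exact b.traceDual.ne_zero l hy
  -- If all bounds were positive, the coordinates of `1` would be regular everywhere and vanish at
  -- infinity, hence be zero.
  have hl : ∃ l, N l = 0 := by
    by_contra hcon
    push Not at hcon
    have hrepr : ∀ l, algebraMap (IntermediateField.adjoin k {x}) F (b.repr 1 l) = 0 := by
      intro l
      obtain ⟨i₀, hi₀⟩ := S.exists_ord_neg hx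
      have hone : ∀ i, S.Ge i 0 (1 : F) := fun i => by rw [ge_zero_iff]; exact (S.O i).one_mem
      have hinf : ∀ i, S.ord i x < 0 →
          S.Ge i 1 (algebraMap (IntermediateField.adjoin k {x}) F (b.repr 1 l)) := by
        intro i hi
        have h5 := S.ge_pow_mul_repr_of_ge hx b N h3 h4 (f := 1) (fun i _ => hone i) l hi
        have h6 := h5.mul (S.ge_ord i (x ^ N l)⁻¹)
        have h7 : ∀ g : F, x ^ N l * g * (x ^ N l)⁻¹ = g := fun g => by field_simp
        rw [h7] at h6
        refine h6.mono ?_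
        rw [ord_inv, S.ord_pow i hx0]
        have : (1 : ℤ) ≤ N l := by have := hcon l; omega
        nlinarith
      refine S.eq_zero_of_forall_ge (fun i => ?_) (hinf i₀ hi₀)
      by_cases hi : 0 ≤ S.ord i x
      · obtain ⟨a, ha⟩ := S.exists_residue_ge i ((S.ge_iff i hx0 0).2 hi)
        have hxa : x - algebraMap k F a ≠ 0 := fun h => hx ⟨a, (sub_eq_zero.1 h).symm⟩
        exact S.ge_repr_of_ge hx b h2 (a := a) (fun i _ => hone i) l ((S.ge_iff i hxa 1).1 ha)
      · exact (hinf i (by omega)).mono zero_le_one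
    have : (1 : F) = 0 := by
      rw [← b.sum_repr 1]
      refine Finset.sum_eq_zero fun j _ => ?_
      rw [Algebra.smul_def, hrepr j, zero_mul]
    exact one_ne_zero this
  obtain ⟨l, hl⟩ := hl
  refine ⟨b, l, h1, fun j i hi => (h3 j i hi).mono ?_, fun i => ?_⟩
  · have : (N j : ℤ) ≤ 1 := by exact_mod_cast hN j
    nlinarith
  · by_cases hi : 0 ≤ S.ord i x
    · exact h1 l i hi
    · have := h3 l i (by omega)
      rw [hl] at this
      simpa using this

end PlaceSystem

/-! ### Linear systems and functions with one simple pole. -/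

namespace PlaceSystem

section
variable {k F ι : Type*} [Field k] [Field F] [Algebra k F] (S : PlaceSystem k F ι)

/-- The functions of order at least `n` at the place `i`. -/
def geSubmodule (i : ι) (n : ℤ) : Submodule k F where
  carrier := {f | S.Ge i n f}
  add_mem' := fun hf hg => Ge.add hf hg
  zero_mem' := S.ge_zero' i n
  smul_mem' := fun c f hf => by
    rw [Algebra.smul_def]
    exact Ge.algebraMap_mul hf c

@[simp] lemma mem_geSubmodule {i : ι} {n : ℤ} {f : F} : f ∈ S.geSubmodule i n ↔ S.Ge i n f :=
  Iff.rfl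

/-- The coefficient of order `n` at `i` is a linear form with values in `k`, and the subspace is its
kernel. -/
lemma finrank_le_finrank_inf_geSubmodule (i : ι) (n : ℤ) (V : Submodule k F)
    [FiniteDimensional k V] (hV : ∀ f ∈ V, S.Ge i n f) :
    Module.finrank k V ≤ Module.finrank k (V ⊓ S.geSubmodule i (n + 1) : Submodule k F) + 1 := by
  set V' := V ⊓ S.geSubmodule i (n + 1) with hV'
  have hfin : FiniteDimensional k V' := Submodule.finiteDimensional_of_le inf_le_left
  by_cases h : V ≤ S.geSubmodule i (n + 1)
  · have : V' = V := inf_eq_left.2 h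
    rw [this]; omega
  obtain ⟨v, hv, hv'⟩ := SetLike.not_le_iff_exists.1 h
  have hu : ∀ m : ℤ, S.unif i ^ m ≠ 0 := fun m => zpow_ne_zero m (S.unif_ne_zero i)
  have key : ∀ f ∈ V, ∃ c : k, S.Ge i (n + 1) (f - algebraMap k F c * S.unif i ^ n) := by
    intro f hf
    obtain ⟨c, hc⟩ := S.exists_residue_ge i (f := f * S.unif i ^ (-n))
      ((S.ge_zero_iff i _).2 (hV f hf))
    refine ⟨c, ?_⟩
    have h1 := hc.mul (S.ge_ord i (S.unif i ^ n))
    rw [S.ord_zpow i (S.unif_ne_zero i), ord_unif, mul_one, sub_mul, mul_assoc,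
      ← zpow_add₀ (S.unif_ne_zero i), neg_add_cancel, zpow_zero, mul_one, add_comm] at h1
    exact h1
  have hle : V ≤ V' ⊔ Submodule.span k {v} := by
    intro f hf
    obtain ⟨c, hc⟩ := key f hf
    obtain ⟨d, hd⟩ := key v hv
    have hd0 : d ≠ 0 := by
      rintro rfl
      rw [map_zero, zero_mul, sub_zero] at hd
      exact hv' hd
    have h1 : f - (c / d) • v ∈ V' := by
      refine ⟨sub_mem hf (V.smul_mem _ hv), ?_⟩
      rw [SetLike.mem_coe, mem_geSubmodule]
      have h2 := hc.sub (hd.algebraMap_mul (c / d))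
      have h3 : algebraMap k F (c / d) * algebraMap k F d = algebraMap k F c := by
        rw [← map_mul, div_mul_cancel₀ c hd0]
      rw [mul_sub, ← mul_assoc, h3, sub_sub_sub_cancel_right] at h2
      rwa [Algebra.smul_def]
    have h4 : f = (f - (c / d) • v) + (c / d) • v := by rw [sub_add_cancel]
    rw [h4]
    exact Submodule.add_mem_sup h1 (Submodule.smul_mem _ _ (Submodule.mem_span_singleton_self v))
  have h1 := Submodule.finrank_mono hle
  have h2 := Submodule.finrank_add_le_finrank_add_finrank V' (Submodule.span k {v})
  have h3 := finrank_span_singleton (K := k) (v := v)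
    (by rintro rfl; exact hv' (zero_mem _))
  omega

/-- A linear system of dimension at least its degree contains a nonconstant function with at most
one simple pole. -/
lemma exists_simple_pole (d : ℕ) : ∀ (D : ι →₀ ℕ) (V : Submodule k F) [FiniteDimensional k V],
    D.degree = d + 1 → (∀ f ∈ V, ∀ i, S.Ge i (-(D i : ℤ)) f) → d + 2 ≤ Module.finrank k V →
    ∃ (z : F) (i : ι), z ∉ Set.range (algebraMap k F) ∧ S.Ge i (-1) z ∧ ∀ j, j ≠ i → S.Ge j 0 z := by
  classical
  induction d with
  | zero =>
    intro D V _ hD hV hr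
    obtain ⟨i, rfl⟩ : ∃ i, D = Finsupp.single i 1 := by
      obtain ⟨i, hi⟩ : ∃ i, D i ≠ 0 := by
        by_contra hcon
        push Not at hcon
        have : D = 0 := Finsupp.ext hcon
        rw [this] at hD
        simp at hD
      have hle : Finsupp.single i 1 ≤ D := by
        rw [Finsupp.single_le_iff]; omega
      have hDs : D = (D - Finsupp.single i 1) + Finsupp.single i 1 :=
        (tsub_add_cancel_of_le hle).symm
      have h0 : (D - Finsupp.single i 1).degree = 0 := by
        rw [hDs, map_add, Finsupp.degree_single] at hD
        omega
      rw [Finsupp.degree_eq_zero_iff] at h0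
      rw [h0, zero_add] at hDs
      exact ⟨i, hDs⟩
    have hnot : ¬ V ≤ Submodule.span k {(1 : F)} := by
      intro hle
      have h1 := Submodule.finrank_mono hle
      have h2 := finrank_span_singleton (K := k) (v := (1 : F)) one_ne_zero
      omega
    obtain ⟨z, hz, hz'⟩ := SetLike.not_le_iff_exists.1 hnot
    refine ⟨z, i, ?_, by simpa using hV z hz i, fun j hj => ?_⟩
    · rintro ⟨c, rfl⟩
      exact hz' (Submodule.mem_span_singleton.2 ⟨c, by rw [Algebra.smul_def, mul_one]⟩)
    · have := hV z hz j
      rwa [Finsupp.single_eq_of_ne hj, Nat.cast_zero, neg_zero] at this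
  | succ d ih =>
    intro D V _ hD hV hr
    obtain ⟨i, hi⟩ : ∃ i, D i ≠ 0 := by
      by_contra hcon
      push Not at hcon
      have : D = 0 := Finsupp.ext hcon
      rw [this] at hD
      simp at hD
    have hle : Finsupp.single i 1 ≤ D := by
      rw [Finsupp.single_le_iff]; omega
    have hDs : D = (D - Finsupp.single i 1) + Finsupp.single i 1 := (tsub_add_cancel_of_le hle).symm
    have hfin : FiniteDimensional k (V ⊓ S.geSubmodule i (-(D i : ℤ) + 1) : Submodule k F) :=
      Submodule.finiteDimensional_of_le inf_le_left
    -- One more condition at a point of `D` lowers the degree by one and the dimension by at most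
    -- one.
    refine ih (D - Finsupp.single i 1) (V ⊓ S.geSubmodule i (-(D i : ℤ) + 1)) ?_ ?_ ?_
    · rw [hDs, map_add, Finsupp.degree_single] at hD
      omega
    · rintro f ⟨hf, hfi⟩ j
      by_cases hj : j = i
      · subst hj
        refine Ge.mono hfi ?_
        simp only [Finsupp.coe_tsub, Pi.sub_apply, Finsupp.single_eq_same]
        omega
      · refine (hV f hf j).mono ?_
        simp [Finsupp.single_eq_of_ne hj]
    · have := S.finrank_le_finrank_inf_geSubmodule i (-(D i : ℤ)) V (fun f hf => hV f hf i)
      omega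

end

section
variable {k F ι : Type*} [Field k] [IsAlgClosed k] [CharZero k] [Field F] [Algebra k F]
  (S : PlaceSystem k F ι)

/-- The `n = [F : k(x)]` basis functions have poles bounded by those of `x`, and so has `x * b l`
with `b l` regular everywhere. These `n + 1` functions are independent, and the polar divisor of `x`
has degree `n`. -/
lemma exists_simple_pole_of_regular_eq_zero {x : F} (hx : x ∉ Set.range (algebraMap k F))
    (hreg : ∀ y : F, (∀ a i, 0 < S.ord i (x - algebraMap k F a) →
        S.Ge i (1 - S.ord i (x - algebraMap k F a)) y) →
      (∀ i, S.ord i x < 0 → S.Ge i (1 - S.ord i x) y) → y = 0) :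
    ∃ (z : F) (i : ι), z ∉ Set.range (algebraMap k F) ∧ S.Ge i (-1) z ∧
      ∀ j, j ≠ i → S.Ge j 0 z := by
  classical
  have hx0 : x ≠ 0 := by rintro rfl; exact hx ⟨0, map_zero _⟩
  have hbasis := S.exists_basis_ge_ord hx hreg
  obtain ⟨T, hT, hTs⟩ := S.exists_sum_neg_ord_eq_finrank hx
  have hn := S.finrank_adjoin_pos hx
  generalize Module.finrank (IntermediateField.adjoin k {x}) F = n at hbasis hTs hn
  obtain ⟨b, l, h1, h2, h3⟩ := hbasis
  let v : Option (Fin n) → F := fun o => o.elim (x * b l) b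
  have hli : LinearIndependent k v := by
    rw [Fintype.linearIndependent_iff]
    intro c hc
    rw [Fintype.sum_option] at hc
    simp only [v, Option.elim_none, Option.elim_some] at hc
    let g : Fin n → IntermediateField.adjoin k {x} := fun j =>
      algebraMap k _ (c (some j)) + if j = l then algebraMap k _ (c none) *
        IntermediateField.AdjoinSimple.gen k x else 0
    have hg : ∑ j, g j • b j = 0 := by
      rw [← hc, add_comm]
      simp only [g, add_smul, Finset.sum_add_distrib, ite_smul, zero_smul, Finset.sum_ite_eq',
        Finset.mem_univ, if_true]
      congr 1
      · refine Finset.sum_congr rfl fun j _ => ?_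
        rw [Algebra.smul_def, Algebra.smul_def, ← IsScalarTower.algebraMap_apply]
      · rw [Algebra.smul_def, Algebra.smul_def, map_mul,
          IntermediateField.AdjoinSimple.algebraMap_gen, mul_assoc,
          ← IsScalarTower.algebraMap_apply]
    have hg0 := Fintype.linearIndependent_iff.1 b.linearIndependent g hg
    have hgl := congrArg (algebraMap _ F) (hg0 l)
    simp only [g, if_true, map_add, map_mul, IntermediateField.AdjoinSimple.algebraMap_gen,
      map_zero, ← IsScalarTower.algebraMap_apply] at hgl
    have hnone : c none = 0 := by
      by_contra hne
      apply hx
      refine ⟨-(c (some l)) / c none, ?_⟩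
      have : algebraMap k F (c none) ≠ 0 := by simpa using hne
      rw [map_div₀, map_neg, div_eq_iff this]
      linear_combination -hgl
    rintro (_ | j)
    · exact hnone
    · have hgj := hg0 j
      simp only [g, hnone, map_zero, zero_mul, ite_self, add_zero] at hgj
      simpa using hgj
  have hv : ∀ o i, S.Ge i (-((-S.ord i x).toNat : ℤ)) (v o) := by
    intro o i
    by_cases hi : 0 ≤ S.ord i x
    · have hm : (-S.ord i x).toNat = 0 := by omega
      rw [hm, Nat.cast_zero, neg_zero]
      cases o with
      | none => simpa [v] using ((S.ge_iff i hx0 0).2 hi).mul (h3 i)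
      | some j => exact h1 j i hi
    · have hm : -((-S.ord i x).toNat : ℤ) = S.ord i x := by omega
      rw [hm]
      cases o with
      | none => simpa [v] using (S.ge_ord i x).mul (h3 i)
      | some j => exact h2 j i (by omega)
  let D : ι →₀ ℕ := Finsupp.onFinset T (fun i => (-S.ord i x).toNat) fun i hi => by
    rw [hT]; omega
  have hD : D.degree = (n - 1) + 1 := by
    have h4 : D.degree = ∑ i ∈ T, D i := by
      rw [Finsupp.degree_apply]
      exact Finset.sum_subset (Finsupp.support_onFinset_subset) fun i _ hi =>
        Finsupp.notMem_support_iff.1 hi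
    have h5 : ((∑ i ∈ T, D i : ℕ) : ℤ) = n := by
      rw [← hTs]
      push_cast
      refine Finset.sum_congr rfl fun i hi => ?_
      have := (hT i).1 hi
      change ((-S.ord i x).toNat : ℤ) = _
      omega
    have h6 : ∑ i ∈ T, D i = n := by exact_mod_cast h5
    omega
  have hfin : FiniteDimensional k (Submodule.span k (Set.range v)) :=
    FiniteDimensional.span_of_finite k (Set.finite_range v)
  refine S.exists_simple_pole (n - 1) D (Submodule.span k (Set.range v)) hD ?_ ?_
  · intro f hf i
    have hle : Submodule.span k (Set.range v) ≤ S.geSubmodule i (-(D i : ℤ)) := by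
      rw [Submodule.span_le]
      rintro _ ⟨o, rfl⟩
      exact hv o i
    exact hle hf
  · rw [finrank_span_eq_card hli, Fintype.card_option, Fintype.card_fin]
    omega

end

end PlaceSystem

/-! ### Orders of differentials and the canonical degree. -/

namespace PlaceSystem

open KaehlerDifferential

variable {k F ι : Type*} [Field k] [IsAlgClosed k] [CharZero k] [Field F] [Algebra k F]
  (S : PlaceSystem k F ι)

-- For `f = u π ^ m` with `du = a dπ`, one has `df = (m u π ^ (m - 1) + a π ^ m) dπ`. As `m` is
-- invertible, the first summand has order exactly `m - 1`.
omit [IsAlgClosed k] in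
lemma exists_ord_derivative
    (hder : ∀ i, ∀ f ∈ S.O i, ∃ a ∈ S.O i, D k F f = a • D k F (S.unif i))
    {i : ι} {f : F} (hf : S.ord i f ≠ 0) :
    ∃ g : F, g ≠ 0 ∧ S.ord i g = S.ord i f - 1 ∧ D k F f = g • D k F (S.unif i) := by
  have hf0 : f ≠ 0 := by rintro rfl; simp at hf
  have hchar : CharZero F := charZero_of_injective_algebraMap (algebraMap k F).injective
  obtain ⟨u, hu, hu', h0, h⟩ := S.exists_unit_ord i hf0
  obtain ⟨a, ha, hau⟩ := hder i u hu
  set m := S.ord i f with hm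
  have hmF : S.ord i (m : F) = 0 ∧ (m : F) ≠ 0 :=
    ⟨by rw [← map_intCast (algebraMap k F), ord_algebraMap], Int.cast_ne_zero.2 hf⟩
  have hπ := S.unif_ne_zero i
  have h1 : S.ord i ((m : F) * u * S.unif i ^ (m - 1)) = m - 1 := by
    rw [S.ord_mul i (mul_ne_zero hmF.2 h0) (zpow_ne_zero _ hπ), S.ord_mul i hmF.2 h0, hmF.1,
      S.ord_zpow i hπ, ord_unif, S.ord_eq_of i (n := 0) hu hu' h0 (by simp)]
    ring
  have hne : (m : F) * u * S.unif i ^ (m - 1) ≠ 0 :=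
    mul_ne_zero (mul_ne_zero hmF.2 h0) (zpow_ne_zero _ hπ)
  have h2 : S.Ge i m (a * S.unif i ^ m) := by
    have := ((S.ge_zero_iff i a).2 ha).mul (S.ge_ord i (S.unif i ^ m))
    rwa [S.ord_zpow i hπ, ord_unif, zero_add, mul_one] at this
  set p := (m : F) * u * S.unif i ^ (m - 1)
  set q := a * S.unif i ^ m
  have h3 : ¬ S.Ge i m (p + q) := by
    intro h
    have := h.sub h2
    rw [add_sub_cancel_right, S.ge_iff i hne] at this
    omega
  have h4 : p + q ≠ 0 := by
    intro h; rw [h] at h3; exact h3 (S.ge_zero' i m)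
  have h5 : S.Ge i (m - 1) (p + q) := ((S.ge_iff i hne _).2 h1.ge).add (h2.mono (by omega))
  rw [S.ge_iff i h4] at h3 h5
  refine ⟨p + q, h4, by omega, ?_⟩
  conv_lhs => rw [h]
  rw [Derivation.leibniz, Derivation.leibniz_zpow, hau]
  simp only [← Int.cast_smul_eq_zsmul F, smul_smul, ← add_smul]
  congr 1
  simp only [p, q]
  ring

variable {ω : Ω[F⁄k]} {K : ι →₀ ℤ}

-- One place suffices: for a function regular there both `df` and `ω` are multiples of the
-- differential of the uniformizer; otherwise pass to the inverse.
omit [IsAlgClosed k] [CharZero k] in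
lemma exists_eq_smul_differential [Nonempty ι]
    (hder : ∀ i, ∀ f ∈ S.O i, ∃ a ∈ S.O i, D k F f = a • D k F (S.unif i))
    (hK : ∀ i, ∃ g : F, g ≠ 0 ∧ S.ord i g = K i ∧ ω = g • D k F (S.unif i)) (f : F) :
    ∃ h : F, D k F f = h • ω := by
  obtain ⟨i⟩ := ‹Nonempty ι›
  obtain ⟨g, hg0, -, hg⟩ := hK i
  have key : ∀ f ∈ S.O i, ∃ h : F, D k F f = h • ω := by
    intro f hf
    obtain ⟨a, -, ha⟩ := hder i f hf
    exact ⟨a * g⁻¹, by rw [hg, smul_smul, inv_mul_cancel_right₀ hg0, ha]⟩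
  rcases (S.O i).mem_or_inv_mem f with hf | hf
  · exact key f hf
  · obtain ⟨h, hh⟩ := key _ hf
    refine ⟨-(f ^ 2) * h, ?_⟩
    rw [← inv_inv f, Derivation.leibniz_inv, hh, smul_smul]

omit [IsAlgClosed k] in
lemma ord_add_of_derivative (hω : ω ≠ 0)
    (hder : ∀ i, ∀ f ∈ S.O i, ∃ a ∈ S.O i, D k F f = a • D k F (S.unif i))
    (hK : ∀ i, ∃ g : F, g ≠ 0 ∧ S.ord i g = K i ∧ ω = g • D k F (S.unif i))
    {f h : F} (hf : D k F f = h • ω) (c : k) {i : ι} (hi : S.ord i (f - algebraMap k F c) ≠ 0) :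
    h ≠ 0 ∧ S.ord i h + K i = S.ord i (f - algebraMap k F c) - 1 := by
  obtain ⟨g, hg0, hg1, hg⟩ := hK i
  obtain ⟨g', hg0', hg1', hg'⟩ := S.exists_ord_derivative hder hi
  rw [map_sub, Derivation.map_algebraMap, sub_zero, hf, hg, smul_smul] at hg'
  have hD : D k F (S.unif i) ≠ 0 := by
    intro h0; rw [h0, smul_zero] at hg; exact hω hg
  have heq := smul_left_injective F hD hg'
  have h0 : h ≠ 0 := by
    rintro rfl
    rw [zero_mul] at heq
    exact hg0' heq.symm
  refine ⟨h0, ?_⟩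
  rw [← hg1, ← S.ord_mul i h0 hg0, heq, hg1']

omit [CharZero k] [IsAlgClosed k] in
lemma exists_ord_sub_pos {x : F} (hx : x ∉ Set.range (algebraMap k F)) {i : ι} (hi : S.Ge i 0 x) :
    ∃ a : k, 0 < S.ord i (x - algebraMap k F a) := by
  obtain ⟨a, ha⟩ := S.exists_residue_ge i hi
  refine ⟨a, ?_⟩
  rw [S.ge_iff i] at ha
  · omega
  · intro h
    exact hx ⟨a, (sub_eq_zero.1 h).symm⟩

/-- The bounds on `y` say that `y dx = y h ω` has no poles. Its divisor would be effective, yet has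
the degree of `K`, since principal divisors have degree zero. -/
lemma regular_eq_zero (hω : ω ≠ 0)
    (hder : ∀ i, ∀ f ∈ S.O i, ∃ a ∈ S.O i, D k F f = a • D k F (S.unif i))
    (hK : ∀ i, ∃ g : F, g ≠ 0 ∧ S.ord i g = K i ∧ ω = g • D k F (S.unif i))
    (hneg : K.sum (fun _ n => n) < 0) {x h : F} (hx : x ∉ Set.range (algebraMap k F))
    (hh : D k F x = h • ω) {y : F}
    (h1 : ∀ a i, 0 < S.ord i (x - algebraMap k F a) →
        S.Ge i (1 - S.ord i (x - algebraMap k F a)) y)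
    (h2 : ∀ i, S.ord i x < 0 → S.Ge i (1 - S.ord i x) y) : y = 0 := by
  classical
  by_contra hy
  have key : ∀ i, h ≠ 0 ∧ 0 ≤ S.ord i (y * h) + K i := by
    intro i
    have aux : ∀ a, S.ord i (x - algebraMap k F a) ≠ 0 →
        S.Ge i (1 - S.ord i (x - algebraMap k F a)) y → h ≠ 0 ∧ 0 ≤ S.ord i (y * h) + K i := by
      intro a ha hy'
      obtain ⟨h0, h3⟩ := S.ord_add_of_derivative hω hder hK hh a ha
      rw [S.ge_iff i hy] at hy'
      rw [S.ord_mul i hy h0]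
      exact ⟨h0, by omega⟩
    by_cases hi : S.ord i x < 0
    · apply aux 0
      · simpa using hi.ne
      · simpa using h2 i hi
    · have hx0 : x ≠ 0 := by rintro rfl; exact hx ⟨0, map_zero _⟩
      obtain ⟨a, ha⟩ := S.exists_ord_sub_pos hx ((S.ge_iff i hx0 0).2 (by omega))
      exact aux a ha.ne' (h1 a i ha)
  have hT := S.finite_setOf_ord_ne_zero (y * h)
  have h3 := S.sum_ord_eq_zero (y * h) (T := hT.toFinset ∪ K.support)
    (fun i hi => Finset.mem_union_left _ (by simpa using hi))
  have h4 : K.sum (fun _ n => n) = ∑ i ∈ hT.toFinset ∪ K.support, K i :=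
    Finsupp.sum_of_support_subset _ Finset.subset_union_right _ (by simp)
  have h5 : 0 ≤ ∑ i ∈ hT.toFinset ∪ K.support, (S.ord i (y * h) + K i) :=
    Finset.sum_nonneg fun i _ => (key i).2
  rw [Finset.sum_add_distrib, h3, ← h4] at h5
  omega

/-- The degree of a canonical divisor is `-2` or nonnegative. -/
theorem sum_canonical (hω : ω ≠ 0)
    (hder : ∀ i, ∀ f ∈ S.O i, ∃ a ∈ S.O i, D k F f = a • D k F (S.unif i))
    (hK : ∀ i, ∃ g : F, g ≠ 0 ∧ S.ord i g = K i ∧ ω = g • D k F (S.unif i)) :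
    K.sum (fun _ n => n) = -2 ∨ 0 ≤ K.sum (fun _ n => n) := by
  classical
  by_contra! hcon
  obtain ⟨hne, hneg⟩ := hcon
  have : Nonempty ι := by
    by_contra hemp
    rw [not_nonempty_iff] at hemp
    have : K = 0 := Subsingleton.elim _ _
    rw [this] at hneg
    simp at hneg
  obtain ⟨i₀⟩ := id this
  set x := S.unif i₀ with hxdef
  have hx : x ∉ Set.range (algebraMap k F) := by
    rintro ⟨c, hc⟩
    have := S.ord_algebraMap i₀ c
    rw [hc, hxdef, ord_unif] at this
    omega
  obtain ⟨h, hh⟩ := S.exists_eq_smul_differential hder hK x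
  obtain ⟨z, i, hz, hzi, hzj⟩ := S.exists_simple_pole_of_regular_eq_zero hx
    (fun y h1 h2 => S.regular_eq_zero hω hder hK hneg hx hh h1 h2)
  have hz0 : z ≠ 0 := by rintro rfl; exact hz ⟨0, map_zero _⟩
  have hordj : ∀ j, j ≠ i → 0 ≤ S.ord j z := fun j hj => (S.ge_iff j hz0 0).1 (hzj j hj)
  have hordi : S.ord i z = -1 := by
    obtain ⟨j, hj⟩ := S.exists_ord_neg hz
    have hji : j = i := by
      by_contra hji
      have := hordj j hji
      omega
    subst hji
    have := (S.ge_iff j hz0 _).1 hzi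
    omega
  -- A single simple pole means `F = k(z)`.
  have hfr : (Module.finrank (IntermediateField.adjoin k {z}) F : ℤ) = 1 := by
    obtain ⟨T, hT, hTs⟩ := S.exists_sum_neg_ord_eq_finrank hz
    have hTi : T = {i} := by
      ext j
      rw [hT, Finset.mem_singleton]
      constructor
      · intro hj
        by_contra hji
        have := hordj j hji
        omega
      · rintro rfl; omega
    rw [← hTs, hTi, Finset.sum_singleton, hordi]
    rfl
  obtain ⟨g, hg⟩ := S.exists_eq_smul_differential hder hK z
  -- The divisor of `dz = g ω` is computed pointwise: order `-2` at the simple pole, and `0`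
  -- elsewhere since each `z - a` has only simple zeros.
  have h1 : S.ord i g + K i = -2 := by
    have := (S.ord_add_of_derivative hω hder hK hg 0 (i := i) (by simp [hordi])).2
    rw [map_zero, sub_zero, hordi] at this
    omega
  have h2 : ∀ j, j ≠ i → S.ord j g + K j = 0 := by
    intro j hj
    obtain ⟨a, ha⟩ := S.exists_ord_sub_pos hz (hzj j hj)
    have hw := sub_algebraMap_notMem_range hz a
    obtain ⟨T, hT, hTs⟩ := S.exists_sum_ord_eq_finrank hw
    rw [adjoin_sub_algebraMap_eq, hfr] at hTs
    have hle : S.ord j (z - algebraMap k F a) ≤ 1 := by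
      rw [← hTs]
      exact Finset.single_le_sum (f := fun l => S.ord l (z - algebraMap k F a))
        (fun l hl => ((hT l).1 hl).le) ((hT j).2 ha)
    have := (S.ord_add_of_derivative hω hder hK hg a ha.ne').2
    omega
  have hT := S.finite_setOf_ord_ne_zero g
  set T := insert i (hT.toFinset ∪ K.support) with hTdef
  have h3 := S.sum_ord_eq_zero g (T := T)
    (fun j hj => Finset.mem_insert_of_mem (Finset.mem_union_left _ (by simpa using hj)))
  have h4 : K.sum (fun _ n => n) = ∑ j ∈ T, K j :=
    Finsupp.sum_of_support_subset _
      (Finset.subset_union_right.trans (Finset.subset_insert _ _)) _ (by simp)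
  have h5 : ∑ j ∈ T, (S.ord j g + K j) = -2 := by
    rw [Finset.sum_eq_single_of_mem i (Finset.mem_insert_self _ _) (fun j _ hj => h2 j hj), h1]
  rw [Finset.sum_add_distrib, h3, ← h4, zero_add] at h5
  exact hne h5

end PlaceSystem

/-! ### Discrete valuation rings and Kähler differentials. -/

/-- The valuation ring `R` as a subring of its field of fractions. -/
def ValuationRing.rangeSubring (R F : Type*) [CommRing R] [IsDomain R] [ValuationRing R] [Field F]
    [Algebra R F] [IsFractionRing R F] : ValuationSubring F where
  __ := (algebraMap R F).range
  mem_or_inv_mem' := ValuationRing.isInteger_or_isInteger R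

lemma IsDiscreteValuationRing.exists_eq_units_mul_zpow {R F : Type*} [CommRing R] [IsDomain R]
    [IsDiscreteValuationRing R] [Field F] [Algebra R F] [IsFractionRing R F] {t : R}
    (ht : IsLocalRing.maximalIdeal R = Ideal.span {t}) {f : F} (hf : f ≠ 0) :
    ∃ (n : ℤ) (u : Rˣ), f = algebraMap R F u * algebraMap R F t ^ n := by
  have hirr : Irreducible t := (IsDiscreteValuationRing.irreducible_iff_uniformizer t).2 ht
  obtain ⟨a, b, hb, rfl⟩ := IsFractionRing.div_surjective (A := R) f
  have hb0 : b ≠ 0 := nonZeroDivisors.ne_zero hb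
  have ha0 : a ≠ 0 := by rintro rfl; simp at hf
  obtain ⟨m, u, rfl⟩ := eq_unit_mul_pow_irreducible ha0 hirr
  obtain ⟨n, v, rfl⟩ := eq_unit_mul_pow_irreducible hb0 hirr
  have ht0 : algebraMap R F t ≠ 0 := by simpa using hirr.ne_zero
  have hv0 : algebraMap R F v ≠ 0 := by simp
  refine ⟨m - n, u * v⁻¹, ?_⟩
  have hv : algebraMap R F (v⁻¹ : Rˣ) = (algebraMap R F v)⁻¹ := by
    refine eq_inv_of_mul_eq_one_left ?_
    rw [← map_mul, Units.inv_mul, map_one]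
  rw [zpow_sub₀ ht0, zpow_natCast, zpow_natCast, Units.val_mul, map_mul, map_mul, map_mul, map_pow,
    map_pow, hv]
  field_simp

-- Nakayama's lemma: `g = c + h t` with `c` constant gives `dg = h dt + t dh`, so `dt` generates the
-- finite module of differentials modulo the maximal ideal.
open KaehlerDifferential in
lemma KaehlerDifferential.exists_D_eq_smul {k R : Type*} [Field k] [CommRing R] [IsLocalRing R]
    [Algebra k R] [Algebra.EssFiniteType k R] {t : R}
    (ht : IsLocalRing.maximalIdeal R = Ideal.span {t})
    (hres : ∀ f : R, ∃ c : k, f - algebraMap k R c ∈ IsLocalRing.maximalIdeal R) (f : R) :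
    ∃ a : R, D k R f = a • D k R t := by
  have hle : (⊤ : Submodule R (Ω[R⁄k])) ≤ Submodule.span R {D k R t} := by
    refine Submodule.le_of_le_smul_of_le_jacobson_bot (I := IsLocalRing.maximalIdeal R)
      Module.Finite.fg_top (IsLocalRing.maximalIdeal_le_jacobson _) ?_
    rw [← span_range_derivation, Submodule.span_le]
    rintro _ ⟨g, rfl⟩
    obtain ⟨c, hc⟩ := hres g
    rw [ht, Ideal.mem_span_singleton'] at hc
    obtain ⟨h, hh⟩ := hc
    have : D k R g = h • D k R t + t • D k R h := by
      rw [← Derivation.leibniz, hh, map_sub, Derivation.map_algebraMap, sub_zero]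
    rw [this]
    refine Submodule.add_mem_sup (Submodule.smul_mem _ _ (Submodule.mem_span_singleton_self _)) ?_
    refine Submodule.smul_mem_smul ?_ (Submodule.subset_span ⟨h, rfl⟩)
    rw [ht]
    exact Ideal.mem_span_singleton_self t
  obtain ⟨a, ha⟩ := Submodule.mem_span_singleton.1 (hle (Submodule.mem_top (x := D k R f)))
  exact ⟨a, ha.symm⟩

-- As `dt` generates all differentials, `F` is unramified, hence algebraic, over `k(t)`. The
-- transcendence degree is thus at most one, `x` is a transcendence basis, and `F` is finite over
-- `k(x)`.
open KaehlerDifferential in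
lemma KaehlerDifferential.finiteDimensional_adjoin {k F : Type u} [Field k] [IsAlgClosed k]
    [CharZero k] [Field F] [Algebra k F] [Algebra.EssFiniteType k F] (t : F)
    (ht : ∀ f : F, ∃ a : F, D k F f = a • D k F t) {x : F} (hx : x ∉ Set.range (algebraMap k F)) :
    FiniteDimensional (IntermediateField.adjoin k {x}) F := by
  have halg : Algebra.IsAlgebraic (IntermediateField.adjoin k {t}) F := by
    have := Algebra.EssFiniteType.of_comp k (IntermediateField.adjoin k {t}) F
    have hD : D (IntermediateField.adjoin k {t}) F t = 0 := by
      have := (D (IntermediateField.adjoin k {t}) F).map_algebraMap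
        (IntermediateField.AdjoinSimple.gen k t)
      rwa [IntermediateField.AdjoinSimple.algebraMap_gen] at this
    have hunr : Algebra.FormallyUnramified (IntermediateField.adjoin k {t}) F := by
      constructor
      have h0 : ∀ f, D (IntermediateField.adjoin k {t}) F f = 0 := by
        intro f
        obtain ⟨a, ha⟩ := ht f
        have := congrArg (KaehlerDifferential.map k (IntermediateField.adjoin k {t}) F F) ha
        rw [map_smul, map_D, map_D, Algebra.algebraMap_self, RingHom.id_apply, RingHom.id_apply,
          hD, smul_zero] at this
        exact this
      rw [← Submodule.subsingleton_iff F, ← subsingleton_iff_bot_eq_top,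
        ← span_range_derivation, eq_comm, Submodule.span_eq_bot]
      rintro _ ⟨f, rfl⟩
      exact h0 f
    have := Algebra.FormallyUnramified.isSeparable (IntermediateField.adjoin k {t}) F
    infer_instance
  have htr : Algebra.trdeg k F ≤ 1 := by
    have h1 : Algebra.IsAlgebraic (Algebra.adjoin k {t}) F := by
      open scoped IntermediateField.algebraAdjoinAdjoin in
      exact (IsFractionRing.comap_isAlgebraic_iff (A := Algebra.adjoin k {t})
        (K := IntermediateField.adjoin k {t}) (C := F)).2 halg
    simpa using Algebra.IsAlgebraic.trdeg_le_cardinalMk k ({t} : Set F)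
  have hind : AlgebraicIndependent k (fun _ : PUnit.{u + 1} => x) :=
    algebraicIndependent_unique_type_iff.2 (transcendental_of_notMem_range hx)
  have hbas := hind.isTranscendenceBasis_of_trdeg_le_of_finite (by simpa using htr)
  have hx' := hbas.isAlgebraic_field
  rw [Set.range_const] at hx'
  have := Algebra.EssFiniteType.of_comp k (IntermediateField.adjoin k {x}) F
  have : CharZero (IntermediateField.adjoin k {x}) :=
    charZero_of_injective_algebraMap (algebraMap k (IntermediateField.adjoin k {x})).injective
  have := Algebra.FormallyUnramified.of_isSeparable (IntermediateField.adjoin k {x}) F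
  exact Algebra.FormallyUnramified.finite_of_free _ _

/-! ### Local rings of `k`-schemes and the valuative criterion. -/

section
variable {k : Type u} [Field k] {X : Scheme.{u}} (p : X ⟶ Spec (.of k))

/-- The structure map of the local ring at `x` of a `k`-scheme. -/
noncomputable def stalkBase (x : X) : CommRingCat.of k ⟶ X.presheaf.stalk x :=
  (Scheme.ΓSpecIso (.of k)).inv ≫ p.appTop ≫ X.presheaf.germ ⊤ x trivial

lemma map_stalkBase (x : X) : Spec.map (stalkBase p x) = X.fromSpecStalk x ≫ p := by
  have h1 : p = X.toSpecΓ ≫ Spec.map p.appTop ≫ Spec.map (Scheme.ΓSpecIso (.of k)).inv := by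
    rw [← Category.assoc, ← Scheme.toSpecΓ_naturality, Category.assoc,
      toSpecΓ_SpecMap_ΓSpecIso_inv, Category.comp_id]
  conv_rhs => rw [h1]
  rw [← Category.assoc, Scheme.fromSpecStalk_toSpecΓ, stalkBase, Spec.map_comp, Spec.map_comp,
    Category.assoc]

lemma stalkBase_stalkSpecializes {x y : X} (h : x ⤳ y) :
    stalkBase p y ≫ X.presheaf.stalkSpecializes h = stalkBase p x := by
  apply Spec.map_injective
  rw [Spec.map_comp, map_stalkBase, map_stalkBase, ← Category.assoc,
    Scheme.SpecMap_stalkSpecializes_fromSpecStalk]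

lemma essFiniteType_stalkBase [LocallyOfFiniteType p] (x : X) :
    (stalkBase p x).hom.EssFiniteType := by
  have h1 := LocallyOfFiniteType.stalkMap p x
  let g : CommRingCat.of k ⟶ (Spec (.of k)).presheaf.stalk (p x) := StructureSheaf.toStalk k (p x)
  have hg : Spec.map g = (Spec (.of k)).fromSpecStalk (p x) :=
    (Spec.fromSpecStalk_eq' (.of k) (p x)).symm
  have h2 : g.hom.EssFiniteType := by
    have : (p x).asIdeal.IsPrime := PrimeSpectrum.isPrime (p x)
    have := StructureSheaf.IsLocalization.to_stalk k (p x)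
    exact @Algebra.EssFiniteType.of_isLocalization k _ _ _ g.hom.toAlgebra
      (p x).asIdeal.primeCompl this
  have h3 : stalkBase p x = g ≫ p.stalkMap x := by
    apply Spec.map_injective
    rw [map_stalkBase, Spec.map_comp, hg, Scheme.SpecMap_stalkMap_fromSpecStalk]
  rw [h3]
  exact h2.comp h1

lemma exists_sub_stalkBase_mem [IsAlgClosed k] [LocallyOfFiniteType p] {x : X} (hx : IsClosed {x})
    (f : X.presheaf.stalk x) :
    ∃ c : k, f - (stalkBase p x).hom c ∈ IsLocalRing.maximalIdeal (X.presheaf.stalk x) := by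
  have h1 : (residueFieldIsoBase p x hx).inv = stalkBase p x ≫ X.residue x := by
    apply Spec.map_injective
    rw [SpecMap_residueFieldIsoBase_inv, Spec.map_comp, map_stalkBase, Scheme.fromSpecResidueField,
      Category.assoc]
  refine ⟨(residueFieldIsoBase p x hx).hom (X.residue x f), ?_⟩
  rw [← IsLocalRing.residue_eq_zero_iff, map_sub, sub_eq_zero]
  change X.residue x f = (stalkBase p x ≫ X.residue x) _
  rw [← h1]
  simp

variable [IsIntegral X]

lemma fromSpecStalk_genericPoint (x : X) :
    Spec.map (CommRingCat.ofHom (algebraMap (X.presheaf.stalk x) X.functionField)) ≫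
      X.fromSpecStalk x = X.fromSpecStalk (genericPoint X) :=
  Scheme.SpecMap_stalkSpecializes_fromSpecStalk ((genericPoint_spec X).specializes trivial)

lemma algebraMap_stalkBase (x : X) (c : k) :
    algebraMap (X.presheaf.stalk x) X.functionField ((stalkBase p x).hom c) =
      (stalkBase p (genericPoint X)).hom c :=
  congr($(stalkBase_stalkSpecializes p ((genericPoint_spec X).specializes trivial)).hom c)

omit [Field k] in
lemma algebraMap_stalkClosedPointTo {R : Type u} [CommRing R] [IsLocalRing R]
    [Algebra R X.functionField] (l : Spec (.of R) ⟶ X)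
    (hl : Spec.map (CommRingCat.ofHom (algebraMap R X.functionField)) ≫ l =
      X.fromSpecStalk (genericPoint X))
    (f : X.presheaf.stalk (l (IsLocalRing.closedPoint R))) :
    algebraMap R X.functionField (Scheme.stalkClosedPointTo l f) =
      algebraMap (X.presheaf.stalk (l (IsLocalRing.closedPoint R))) X.functionField f := by
  have h1 : Scheme.stalkClosedPointTo l ≫ CommRingCat.ofHom (algebraMap R X.functionField) =
      CommRingCat.ofHom
        (algebraMap (X.presheaf.stalk (l (IsLocalRing.closedPoint R))) X.functionField) := by
    apply Spec.map_injective
    rw [← cancel_mono (X.fromSpecStalk (l (IsLocalRing.closedPoint R))), Spec.map_comp,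
      Category.assoc, fromSpecStalk_genericPoint]
    exact (congrArg _ (Scheme.Spec_stalkClosedPointTo_fromSpecStalk l)).trans hl
  exact congr($(h1).hom f)

lemma exists_lift_of_valuationRing [UniversallyClosed p] {R : Type u} [CommRing R] [IsDomain R]
    [ValuationRing R] [Algebra R X.functionField] [IsFractionRing R X.functionField]
    (φ : k →+* R)
    (hφ : (algebraMap R X.functionField).comp φ = (stalkBase p (genericPoint X)).hom) :
    ∃ l : Spec (.of R) ⟶ X, Spec.map (CommRingCat.ofHom (algebraMap R X.functionField)) ≫ l =
      X.fromSpecStalk (genericPoint X) := by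
  have w : X.fromSpecStalk (genericPoint X) ≫ p =
      Spec.map (CommRingCat.ofHom (algebraMap R X.functionField)) ≫
        Spec.map (CommRingCat.ofHom φ) := by
    rw [← map_stalkBase, ← Spec.map_comp, ← CommRingCat.ofHom_comp, hφ]
    rfl
  have hex : ValuativeCriterion.Existence p := by
    have : UniversallyClosed p := inferInstance
    rw [UniversallyClosed.eq_valuativeCriterion] at this
    exact this.1
  obtain ⟨l, hl₁, -⟩ := (hex
    { R := R, K := X.functionField, i₁ := X.fromSpecStalk (genericPoint X),
      i₂ := Spec.map (CommRingCat.ofHom φ), commSq := ⟨w⟩ }).exists_lift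
  exact ⟨l, hl₁⟩

lemma lift_unique_of_valuationRing [IsSeparated p] {R : Type u} [CommRing R] [IsDomain R]
    [ValuationRing R] [Algebra R X.functionField] [IsFractionRing R X.functionField]
    {l₁ l₂ : Spec (.of R) ⟶ X}
    (h : Spec.map (CommRingCat.ofHom (algebraMap R X.functionField)) ≫ l₁ =
      Spec.map (CommRingCat.ofHom (algebraMap R X.functionField)) ≫ l₂)
    (h' : l₁ ≫ p = l₂ ≫ p) : l₁ = l₂ := by
  have hu := IsSeparated.valuativeCriterion p
    { R := R, K := X.functionField,
      i₁ := Spec.map (CommRingCat.ofHom (algebraMap R X.functionField)) ≫ l₁,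
      i₂ := l₁ ≫ p, commSq := ⟨Category.assoc _ _ _⟩ }
  exact congrArg CommSq.LiftStruct.l (hu.elim ⟨l₁, rfl, rfl⟩ ⟨l₂, h.symm, h'.symm⟩)

/-- By the valuative criterion the generic point extends to `Spec V`; the image of the closed point
is the centre of `V`. -/
lemma exists_stalk_le_valuationSubring [UniversallyClosed p] (V : ValuationSubring X.functionField)
    (hV : ∀ c, (stalkBase p (genericPoint X)).hom c ∈ V) :
    ∃ x : X, ∀ f : X.presheaf.stalk x, algebraMap _ X.functionField f ∈ V := by
  obtain ⟨l, hl⟩ := exists_lift_of_valuationRing p (R := V)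
    ((stalkBase p (genericPoint X)).hom.codRestrict V.toSubring hV) rfl
  refine ⟨l (IsLocalRing.closedPoint V), fun f => ?_⟩
  rw [← algebraMap_stalkClosedPointTo l hl]
  exact (Scheme.stalkClosedPointTo l f).2

/-- Equal local rings give two extensions of the generic point over one valuation ring.
Separatedness identifies them, and the closed point goes to `x` and to `y`. -/
lemma eq_of_range_stalk_eq [IsSeparated p] {x y : X} [ValuationRing (X.presheaf.stalk x)]
    (h : (algebraMap (X.presheaf.stalk x) X.functionField).range =
      (algebraMap (X.presheaf.stalk y) X.functionField).range) : x = y := by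
  have hy : ∀ f : X.presheaf.stalk y, ∃ g : X.presheaf.stalk x,
      algebraMap _ X.functionField g = algebraMap _ X.functionField f := by
    intro f
    have : algebraMap _ X.functionField f ∈ (algebraMap (X.presheaf.stalk x) X.functionField).range := by
      rw [h]; exact ⟨f, rfl⟩
    exact this
  have hx : ∀ f : X.presheaf.stalk x, ∃ g : X.presheaf.stalk y,
      algebraMap _ X.functionField g = algebraMap _ X.functionField f := by
    intro f
    have : algebraMap _ X.functionField f ∈ (algebraMap (X.presheaf.stalk y) X.functionField).range := by
      rw [← h]; exact ⟨f, rfl⟩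
    exact this
  have hix := IsFractionRing.injective (X.presheaf.stalk x) X.functionField
  have hiy := IsFractionRing.injective (X.presheaf.stalk y) X.functionField
  choose g hg using hy
  let ψ : X.presheaf.stalk y →+* X.presheaf.stalk x :=
    { toFun := g
      map_one' := hix (by rw [hg, map_one, map_one])
      map_mul' := fun a b => hix (by rw [hg, map_mul, map_mul, hg, hg])
      map_zero' := hix (by rw [hg, map_zero, map_zero])
      map_add' := fun a b => hix (by rw [hg, map_add, map_add, hg, hg]) }
  have hloc : IsLocalHom ψ := by
    constructor
    intro a ha
    obtain ⟨b, hb⟩ := ha.exists_right_inv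
    obtain ⟨c, hc⟩ := hx b
    refine IsUnit.of_mul_eq_one c (hiy ?_)
    rw [map_mul, hc, ← hg, ← map_mul]
    change algebraMap _ _ (ψ a * b) = _
    rw [hb, map_one, map_one]
  let ψ' : X.presheaf.stalk y ⟶ X.presheaf.stalk x := CommRingCat.ofHom ψ
  have hψ : ψ' ≫ CommRingCat.ofHom (algebraMap (X.presheaf.stalk x) X.functionField) =
      CommRingCat.ofHom (algebraMap (X.presheaf.stalk y) X.functionField) := by
    ext f
    exact hg f
  have hk : stalkBase p y ≫ ψ' = stalkBase p x := by
    ext c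
    apply hix
    rw [algebraMap_stalkBase]
    change algebraMap _ _ (ψ ((stalkBase p y).hom c)) = _
    exact (hg _).trans (algebraMap_stalkBase p y c)
  have h2 : X.fromSpecStalk x = Spec.map ψ' ≫ X.fromSpecStalk y := by
    refine lift_unique_of_valuationRing p (R := X.presheaf.stalk x) ?_ ?_
    · rw [fromSpecStalk_genericPoint, ← Category.assoc, ← Spec.map_comp]
      exact (fromSpecStalk_genericPoint y).symm.trans
        (congrArg (fun g => Spec.map g ≫ X.fromSpecStalk y) hψ.symm)
    · rw [Category.assoc, ← map_stalkBase, ← map_stalkBase, ← Spec.map_comp, hk]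
  have h3 := congr($h2 (IsLocalRing.closedPoint (X.presheaf.stalk x)))
  rw [Scheme.fromSpecStalk_closedPoint] at h3
  have h4 : Spec.map ψ' (IsLocalRing.closedPoint (X.presheaf.stalk x)) =
      IsLocalRing.closedPoint (X.presheaf.stalk y) := IsLocalRing.comap_closedPoint ψ
  exact h3.trans ((congrArg (X.fromSpecStalk y) h4).trans Scheme.fromSpecStalk_closedPoint)

lemma isClosed_ne_genericPoint (hdim : topologicalKrullDim X = 1) {x : X} (hx : IsClosed {x}) :
    x ≠ genericPoint X := by
  rintro rfl
  have h1 : ({genericPoint X} : Set X) = Set.univ := by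
    rw [← hx.closure_eq]
    exact genericPoint_spec X
  have : Subsingleton X := by
    constructor
    intro a b
    have ha : a ∈ ({genericPoint X} : Set X) := h1 ▸ Set.mem_univ a
    have hb : b ∈ ({genericPoint X} : Set X) := h1 ▸ Set.mem_univ b
    rw [Set.mem_singleton_iff] at ha hb
    rw [ha, hb]
  have : Nonempty X := ⟨genericPoint X⟩
  have h2 := topologicalKrullDim_zero_of_discreteTopology X
  rw [hdim] at h2
  exact absurd h2 (by norm_num)

lemma not_isField_stalk {x : X} (hx : x ≠ genericPoint X) : ¬ IsField (X.presheaf.stalk x) := by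
  intro hf
  apply hx
  have h1 : genericPoint X ∈ Set.range (X.fromSpecStalk x) := by
    rw [Scheme.range_fromSpecStalk]
    exact (genericPoint_spec X).specializes trivial
  obtain ⟨y, hy⟩ := h1
  have : Subsingleton (PrimeSpectrum (X.presheaf.stalk x)) := by
    let := hf.toField
    infer_instance
  have h2 : y = IsLocalRing.closedPoint (X.presheaf.stalk x) :=
    Subsingleton.elim (α := PrimeSpectrum (X.presheaf.stalk x)) _ _
  rw [← hy, h2, Scheme.fromSpecStalk_closedPoint]

omit [IsIntegral X] in
lemma exists_closedPoint_specializes [CompactSpace X] (x : X) : ∃ y : closedPoints X, x ⤳ (y : X) := by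
  obtain ⟨y, hy, hy'⟩ := IsClosed.exists_closed_singleton (S := closure {x}) isClosed_closure
    ⟨x, subset_closure rfl⟩
  exact ⟨⟨y, hy'⟩, specializes_iff_mem_closure.2 hy⟩

end

/-! ### The places of a complete curve. -/

section
variable {k : Type u} [Field k] {X : Scheme.{u}} (p : X ⟶ Spec (.of k)) [IsIntegral X]

open KaehlerDifferential in
lemma exists_D_algebraMap_stalk [IsAlgClosed k] [LocallyOfFiniteType p] {x : X} (hx : IsClosed {x})
    {t : X.presheaf.stalk x}
    (ht : IsLocalRing.maximalIdeal (X.presheaf.stalk x) = Ideal.span {t})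
    (r : X.presheaf.stalk x) :
    letI := functionFieldAlgebra p
    ∃ a : X.presheaf.stalk x, D k X.functionField (algebraMap _ X.functionField r) =
      algebraMap _ X.functionField a • D k X.functionField (algebraMap _ X.functionField t) := by
  let := functionFieldAlgebra p
  let := (stalkBase p x).hom.toAlgebra
  have : IsScalarTower k (X.presheaf.stalk x) X.functionField :=
    .of_algebraMap_eq fun c => (algebraMap_stalkBase p x c).symm
  have : Algebra.EssFiniteType k (X.presheaf.stalk x) := essFiniteType_stalkBase p x
  obtain ⟨a, ha⟩ := KaehlerDifferential.exists_D_eq_smul (k := k) ht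
    (exists_sub_stalkBase_mem p hx) r
  refine ⟨a, ?_⟩
  have := congrArg (KaehlerDifferential.map k k (X.presheaf.stalk x) X.functionField) ha
  rw [map_smul, map_D, map_D] at this
  rw [algebraMap_smul]
  exact this

open KaehlerDifferential in
lemma essFiniteType_functionField [LocallyOfFiniteType p] :
    letI := functionFieldAlgebra p
    Algebra.EssFiniteType k X.functionField := essFiniteType_stalkBase p (genericPoint X)

/-- The generators `t` make the noetherian local rings at closed points discrete valuation rings.
Properness gives every valuation ring over `k` a centre and makes points determined by their local
rings. -/
lemma exists_placeSystem [IsAlgClosed k] [CharZero k] [IsProper p]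
    (hdim : topologicalKrullDim X = 1) (t : ∀ x : closedPoints X, X.presheaf.stalk (x : X))
    (ht : ∀ x : closedPoints X, IsLocalRing.maximalIdeal (X.presheaf.stalk (x : X)) = Ideal.span {t x}) :
    letI := functionFieldAlgebra p
    ∃ S : PlaceSystem k X.functionField (closedPoints X),
      (∀ (x : closedPoints X) f, f ∈ S.O x ↔ ∃ r, algebraMap (X.presheaf.stalk (x : X)) X.functionField r = f) ∧
      ∀ x : closedPoints X, S.unif x = algebraMap (X.presheaf.stalk (x : X)) X.functionField (t x) := by
  let := functionFieldAlgebra p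
  have : IsLocallyNoetherian X := LocallyOfFiniteType.isLocallyNoetherian p
  have hdvr : ∀ x : closedPoints X, IsDiscreteValuationRing (X.presheaf.stalk (x : X)) := by
    intro x
    have hf := not_isField_stalk (isClosed_ne_genericPoint hdim x.2)
    have hp : (IsLocalRing.maximalIdeal (X.presheaf.stalk (x : X))).IsPrincipal := ⟨⟨t x, ht x⟩⟩
    exact ((IsDiscreteValuationRing.TFAE _ hf).out 4 0).1 hp
  have hcomp : CompactSpace X := by
    have : QuasiCompact p := inferInstance
    exact (quasiCompact_iff_compactSpace p).1 this
  have ht0 : ∀ x : closedPoints X, algebraMap (X.presheaf.stalk (x : X)) X.functionField (t x) ≠ 0 := by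
    intro x
    have := ((IsDiscreteValuationRing.irreducible_iff_uniformizer (t x)).2 (ht x)).ne_zero
    simpa using this
  have hinv : ∀ x : closedPoints X, ∀ r, algebraMap (X.presheaf.stalk (x : X)) X.functionField r ≠
      (algebraMap (X.presheaf.stalk (x : X)) X.functionField (t x))⁻¹ := by
    intro x r hr
    have h1 : r * t x = 1 := by
      apply IsFractionRing.injective (X.presheaf.stalk (x : X)) X.functionField
      rw [map_mul, hr, inv_mul_cancel₀ (ht0 x), map_one]
    have := (IsDiscreteValuationRing.irreducible_iff_uniformizer (t x)).2 (ht x)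
    exact this.not_isUnit (IsUnit.of_mul_eq_one_right _ h1)
  have halg : ∀ (x : X) (c : k), algebraMap k X.functionField c =
      algebraMap (X.presheaf.stalk x) X.functionField ((stalkBase p x).hom c) :=
    fun x c => (algebraMap_stalkBase p x c).symm
  refine ⟨{ 
    O := fun x => ValuationRing.rangeSubring (X.presheaf.stalk (x : X)) X.functionField
    injective := fun x y h => Subtype.ext (eq_of_range_stalk_eq p (by
      ext f; exact SetLike.ext_iff.1 h f))
    algebraMap_mem := fun x c => ⟨_, (halg x c).symm⟩
    exists_eq := fun V hV hVt => ?_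
    unif := fun x => algebraMap (X.presheaf.stalk (x : X)) X.functionField (t x)
    unif_mem := fun x => ⟨_, rfl⟩
    inv_unif_notMem := fun x ⟨r, hr⟩ => hinv x r hr
    exists_eq_mul_zpow := fun x f hf => ?_
    exists_residue := fun x f hf => ?_
    finite_adjoin := fun x hx => ?_ }, fun x f => Iff.rfl, fun x => rfl⟩
  -- The centre `y` of `V` specializes to a closed point `x`, so `V` contains the local ring there.
  -- Were it strictly larger, it would contain `(t x)⁻¹` and be the whole field.
  · obtain ⟨y, hy⟩ := exists_stalk_le_valuationSubring p V hV
    obtain ⟨x, hx⟩ := exists_closedPoint_specializes y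
    have hle' : ValuationRing.rangeSubring (X.presheaf.stalk (x : X)) X.functionField ≤ V := by
      rintro _ ⟨r, rfl⟩
      have : algebraMap (X.presheaf.stalk (x : X)) X.functionField r =
          algebraMap (X.presheaf.stalk y) X.functionField
            (X.presheaf.stalkSpecializes hx r) := by
        exact congr($(X.presheaf.stalkSpecializes_comp
          ((genericPoint_spec X).specializes trivial) hx).hom r).symm
      change algebraMap (X.presheaf.stalk (x : X)) X.functionField r ∈ V
      rw [this]
      exact hy _
    refine ⟨x, le_antisymm hle' ?_⟩
    · intro f hf
      by_contra hfx
      apply hVt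
      have hf0 : f ≠ 0 := by
        rintro rfl
        exact hfx (zero_mem _)
      have hle : ∀ r, algebraMap (X.presheaf.stalk (x : X)) X.functionField r ∈ V := fun r => hle' ⟨r, rfl⟩
      obtain ⟨n, u, h⟩ := IsDiscreteValuationRing.exists_eq_units_mul_zpow (ht x) hf0
      have hn : n < 0 := by
        by_contra hn
        lift n to ℕ using by omega
        exact hfx ⟨u * t x ^ n, by rw [h, zpow_natCast, map_mul, map_pow]⟩
      have hu : ∀ v : (X.presheaf.stalk (x : X))ˣ,
          algebraMap (X.presheaf.stalk (x : X)) X.functionField v *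
            algebraMap (X.presheaf.stalk (x : X)) X.functionField (v⁻¹ : _ˣ) = 1 := by
        intro v
        rw [← map_mul, Units.mul_inv, map_one]
      have htV : (algebraMap (X.presheaf.stalk (x : X)) X.functionField (t x))⁻¹ ∈ V := by
        obtain ⟨m, hm⟩ := Int.eq_ofNat_of_zero_le (show 0 ≤ -n - 1 by omega)
        have h1 : (algebraMap (X.presheaf.stalk (x : X)) X.functionField (t x))⁻¹ =
            f * algebraMap (X.presheaf.stalk (x : X)) X.functionField
              ((u⁻¹ : (X.presheaf.stalk (x : X))ˣ) * t x ^ m) := by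
          rw [h, map_mul, map_pow, mul_mul_mul_comm, hu, one_mul, ← zpow_natCast,
            ← zpow_add₀ (ht0 x), ← hm, show n + (-n - 1) = -1 by ring, zpow_neg_one]
        rw [h1]
        exact mul_mem hf (hle _)
      rw [eq_top_iff]
      rintro g -
      by_cases hg : g = 0
      · rw [hg]; exact zero_mem _
      obtain ⟨m, w, hgw⟩ := IsDiscreteValuationRing.exists_eq_units_mul_zpow (ht x) hg
      rw [hgw]
      refine mul_mem (hle _) ?_
      obtain ⟨m, rfl | rfl⟩ := m.eq_nat_or_neg
      · rw [zpow_natCast, ← map_pow]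
        exact hle _
      · rw [zpow_neg, zpow_natCast, ← inv_pow]
        exact pow_mem htV _
  · obtain ⟨n, u, h⟩ := IsDiscreteValuationRing.exists_eq_units_mul_zpow (ht x) hf
    refine ⟨n, algebraMap _ _ (u : X.presheaf.stalk (x : X)), ⟨_, rfl⟩,
      ⟨((u⁻¹ : (X.presheaf.stalk (x : X))ˣ) : X.presheaf.stalk (x : X)), ?_⟩, ?_, h⟩
    · refine eq_inv_of_mul_eq_one_left ?_
      change algebraMap _ _ _ * algebraMap _ _ _ = _
      rw [← map_mul, Units.inv_mul, map_one]
    · simp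
  · obtain ⟨r, rfl⟩ := hf
    obtain ⟨c, hc⟩ := exists_sub_stalkBase_mem p x.2 r
    rw [ht, Ideal.mem_span_singleton'] at hc
    obtain ⟨s, hs⟩ := hc
    refine ⟨c, s, ?_⟩
    rw [eq_mul_inv_iff_mul_eq₀ (ht0 x), halg x]
    change algebraMap _ _ _ * _ = algebraMap _ _ _ - _
    rw [← map_mul, hs, map_sub]
  · obtain ⟨x₀, -⟩ := exists_closedPoint_specializes (genericPoint X)
    have := essFiniteType_functionField p
    refine KaehlerDifferential.finiteDimensional_adjoin
      (algebraMap (X.presheaf.stalk (x₀ : X)) X.functionField (t x₀)) (fun f => ?_) hx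
    rcases (ValuationRing.rangeSubring (X.presheaf.stalk (x₀ : X))
      X.functionField).mem_or_inv_mem f with ⟨r, hr⟩ | ⟨r, hr⟩
    · obtain ⟨a, ha⟩ := exists_D_algebraMap_stalk p x₀.2 (ht x₀) r
      rw [← hr]
      exact ⟨_, ha⟩
    · obtain ⟨a, ha⟩ := exists_D_algebraMap_stalk p x₀.2 (ht x₀) r
      refine ⟨-f ^ 2 * algebraMap (X.presheaf.stalk (x₀ : X)) X.functionField a, ?_⟩
      rw [← inv_inv f, Derivation.leibniz_inv, ← hr, mul_smul, ← ha]

/-- The degree of a canonical divisor of a complete normal curve is `-2` or nonnegative. -/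
theorem deg_canonical [IsAlgClosed k] [CharZero k] (h : IsCompleteNormalCurve p)
    {K : CurveDivisor X ℤ} (hK : IsCanonicalDivisor p K) : K.deg = -2 ∨ 0 ≤ K.deg := by
  let := functionFieldAlgebra p
  have := h.isProper
  obtain ⟨ω, hω, hK⟩ := hK
  choose t v ht hωt using hK
  obtain ⟨S, hS, hSt⟩ := exists_placeSystem p h.dim_eq_one t ht
  refine S.sum_canonical hω ?_ ?_
  · intro x f hf
    obtain ⟨r, rfl⟩ := (hS x f).1 hf
    obtain ⟨a, ha⟩ := exists_D_algebraMap_stalk p x.2 (ht x) r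
    exact ⟨_, (hS x _).2 ⟨a, rfl⟩, by rw [hSt]; exact ha⟩
  · intro x
    have hv : algebraMap (X.presheaf.stalk (x : X)) X.functionField (v x) ≠ 0 := by simp
    have hu := S.unif_ne_zero x
    have hm : ∀ u : (X.presheaf.stalk (x : X))ˣ,
        algebraMap (X.presheaf.stalk (x : X)) X.functionField u ∈ S.O x := fun u =>
      (hS x _).2 ⟨_, rfl⟩
    refine ⟨algebraMap (X.presheaf.stalk (x : X)) X.functionField (v x) * S.unif x ^ K x,
      mul_ne_zero hv (zpow_ne_zero _ hu), S.ord_eq_of x (hm _) ?_ hv rfl, ?_⟩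
    · have : (algebraMap (X.presheaf.stalk (x : X)) X.functionField (v x))⁻¹ =
          algebraMap (X.presheaf.stalk (x : X)) X.functionField ((v x)⁻¹ : _ˣ) := by
        refine (eq_inv_of_mul_eq_one_left ?_).symm
        rw [← map_mul, Units.inv_mul, map_one]
      rw [this]
      exact hm _
    · rw [hSt]
      exact hωt x

end

/-! ### Affine charts and the function field. -/

section
variable {R : Type u} [CommRing R] {Y : Scheme.{u}} (c : Spec (.of R) ⟶ Y) [IsOpenImmersion c]

/-- The localization map from the coordinate ring of an affine chart to a local ring. -/
noncomputable def chartStalk (y : Spec (.of R)) :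
    CommRingCat.of R ⟶ Y.presheaf.stalk (c y) :=
  (show CommRingCat.of R ⟶ (Spec (.of R)).presheaf.stalk y from StructureSheaf.toStalk R y) ≫
    inv (c.stalkMap y)

lemma map_chartStalk (y : Spec (.of R)) :
    Spec.map (chartStalk c y) ≫ c = Y.fromSpecStalk (c y) := by
  have h : Spec.map (show CommRingCat.of R ⟶ (Spec (.of R)).presheaf.stalk y from
      StructureSheaf.toStalk R y) = (Spec (.of R)).fromSpecStalk y :=
    (Spec.fromSpecStalk_eq' (.of R) y).symm
  rw [chartStalk, Spec.map_comp, h, Category.assoc, ← Scheme.SpecMap_stalkMap_fromSpecStalk,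
    ← Category.assoc, ← Spec.map_comp, IsIso.hom_inv_id, Spec.map_id, Category.id_comp]

instance (y : Spec (.of R)) : y.asIdeal.IsPrime := PrimeSpectrum.isPrime y

lemma isLocalization_chartStalk (y : Spec (.of R)) :
    letI := (chartStalk c y).hom.toAlgebra
    IsLocalization.AtPrime (Y.presheaf.stalk (c y)) y.asIdeal := by
  let g : CommRingCat.of R ⟶ (Spec (.of R)).presheaf.stalk y := StructureSheaf.toStalk R y
  have h1 := StructureSheaf.IsLocalization.to_stalk R y
  let := (chartStalk c y).hom.toAlgebra
  let : Algebra R ((Spec (.of R)).presheaf.stalk y) := g.hom.toAlgebra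
  have h1 : IsLocalization y.asIdeal.primeCompl ((Spec (.of R)).presheaf.stalk y) := h1
  let e : (Spec (.of R)).presheaf.stalk y ≃+* Y.presheaf.stalk (c y) :=
    (asIso (inv (c.stalkMap y))).commRingCatIsoToRingEquiv
  exact IsLocalization.isLocalization_of_algEquiv y.asIdeal.primeCompl
    (AlgEquiv.ofRingEquiv (f := e) fun r => rfl)

lemma maximalIdeal_stalk_eq_span (y : Spec (.of R)) {f : R} (hf : y.asIdeal = Ideal.span {f}) :
    IsLocalRing.maximalIdeal (Y.presheaf.stalk (c y)) = Ideal.span {(chartStalk c y).hom f} := by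
  let := (chartStalk c y).hom.toAlgebra
  have := isLocalization_chartStalk c y
  have h := IsLocalization.AtPrime.map_eq_maximalIdeal y.asIdeal (Y.presheaf.stalk (c y))
  rw [← h, hf, Ideal.map_span, Set.image_singleton]
  rfl

lemma isDomain_stalk_chart [IsDomain R] (y : Spec (.of R)) :
    IsDomain (Y.presheaf.stalk (c y)) := by
  let := (chartStalk c y).hom.toAlgebra
  have := isLocalization_chartStalk c y
  exact IsLocalization.isDomain_of_le_nonZeroDivisors (R := R) (M := y.asIdeal.primeCompl) _ y.asIdeal.primeCompl_le_nonZeroDivisors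

lemma isIntegrallyClosed_stalk_chart [IsDomain R] [IsIntegrallyClosed R] (y : Spec (.of R)) :
    IsIntegrallyClosed (Y.presheaf.stalk (c y)) := by
  let := (chartStalk c y).hom.toAlgebra
  have := isLocalization_chartStalk c y
  exact isIntegrallyClosed_of_isLocalization (R := R) _ y.asIdeal.primeCompl
    y.asIdeal.primeCompl_le_nonZeroDivisors

variable [IsDomain R]

lemma injective_chartStalk (y : Spec (.of R)) : Function.Injective (chartStalk c y).hom := by
  let := (chartStalk c y).hom.toAlgebra
  have := isLocalization_chartStalk c y
  exact IsLocalization.injective (Y.presheaf.stalk (c y)) y.asIdeal.primeCompl_le_nonZeroDivisors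

variable [IsIntegral Y]

/-- The map from the coordinate ring of an affine chart to the function field. -/
noncomputable def chartFunctionField : R →+* Y.functionField :=
  (algebraMap (Y.presheaf.stalk (c (⊥ : PrimeSpectrum R))) Y.functionField).comp
    (chartStalk c (⊥ : PrimeSpectrum R)).hom

omit [IsDomain R] in
lemma map_algebraMap_comp_chartStalk (y : Spec (.of R)) :
    Spec.map (CommRingCat.ofHom ((algebraMap (Y.presheaf.stalk (c y)) Y.functionField).comp
      (chartStalk c y).hom)) ≫ c = Y.fromSpecStalk (genericPoint Y) := by
  rw [← fromSpecStalk_genericPoint (c y), ← map_chartStalk, ← Category.assoc, ← Spec.map_comp]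
  rfl

lemma map_chartFunctionField :
    Spec.map (CommRingCat.ofHom (chartFunctionField c)) ≫ c = Y.fromSpecStalk (genericPoint Y) :=
  map_algebraMap_comp_chartStalk c _

/-- An open immersion is a monomorphism, so compatibility with the generic point determines the ring
map. This is how different routes to the function field are compared. -/
lemma eq_chartFunctionField {f : R →+* Y.functionField}
    (hf : Spec.map (CommRingCat.ofHom f) ≫ c = Y.fromSpecStalk (genericPoint Y)) :
    f = chartFunctionField c := by
  rw [← map_chartFunctionField c, cancel_mono] at hf
  exact congr($(Spec.map_injective hf).hom)

lemma algebraMap_chartStalk (y : Spec (.of R)) (r : R) :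
    algebraMap (Y.presheaf.stalk (c y)) Y.functionField ((chartStalk c y).hom r) =
      chartFunctionField c r := by
  rw [← eq_chartFunctionField c (f := (algebraMap (Y.presheaf.stalk (c y)) Y.functionField).comp
    (chartStalk c y).hom)]
  · rfl
  · exact map_algebraMap_comp_chartStalk c y

lemma injective_chartFunctionField : Function.Injective (chartFunctionField c) :=
  (IsFractionRing.injective _ _).comp (injective_chartStalk c _)

lemma chartFunctionField_base {k : Type u} [Field k] (p : Y ⟶ Spec (.of k)) {φ : k →+* R}
    (h : c ≫ p = Spec.map (CommRingCat.ofHom φ)) (a : k) :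
    chartFunctionField c (φ a) = (stalkBase p (genericPoint Y)).hom a := by
  have : stalkBase p (genericPoint Y) =
      CommRingCat.ofHom φ ≫ CommRingCat.ofHom (chartFunctionField c) := by
    apply Spec.map_injective
    rw [map_stalkBase, Spec.map_comp, ← h, ← map_chartFunctionField c, Category.assoc]
  rw [this]
  rfl

end

/-! ### Curves glued from two affine lines. -/

section

open Polynomial

/-- A scheme glued from two affine lines along the complements of the origins, the coordinates
being inverse to each other. -/
structure LineGluing {k : Type u} [Field k] {Y : Scheme.{u}} (p : Y ⟶ Spec (.of k)) where
  c₀ : Spec (.of k[X]) ⟶ Y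
  c₁ : Spec (.of k[X]) ⟶ Y
  open₀ : IsOpenImmersion c₀
  open₁ : IsOpenImmersion c₁
  base₀ : c₀ ≫ p = Spec.map (CommRingCat.ofHom C)
  base₁ : c₁ ≫ p = Spec.map (CommRingCat.ofHom C)
  cover : ∀ y : Y, (∃ z, c₀ z = y) ∨ ∃ z, c₁ z = y
  L : Type u
  [commRing : CommRing L]
  ψ₀ : k[X] →+* L
  ψ₁ : k[X] →+* L
  inverse : ψ₀ X * ψ₁ X = 1
  isLocalization : letI := ψ₁.toAlgebra; IsLocalization.Away (X : k[X]) L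
  glue : Spec.map (CommRingCat.ofHom ψ₀) ≫ c₀ = Spec.map (CommRingCat.ofHom ψ₁) ≫ c₁

namespace LineGluing

attribute [instance] open₀ open₁ commRing

variable {k : Type u} [Field k] {Y : Scheme.{u}} {p : Y ⟶ Spec (.of k)} (G : LineGluing p)

include G

/-- Off the origin, a point of the second chart comes from the overlap `Spec L` and so lies in the
first chart as well. -/
lemma exists_c₀_eq {z : Spec (.of k[X])} (hz : X ∉ z.asIdeal) : ∃ y, G.c₀ y = G.c₁ z := by
  let := G.ψ₁.toAlgebra
  have := G.isLocalization
  have hz' : z ∈ Set.range (PrimeSpectrum.comap G.ψ₁) := by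
    rw [show G.ψ₁ = algebraMap k[X] G.L from rfl,
      PrimeSpectrum.localization_away_comap_range G.L (X : k[X])]
    exact hz
  obtain ⟨w, rfl⟩ := hz'
  exact ⟨PrimeSpectrum.comap G.ψ₀ w, congr($(G.glue) w)⟩

/-- The generic point of the first chart is dense: its closure contains the generic point of the
second chart, which lies in the overlap. -/
lemma irreducibleSpace : IrreducibleSpace Y := by
  have key : ∀ (c : Spec (.of k[X]) ⟶ Y) (Z : Set Y), IsClosed Z →
      c (⊥ : PrimeSpectrum k[X]) ∈ Z → ∀ z, c z ∈ Z := by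
    intro c Z hZ hc z
    have h1 : IsClosed (c ⁻¹' Z) := hZ.preimage c.continuous
    have h2 : (⊥ : PrimeSpectrum k[X]) ⤳ z := (PrimeSpectrum.le_iff_specializes _ _).1 bot_le
    exact h2.mem_closed h1 hc
  have hclo : closure {G.c₀ (⊥ : PrimeSpectrum k[X])} = Set.univ := by
    rw [Set.eq_univ_iff_forall]
    intro y
    have h0 := key G.c₀ _ isClosed_closure (subset_closure (Set.mem_singleton _))
    rcases G.cover y with ⟨z, rfl⟩ | ⟨z, rfl⟩
    · exact h0 z
    · obtain ⟨w, hw⟩ := G.exists_c₀_eq (z := (⊥ : PrimeSpectrum k[X])) (fun h => X_ne_zero h)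
      exact key G.c₁ _ isClosed_closure (hw ▸ h0 w) z
  have : PreirreducibleSpace Y := ⟨by
    rw [← hclo]; exact (isPreirreducible_singleton).closure⟩
  exact { toNonempty := ⟨G.c₀ (⊥ : PrimeSpectrum k[X])⟩ }

lemma isIntegral : IsIntegral Y := by
  have := G.irreducibleSpace
  have (y : Y) : _root_.IsReduced (Y.presheaf.stalk y) := by
    rcases G.cover y with ⟨z, rfl⟩ | ⟨z, rfl⟩
    · have := isDomain_stalk_chart G.c₀ z
      infer_instance
    · have := isDomain_stalk_chart G.c₁ z
      infer_instance
  have : IsReduced Y := isReduced_of_isReduced_stalk Y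
  exact isIntegral_of_irreducibleSpace_of_isReduced Y

lemma isIntegrallyClosed_stalk (y : Y) : IsIntegrallyClosed (Y.presheaf.stalk y) := by
  rcases G.cover y with ⟨z, rfl⟩ | ⟨z, rfl⟩
  · exact isIntegrallyClosed_stalk_chart G.c₀ z
  · exact isIntegrallyClosed_stalk_chart G.c₁ z

-- `Y` is a Jacobson space, so closedness of a point is tested in an open chart, where it means that
-- the prime is maximal.
omit G in
lemma isClosed_iff [IsIntegral Y] [LocallyOfFiniteType p] (c : Spec (.of k[X]) ⟶ Y)
    [IsOpenImmersion c] (z : Spec (.of k[X])) : IsClosed {c z} ↔ z.asIdeal ≠ ⊥ := by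
  have : JacobsonSpace Y := LocallyOfFiniteType.jacobsonSpace p
  have h1 := c.isOpenEmbedding.preimage_closedPoints
  have h2 : IsClosed {c z} ↔ IsClosed {z} := Set.ext_iff.1 h1 z
  rw [h2]
  have h3 : IsClosed {z} ↔ z.asIdeal.IsMaximal := PrimeSpectrum.isClosed_singleton_iff_isMaximal z
  rw [h3]
  constructor
  · intro hm hz
    rw [hz] at hm
    exact Polynomial.not_isField k (Ring.isField_iff_maximal_bot.2 hm)
  · intro hz
    exact Ring.DimensionLEOne.maximalOfPrime hz inferInstance

omit G in
lemma chart_bot_eq [IsIntegral Y] (c : Spec (.of k[X]) ⟶ Y) [IsOpenImmersion c]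
    {z : Spec (.of k[X])} (hz : z.asIdeal = ⊥) : c z = genericPoint Y := by
  have h : z = genericPoint (Spec (.of k[X])) := by
    rw [genericPoint_eq_bot_of_affine]
    exact PrimeSpectrum.ext hz
  rw [h]
  exact genericPoint_eq_of_isOpenImmersion c

omit G in
lemma isClosed_or_eq_genericPoint [IsIntegral Y] [LocallyOfFiniteType p] (G : LineGluing p) (y : Y) :
    IsClosed {y} ∨ y = genericPoint Y := by
  have key : ∀ (c : Spec (.of k[X]) ⟶ Y) [IsOpenImmersion c] (z : Spec (.of k[X])),
      IsClosed {c z} ∨ c z = genericPoint Y := by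
    intro c _ z
    by_cases hz : z.asIdeal = ⊥
    · exact Or.inr (chart_bot_eq c hz)
    · exact Or.inl ((isClosed_iff (p := p) c z).2 hz)
  rcases G.cover y with ⟨z, rfl⟩ | ⟨z, rfl⟩
  · exact key G.c₀ z
  · exact key G.c₁ z

omit G in
/-- The point of the affine line with coordinate `a`. -/
noncomputable def point (a : k) : Spec (.of k[X]) :=
  (⟨Ideal.span {X - C a}, (Ideal.span_singleton_prime (X_sub_C_ne_zero a)).2 (prime_X_sub_C a)⟩ :
    PrimeSpectrum k[X])

omit G in
lemma point_asIdeal (a : k) : (point a).asIdeal = Ideal.span {X - C a} := rfl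

omit G in
lemma point_asIdeal_ne_bot (a : k) : (point a).asIdeal ≠ ⊥ := by
  rw [point_asIdeal, Ne, Ideal.span_singleton_eq_bot]
  exact X_sub_C_ne_zero a

omit G in
lemma point_injective : Function.Injective (point (k := k)) := by
  intro a b h
  have h1 : X - C a ∈ (point b).asIdeal := by
    rw [← h]; exact Ideal.mem_span_singleton_self _
  rw [point_asIdeal, Ideal.mem_span_singleton, dvd_iff_isRoot] at h1
  simpa [sub_eq_zero, eq_comm] using h1

omit G in
lemma exists_eq_point [IsAlgClosed k] {z : Spec (.of k[X])} (hz : z.asIdeal ≠ ⊥) :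
    ∃ a, z = point a := by
  obtain ⟨f, hf, hf0⟩ := Submodule.exists_mem_ne_zero_of_ne_bot hz
  have hspl := IsAlgClosed.splits f
  have hprod := hspl.eq_prod_roots
  rw [hprod] at hf
  rcases z.2.mem_or_mem hf with h | h
  · exfalso
    apply z.2.ne_top
    refine Ideal.eq_top_of_isUnit_mem _ h (isUnit_C.2 ?_)
    simpa using hf0
  · obtain ⟨g, hg, hgz⟩ := (z.2.multiset_prod_mem_iff_exists_mem _).1 h
    obtain ⟨a, -, rfl⟩ := Multiset.mem_map.1 hg
    refine ⟨a, PrimeSpectrum.ext ?_⟩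
    have hmax : (point a).asIdeal.IsMaximal :=
      Ring.DimensionLEOne.maximalOfPrime (point_asIdeal_ne_bot a) (point a).2
    refine (hmax.eq_of_le z.2.ne_top ?_).symm
    rw [point_asIdeal, Ideal.span_singleton_le_iff_mem]
    exact hgz

lemma topologicalKrullDim_eq_one [LocallyOfFiniteType p] : topologicalKrullDim Y = 1 := by
  have := G.isIntegral
  have hgen : closure {genericPoint Y} = Set.univ := genericPoint_spec Y
  apply le_antisymm
  · refine Order.krullDim_le_one_iff.2 fun Z => ?_
    have hZ := Z.isIrreducible.isGenericPoint_genericPoint Z.isClosed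
    rcases isClosed_or_eq_genericPoint G Z.isIrreducible.genericPoint with h | h
    · left
      intro W hW
      have hZ' : (Z : Set Y) = {Z.isIrreducible.genericPoint} := by
        exact hZ.def.symm.trans h.closure_eq
      have hW' : (W : Set Y) ⊆ Z := hW
      rw [hZ', Set.subset_singleton_iff_eq] at hW'
      rcases hW' with hW' | hW'
      · exact absurd hW' W.isIrreducible.nonempty.ne_empty
      · change (Z : Set Y) ⊆ W
        rw [hZ', hW']
    · right
      intro W _
      change (W : Set Y) ⊆ Z
      rw [← hZ.def, h, hgen]
      exact Set.subset_univ _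
  · refine Order.one_le_krullDim_iff.2 ?_
    have hcl : IsClosed {G.c₀ (point 0)} :=
      (isClosed_iff (p := p) G.c₀ _).2 (point_asIdeal_ne_bot 0)
    have hne : G.c₀ (point 0) ≠ genericPoint Y := by
      rw [← chart_bot_eq G.c₀ (z := (⊥ : PrimeSpectrum k[X])) rfl]
      intro h
      have := G.c₀.isOpenEmbedding.injective h
      exact point_asIdeal_ne_bot (0 : k) (congrArg PrimeSpectrum.asIdeal this)
    refine ⟨⟨{G.c₀ (point 0)}, isIrreducible_singleton, hcl⟩,
      ⟨Set.univ, IrreducibleSpace.isIrreducible_univ Y, isClosed_univ⟩, ?_⟩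
    refine lt_of_le_of_ne (Set.subset_univ _) fun h => hne ?_
    have h1 : ({G.c₀ (point 0)} : Set Y) = Set.univ := 
      congrArg (fun Z : TopologicalSpace.IrreducibleCloseds Y => (Z : Set Y)) h
    have h2 : genericPoint Y ∈ ({G.c₀ (point 0)} : Set Y) := h1 ▸ Set.mem_univ _
    exact h2.symm

lemma isCompleteNormalCurve [IsProper p] : IsCompleteNormalCurve p where
  isIntegral := G.isIntegral
  isProper := inferInstance
  isNormal := G.isIntegrallyClosed_stalk
  dim_eq_one := G.topologicalKrullDim_eq_one

lemma infinite_closedPoints [IsAlgClosed k] [LocallyOfFiniteType p] : Infinite (closedPoints Y) := by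
  have := G.isIntegral
  have : Infinite k := IsAlgClosed.instInfinite
  refine Infinite.of_injective (fun a : k => (⟨G.c₀ (point a),
    (isClosed_iff (p := p) G.c₀ _).2 (point_asIdeal_ne_bot a)⟩ : closedPoints Y)) fun a b h => ?_
  exact point_injective (G.c₀.isOpenEmbedding.injective (congrArg Subtype.val h))

section
variable [IsIntegral Y]

/-- Both charts map to the function field through the overlap ring `L`, where the coordinates are
inverse. -/
lemma coord_mul_coord : chartFunctionField G.c₀ X * chartFunctionField G.c₁ X = 1 := by
  let := G.ψ₁.toAlgebra
  have := G.isLocalization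
  have hu : IsUnit (chartFunctionField G.c₁ X) := by
    rw [isUnit_iff_ne_zero]
    exact (map_ne_zero_iff _ (injective_chartFunctionField G.c₁)).2 X_ne_zero
  let l : G.L →+* Y.functionField := IsLocalization.Away.lift (X : k[X]) hu
  have hl : l.comp G.ψ₁ = chartFunctionField G.c₁ := IsLocalization.Away.lift_comp _ hu
  have hl' : l.comp G.ψ₀ = chartFunctionField G.c₀ := by
    apply eq_chartFunctionField
    rw [CommRingCat.ofHom_comp, Spec.map_comp, Category.assoc, G.glue, ← Category.assoc,
      ← Spec.map_comp, ← CommRingCat.ofHom_comp, hl, map_chartFunctionField]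
  rw [← hl, ← hl', RingHom.comp_apply, RingHom.comp_apply, ← map_mul, G.inverse, map_one]

open KaehlerDifferential

/-- If the differential of the coordinate vanished, all differentials would, and the function field
would be algebraic over `k`, hence equal to `k`; but the coordinate is not constant. -/
lemma D_coord_ne_zero [IsAlgClosed k] [CharZero k] [LocallyOfFiniteType p] :
    letI := functionFieldAlgebra p
    D k Y.functionField (chartFunctionField G.c₀ X) ≠ 0 := by
  let := functionFieldAlgebra p
  intro h0
  have hcl : IsClosed {G.c₀ (point 0)} :=
    (isClosed_iff (p := p) G.c₀ _).2 (point_asIdeal_ne_bot 0)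
  have hst : ∀ r, D k Y.functionField
      (algebraMap (Y.presheaf.stalk (G.c₀ (point 0))) Y.functionField r) = 0 := by
    intro r
    obtain ⟨a, ha⟩ := exists_D_algebraMap_stalk p hcl
      (maximalIdeal_stalk_eq_span G.c₀ (point 0) (point_asIdeal 0)) r
    rw [algebraMap_chartStalk, map_zero, sub_zero, h0, smul_zero] at ha
    exact ha
  have hall : ∀ f, D k Y.functionField f = 0 := by
    intro f
    obtain ⟨a, b, -, rfl⟩ :=
      IsFractionRing.div_surjective (A := Y.presheaf.stalk (G.c₀ (point 0))) f
    rw [Derivation.leibniz_div, hst, hst]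
    simp
  have := essFiniteType_functionField p
  have hunr : Algebra.FormallyUnramified k Y.functionField := by
    constructor
    rw [← Submodule.subsingleton_iff Y.functionField, ← subsingleton_iff_bot_eq_top,
      ← span_range_derivation, eq_comm, Submodule.span_eq_bot]
    rintro _ ⟨f, rfl⟩
    exact hall f
  have := Algebra.FormallyUnramified.isSeparable k Y.functionField
  obtain ⟨a, ha⟩ := (IsAlgClosed.algebraMap_bijective_of_isIntegral
    (k := k) (K := Y.functionField)).2 (chartFunctionField G.c₀ X)
  have h1 : chartFunctionField G.c₀ (C a) = chartFunctionField G.c₀ X :=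
    (chartFunctionField_base G.c₀ p G.base₀ a).trans ha
  exact X_ne_C a (injective_chartFunctionField G.c₀ h1).symm

-- The first coordinate is regular throughout the first chart, whereas its inverse is a nonunit at
-- the origin of the second.
omit [IsIntegral Y] in
lemma c₀_ne_c₁_point_zero (y : Spec (.of k[X])) : G.c₀ y ≠ G.c₁ (point 0) := by
  have := G.isIntegral
  intro h
  obtain ⟨w, hw⟩ : ∃ w : Y.presheaf.stalk (G.c₁ (point 0)),
      algebraMap _ Y.functionField w = chartFunctionField G.c₀ X := by
    rw [← h]
    exact ⟨_, algebraMap_chartStalk G.c₀ y X⟩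
  have h1 : (chartStalk G.c₁ (point 0)).hom X ∈
      IsLocalRing.maximalIdeal (Y.presheaf.stalk (G.c₁ (point 0))) := by
    rw [maximalIdeal_stalk_eq_span G.c₁ (point 0) (point_asIdeal 0), map_zero, sub_zero]
    exact Ideal.mem_span_singleton_self _
  rw [IsLocalRing.mem_maximalIdeal] at h1
  apply h1
  refine IsUnit.of_mul_eq_one_right w ?_
  apply IsFractionRing.injective (Y.presheaf.stalk (G.c₁ (point 0))) Y.functionField
  rw [map_mul, hw, algebraMap_chartStalk, G.coord_mul_coord, map_one]

/-- Take `du` for the coordinate `u` of the first chart. There `u - a` is a local parameter, so the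
order is `0`; at the one remaining point `u = 1 / v` and `du = -v⁻² dv`. -/
theorem exists_isCanonicalDivisor [IsAlgClosed k] [CharZero k] [LocallyOfFiniteType p] :
    ∃ K : CurveDivisor Y ℤ, IsCanonicalDivisor p K ∧ K.deg = -2 := by
  classical
  let := functionFieldAlgebra p
  have hcl : IsClosed {G.c₁ (point 0)} :=
    (isClosed_iff (p := p) G.c₁ _).2 (point_asIdeal_ne_bot 0)
  let P : closedPoints Y := ⟨G.c₁ (point 0), hcl⟩
  have key₀ : ∀ a, HasOrderAt p (D k Y.functionField (chartFunctionField G.c₀ X))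
      (G.c₀ (point a)) 0 := by
    intro a
    refine ⟨_, 1, maximalIdeal_stalk_eq_span G.c₀ (point a) (point_asIdeal a), ?_⟩
    have h1 : D k Y.functionField (chartFunctionField G.c₀ (C a)) = 0 := by
      rw [chartFunctionField_base G.c₀ p G.base₀ a]
      exact Derivation.map_algebraMap _ a
    rw [algebraMap_chartStalk, map_sub, map_sub, h1, sub_zero, Units.val_one, map_one, zpow_zero,
      mul_one, one_smul]
  have key₁ : HasOrderAt p (D k Y.functionField (chartFunctionField G.c₀ X))
      (G.c₁ (point 0)) (-2) := by
    refine ⟨_, -1, maximalIdeal_stalk_eq_span G.c₁ (point 0) (point_asIdeal 0), ?_⟩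
    have h1 : chartFunctionField G.c₀ X = (chartFunctionField G.c₁ X)⁻¹ :=
      eq_inv_of_mul_eq_one_left G.coord_mul_coord
    rw [algebraMap_chartStalk, map_zero, sub_zero, h1, Derivation.leibniz_inv, Units.val_neg,
      Units.val_one, map_neg, map_one, neg_one_mul, zpow_neg, inv_pow]
    norm_cast
  refine ⟨Finsupp.single P (-2), ⟨D k Y.functionField (chartFunctionField G.c₀ X),
    G.D_coord_ne_zero, ?_⟩, Finsupp.sum_single_index rfl⟩
  rintro ⟨x, hx⟩
  by_cases hx₀ : ∃ y, G.c₀ y = x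
  · obtain ⟨y, rfl⟩ := hx₀
    obtain ⟨a, rfl⟩ := exists_eq_point ((isClosed_iff (p := p) G.c₀ y).1 hx)
    rw [Finsupp.single_eq_of_ne]
    · exact key₀ a
    · intro h
      exact G.c₀_ne_c₁_point_zero _ (congrArg Subtype.val h)
  · obtain ⟨z, rfl⟩ := (G.cover x).resolve_left hx₀
    have hX : X ∈ z.asIdeal := by
      by_contra hX
      exact hx₀ (G.exists_c₀_eq hX)
    obtain ⟨a, rfl⟩ := exists_eq_point ((isClosed_iff (p := p) G.c₁ z).1 hx)
    have ha : a = 0 := by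
      rw [point_asIdeal, Ideal.mem_span_singleton, dvd_iff_isRoot] at hX
      simpa using hX
    subst ha
    rw [show (⟨G.c₁ (point 0), hx⟩ : closedPoints Y) = P from rfl, Finsupp.single_eq_same]
    exact key₁

end

end LineGluing

end

/-! ### The projective line. -/

namespace ProjLine
open MvPolynomial HomogeneousLocalization

variable (k : Type u) [Field k]

/-- The grading of the homogeneous coordinate ring of the projective line. -/
noncomputable abbrev grading : ℕ → Submodule k (MvPolynomial (Fin 2) k) := homogeneousSubmodule (Fin 2) k

noncomputable instance : GradedAlgebra (grading k) := MvPolynomial.gradedAlgebra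

instance : Nontrivial (grading k 0) :=
  ⟨0, 1, fun h => zero_ne_one (congrArg Subtype.val h : (0 : MvPolynomial (Fin 2) k) = 1)⟩

instance : Algebra.FiniteType (grading k 0) (MvPolynomial (Fin 2) k) :=
  have := IsScalarTower.of_algebraMap_eq (R := k) (S := grading k 0)
    (A := MvPolynomial (Fin 2) k) fun _ => rfl
  .of_restrictScalars_finiteType k _ _

lemma X_mem (i : Fin 2) : (X i : MvPolynomial (Fin 2) k) ∈ grading k 1 := isHomogeneous_X k i

lemma bijective_algebraMap : Function.Bijective (algebraMap k (grading k 0)) := by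
  constructor
  · exact (algebraMap k (grading k 0)).injective
  · rintro ⟨f, hf⟩
    have h := hf
    rw [grading, homogeneousSubmodule_zero, Submodule.mem_one] at h
    obtain ⟨c, hc⟩ := h
    exact ⟨c, Subtype.ext hc⟩

/-- The structure morphism of the projective line. -/
noncomputable def structureMap : Proj (grading k) ⟶ Spec (.of k) :=
  Proj.toSpecZero (grading k) ≫ Spec.map (CommRingCat.ofHom (algebraMap k (grading k 0)))

instance : IsProper (structureMap k) := by
  have : IsIso (CommRingCat.ofHom (algebraMap k (grading k 0))) :=
    (ConcreteCategory.isIso_iff_bijective _).2 (bijective_algebraMap k)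
  unfold structureMap
  infer_instance

/-- The coordinate `X j / X i` on the chart where `X i` does not vanish. -/
noncomputable def ratio (i j : Fin 2) : Away (grading k) (X i : MvPolynomial (Fin 2) k) :=
  Away.isLocalizationElem (X_mem k i) (X_mem k j)

/-- The coordinate ring of the chart where `X i` does not vanish. -/
noncomputable def coord (i j : Fin 2) :
    Polynomial k →+* Away (grading k) (X i : MvPolynomial (Fin 2) k) :=
  Polynomial.eval₂RingHom ((fromZeroRingHom (grading k) _).comp (algebraMap k (grading k 0)))
    (ratio k i j)

/-- Dehomogenization. -/
noncomputable def dehom (i : Fin 2) : MvPolynomial (Fin 2) k →+* Polynomial k :=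
  eval₂Hom Polynomial.C (fun j => if j = i then 1 else Polynomial.X)

lemma dehom_C (i : Fin 2) (a : k) : dehom k i (C a) = Polynomial.C a := eval₂_C _ _ _

lemma dehom_X_self (i : Fin 2) : dehom k i (X i) = 1 := by simp [dehom]

lemma dehom_X {i j : Fin 2} (hij : j ≠ i) : dehom k i (X j) = Polynomial.X := by simp [dehom, hij]

/-- `coord`, with values in the full localization. -/
noncomputable def coordLoc (i j : Fin 2) :
    Polynomial k →+* Localization.Away (X i : MvPolynomial (Fin 2) k) :=
  (algebraMap (Away (grading k) (X i : MvPolynomial (Fin 2) k)) _).comp (coord k i j)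

lemma coordLoc_C (i j : Fin 2) (a : k) :
    coordLoc k i j (Polynomial.C a) = algebraMap (MvPolynomial (Fin 2) k) _ (C a) := by
  rw [coordLoc, RingHom.comp_apply, coord, Polynomial.coe_eval₂RingHom, Polynomial.eval₂_C]
  rfl

lemma coordLoc_X_mul (i j : Fin 2) :
    coordLoc k i j Polynomial.X * algebraMap (MvPolynomial (Fin 2) k) _ (X i) =
      algebraMap (MvPolynomial (Fin 2) k) _ (X j) := by
  rw [coordLoc, RingHom.comp_apply, coord, Polynomial.coe_eval₂RingHom, Polynomial.eval₂_X, ratio,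
    HomogeneousLocalization.algebraMap_apply, Away.isLocalizationElem, Away.val_mk,
    Localization.mk_eq_mk']
  have h := IsLocalization.mk'_spec (Localization.Away (X i : MvPolynomial (Fin 2) k)) (X j ^ 1)
    (⟨X i ^ 1, 1, rfl⟩ : Submonoid.powers (X i : MvPolynomial (Fin 2) k))
  exact (congrArg (_ * algebraMap _ (Localization.Away (X i)) ·) (pow_one (X i)).symm).trans
    (h.trans (congrArg _ (pow_one (X j))))

/-- On a monomial with `n = a + b` this is `(X j / X i) ^ b * X i ^ n = X i ^ a * X j ^ b`. -/
lemma coordLoc_dehom_mul {i j : Fin 2} (hij : j ≠ i) {n : ℕ} {f : MvPolynomial (Fin 2) k}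
    (hf : f.IsHomogeneous n) :
    coordLoc k i j (dehom k i f) * algebraMap (MvPolynomial (Fin 2) k) _ (X i) ^ n =
      algebraMap (MvPolynomial (Fin 2) k) _ f := by
  have hij' : i = 0 ∧ j = 1 ∨ i = 1 ∧ j = 0 := by
    revert hij i j
    decide
  conv_lhs => rw [f.as_sum]
  conv_rhs => rw [f.as_sum]
  rw [map_sum, map_sum, map_sum, Finset.sum_mul]
  refine Finset.sum_congr rfl fun d hd => ?_
  have hdn : n = d i + d j := by
    have h1 : d.degree = n := by
      rw [Finsupp.degree_eq_weight_one]
      exact hf (mem_support_iff.1 hd)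
    rw [Finsupp.degree_eq_sum, Fin.sum_univ_two] at h1
    rcases hij' with ⟨rfl, rfl⟩ | ⟨rfl, rfl⟩ <;> omega
  have hmon : monomial d (f.coeff d) = C (f.coeff d) * (X i ^ d i * X j ^ d j) := by
    rw [monomial_eq, Finsupp.prod_fintype _ _ (by simp), Fin.prod_univ_two]
    rcases hij' with ⟨rfl, rfl⟩ | ⟨rfl, rfl⟩
    · rfl
    · rw [mul_comm (X 1 ^ _)]
  rw [hmon, hdn]
  simp only [map_mul, map_pow, dehom_C, dehom_X_self, dehom_X k hij, coordLoc_C, one_pow, one_mul]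
  rw [← coordLoc_X_mul k i j]
  ring

/-- Dehomogenization, extended to the localization, is a left inverse, and `f / X i ^ n` is the
image of the dehomogenization of `f`. -/
lemma bijective_coord {i j : Fin 2} (hij : j ≠ i) : Function.Bijective (coord k i j) := by
  constructor
  · let l : Localization.Away (X i : MvPolynomial (Fin 2) k) →+* Polynomial k :=
      Localization.awayLift (dehom k i) (X i) (by rw [dehom_X_self]; exact isUnit_one)
    have hl : ∀ f, l (algebraMap _ _ f) = dehom k i f := fun f => IsLocalization.Away.lift_eq _ _ f
    have h : l.comp (coordLoc k i j) = RingHom.id _ := by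
      apply Polynomial.ringHom_ext
      · intro a
        rw [RingHom.comp_apply, coordLoc_C, hl, dehom_C, RingHom.id_apply]
      · have := congrArg l (coordLoc_X_mul k i j)
        rwa [map_mul, hl, hl, dehom_X_self, mul_one, dehom_X k hij] at this
    intro f g hfg
    have := congrArg (fun z => l (algebraMap _ _ z)) hfg
    exact (congr($h f)).symm.trans (this.trans congr($h g))
  · intro z
    obtain ⟨n, f, hf, rfl⟩ := Away.mk_surjective (grading k) (X_mem k i) z
    refine ⟨dehom k i f, ?_⟩
    rw [smul_eq_mul, mul_one] at hf
    apply val_injective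
    rw [Away.val_mk, Localization.mk_eq_mk', IsLocalization.eq_mk'_iff_mul_eq, map_pow]
    exact coordLoc_dehom_mul k hij hf

/-- The coordinate ring of an affine chart is a polynomial ring. -/
noncomputable def coordEquiv {i j : Fin 2} (hij : j ≠ i) :
    Polynomial k ≃+* Away (grading k) (X i : MvPolynomial (Fin 2) k) :=
  RingEquiv.ofBijective (coord k i j) (bijective_coord k hij)

/-- The affine charts of the projective line. -/
noncomputable def chart {i j : Fin 2} (hij : j ≠ i) :
    Spec (.of (Polynomial k)) ⟶ Proj (grading k) :=
  Spec.map (coordEquiv k hij).symm.toCommRingCatIso.hom ≫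
    Proj.awayι (grading k) (X i) (X_mem k i) one_pos

instance {i j : Fin 2} (hij : j ≠ i) : IsOpenImmersion (chart k hij) := by
  unfold chart
  infer_instance

lemma map_coord_chart {i j : Fin 2} (hij : j ≠ i) :
    Spec.map (CommRingCat.ofHom (coord k i j)) ≫ chart k hij =
      Proj.awayι (grading k) (X i) (X_mem k i) one_pos := by
  have : (coordEquiv k hij).symm.toCommRingCatIso.hom ≫ CommRingCat.ofHom (coord k i j) = 𝟙 _ := by
    exact CommRingCat.hom_ext (RingHom.ext fun z => (coordEquiv k hij).apply_symm_apply z)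
  rw [chart, ← Category.assoc, ← Spec.map_comp, this, Spec.map_id, Category.id_comp]

lemma range_chart {i j : Fin 2} (hij : j ≠ i) {y : Proj (grading k)}
    (hy : y ∈ Proj.basicOpen (grading k) (X i)) : ∃ z, chart k hij z = y := by
  rw [← Proj.opensRange_awayι (grading k) (X i) (X_mem k i) one_pos] at hy
  obtain ⟨w, rfl⟩ := hy
  rw [← map_coord_chart k hij]
  exact ⟨Spec.map (CommRingCat.ofHom (coord k i j)) w, rfl⟩

lemma chart_structureMap {i j : Fin 2} (hij : j ≠ i) :
    chart k hij ≫ structureMap k = Spec.map (CommRingCat.ofHom Polynomial.C) := by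
  have : CommRingCat.ofHom (algebraMap k (grading k 0)) ≫
      CommRingCat.ofHom (fromZeroRingHom (grading k) (Submonoid.powers (X i))) ≫
        (coordEquiv k hij).symm.toCommRingCatIso.hom = CommRingCat.ofHom Polynomial.C := by
    refine CommRingCat.hom_ext (RingHom.ext fun a => ?_)
    refine (coordEquiv k hij).symm_apply_eq.2 ?_
    change _ = coord k i j (Polynomial.C a)
    rw [coord, Polynomial.coe_eval₂RingHom, Polynomial.eval₂_C]
    rfl
  rw [← this, Spec.map_comp, Spec.map_comp, chart, structureMap, Category.assoc, Category.assoc,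
    Proj.awayι_toSpecZero_assoc]

lemma adjoin_range_X :
    Algebra.adjoin (grading k 0) (Set.range (X : Fin 2 → MvPolynomial (Fin 2) k)) = ⊤ := by
  rw [eq_top_iff]
  rintro f -
  induction f using MvPolynomial.induction_on with
  | C a => exact Subalgebra.algebraMap_mem _ (algebraMap k (grading k 0) a)
  | add f g hf hg => exact add_mem hf hg
  | mul_X f i hf => exact mul_mem hf (Algebra.subset_adjoin ⟨i, rfl⟩)

/-- The projective line is glued from two affine lines. -/
noncomputable def lineGluing : LineGluing (structureMap k) where
  c₀ := chart k (i := 0) (j := 1) one_ne_zero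
  c₁ := chart k (i := 1) (j := 0) zero_ne_one
  open₀ := inferInstance
  open₁ := inferInstance
  base₀ := chart_structureMap k _
  base₁ := chart_structureMap k _
  cover := fun y => by
    have h : y ∈ ⨆ i, Proj.basicOpen (grading k) (X i : MvPolynomial (Fin 2) k) := by
      rw [Proj.iSup_basicOpen_eq_top' (grading k) _ (fun i => ⟨1, X_mem k i⟩) (adjoin_range_X k)]
      trivial
    obtain ⟨i, hi⟩ := TopologicalSpace.Opens.mem_iSup.1 h
    fin_cases i
    · exact Or.inl (range_chart k _ hi)
    · exact Or.inr (range_chart k _ hi)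
  L := Away (grading k) (X 0 * X 1 : MvPolynomial (Fin 2) k)
  ψ₀ := (awayMap (grading k) (X_mem k 1) rfl).comp (coord k 0 1)
  ψ₁ := (awayMap (grading k) (X_mem k 0) (mul_comm _ _)).comp (coord k 1 0)
  inverse := by
    rw [RingHom.comp_apply, RingHom.comp_apply, coord, coord, Polynomial.coe_eval₂RingHom,
      Polynomial.coe_eval₂RingHom, Polynomial.eval₂_X, Polynomial.eval₂_X, ratio, ratio,
      awayMap_mk, awayMap_mk]
    apply val_injective
    rw [val_mul, val_one, Away.val_mk, Away.val_mk, Localization.mk_mul, ← Localization.mk_one,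
      Localization.mk_eq_mk_iff, Localization.r_iff_exists]
    refine ⟨1, ?_⟩
    simp only [OneMemClass.coe_one, one_mul, Submonoid.coe_mul, mul_one]
    ring
  isLocalization := by
    let := (awayMap (grading k) (X_mem k 0) (mul_comm (X 0) (X 1))).toAlgebra
    have h1 : IsLocalization (Submonoid.powers (ratio k 1 0))
        (Away (grading k) (X 0 * X 1 : MvPolynomial (Fin 2) k)) :=
      Away.isLocalization_mul (X_mem k 1) (X_mem k 0) (mul_comm (X 0) (X 1)) one_ne_zero
    have h2 := IsLocalization.isLocalization_of_base_ringEquiv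
      (Submonoid.powers (ratio k 1 0)) (Away (grading k) (X 0 * X 1 : MvPolynomial (Fin 2) k))
      (coordEquiv k (i := 1) (j := 0) zero_ne_one).symm
    have h3 : (coordEquiv k (i := 1) (j := 0) zero_ne_one).symm (ratio k 1 0) = Polynomial.X := by
      rw [RingEquiv.symm_apply_eq]
      change _ = coord k 1 0 Polynomial.X
      rw [coord, Polynomial.coe_eval₂RingHom, Polynomial.eval₂_X]
    have h4 : (Submonoid.powers (ratio k 1 0)).map
        (coordEquiv k (i := 1) (j := 0) zero_ne_one).symm =
        Submonoid.powers (Polynomial.X : Polynomial k) := by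
      rw [Submonoid.map_powers]
      exact congrArg _ h3
    rw [h4] at h2
    exact h2
  glue := by
    rw [CommRingCat.ofHom_comp, CommRingCat.ofHom_comp, Spec.map_comp, Spec.map_comp,
      Category.assoc, Category.assoc, map_coord_chart, map_coord_chart,
      Proj.SpecMap_awayMap_awayι, Proj.SpecMap_awayMap_awayι]

end ProjLine

/-! ### Standard coefficients and the value `5/6`. -/

/-- The standard coefficient `(m - 1 + l a) / m`. -/
noncomputable def stdCoeff (a : ℝ) (m l : ℕ) : ℝ := ((m : ℝ) - 1) / m + (l : ℝ) * a / m

/-- In this form the coefficient is at most one exactly when `l * a ≤ 1`. -/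
lemma stdCoeff_eq (a : ℝ) {m : ℕ} (hm : 1 ≤ m) (l : ℕ) :
    stdCoeff a m l = 1 - (1 - l * a) / m := by
  have : (m : ℝ) ≠ 0 := by positivity
  unfold stdCoeff
  field_simp
  ring

lemma stdCoeff_nonneg {a : ℝ} (ha : 0 ≤ a) {m : ℕ} (hm : 1 ≤ m) (l : ℕ) : 0 ≤ stdCoeff a m l := by
  have : (1 : ℝ) ≤ m := by exact_mod_cast hm
  have : (0 : ℝ) ≤ m - 1 := by linarith
  unfold stdCoeff
  positivity

lemma stdCoeff_pos {a : ℝ} (ha : 0 < a) {m : ℕ} (hm : 1 ≤ m) {l : ℕ} (hl : l ≠ 0) :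
    0 < stdCoeff a m l := by
  have : (1 : ℝ) ≤ m := by exact_mod_cast hm
  have : (0 : ℝ) ≤ m - 1 := by linarith
  unfold stdCoeff
  positivity

lemma finiteSums_singleton_one : finiteSums {1} = {0} := by
  ext s
  constructor
  · rintro ⟨M, hM, rfl, h⟩
    rw [Multiset.eq_replicate_card.2 hM, Multiset.sum_replicate, nsmul_eq_mul, mul_one] at h ⊢
    have : M.card < 1 := by exact_mod_cast h
    simp [Nat.lt_one_iff.1 this]
  · rintro rfl
    exact ⟨0, by simp, by simp, by simp⟩

/-- Since `2 * a > 1`, only `l = 0` and `l = 1` occur. They give `1 - 1 / m` and `1 - (1 - a) / m ≥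
a`. -/
lemma stdCoeff_cases {a : ℝ} (ha : 5 / 6 < a) (ha' : a < 1) {m : ℕ} (hm : 1 ≤ m) {l : ℕ}
    (h : stdCoeff a m l ≤ 1) :
    stdCoeff a m l < 1 ∧ (stdCoeff a m l = 0 ∨ stdCoeff a m l = 1 / 2 ∨ 2 / 3 ≤ stdCoeff a m l) ∧
      (l ≠ 0 → 5 / 6 < stdCoeff a m l) := by
  rw [stdCoeff_eq a hm] at h ⊢
  have hm0 : (0 : ℝ) < m := by positivity
  have hl : l * a ≤ 1 := by
    have : 0 ≤ (1 - l * a) / m := by linarith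
    rw [div_nonneg_iff] at this
    rcases this with h | h <;> linarith
  have hl2 : l < 2 := by
    by_contra! hl2
    have : (2 : ℝ) ≤ l := by exact_mod_cast hl2
    nlinarith
  interval_cases l
  · refine ⟨by simp; omega, ?_, by simp⟩
    rcases hm.eq_or_lt with rfl | hm
    · simp
    rcases (show 2 ≤ m from hm).eq_or_lt with rfl | hm
    · right; left; norm_num
    right; right
    have : (3 : ℝ) ≤ m := by exact_mod_cast hm
    have : 1 / (m : ℝ) ≤ 1 / 3 := one_div_le_one_div_of_le (by norm_num) this
    norm_num at this ⊢
    linarith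
  · have h1 : (1 : ℝ) ≤ m := by exact_mod_cast hm
    have h2 : (1 - a) / (m : ℝ) ≤ 1 - a := div_le_self (by linarith) h1
    have h3 : 0 < (1 - a) / (m : ℝ) := div_pos (by linarith) hm0
    norm_num
    refine ⟨by linarith, ?_, by linarith⟩
    right; right; linarith

/-- All terms are below `1`, so at least three are nonzero, one of them above `5/6`. If two others
are `1/2`, these three sum to less than `2`, and a fourth, at least `1/2`, overshoots. Otherwise the
sum exceeds `5/6 + 1/2 + 2/3 = 2`. -/
lemma sum_stdCoeff_ne_two {a : ℝ} (ha : 5 / 6 < a) (ha' : a < 1) {n : ℕ} {m l : Fin n → ℕ}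
    (hm : ∀ i, 1 ≤ m i) (hl : ∃ i, l i ≠ 0) (h : ∀ i, stdCoeff a (m i) (l i) ≤ 1) :
    ∑ i, stdCoeff a (m i) (l i) ≠ 2 := by
  intro hsum
  obtain ⟨i, hi⟩ := hl
  have hc := fun i => stdCoeff_cases ha ha' (hm i) (h i)
  have hn : ∀ i, 0 ≤ stdCoeff a (m i) (l i) := fun i => stdCoeff_nonneg (by linarith) (hm i) _
  generalize hd : (fun i => stdCoeff a (m i) (l i)) = d
  simp only [funext_iff] at hd
  simp only [hd] at hsum hc hn
  have hi' := (hc i).2.2 hi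
  have h1 : ∑ j ∈ Finset.univ.erase i, d j = 2 - d i := by
    rw [← hsum, ← Finset.add_sum_erase _ _ (Finset.mem_univ i)]
    ring
  have key : ∀ s : Finset (Fin n), i ∉ s → ∑ j ∈ s, d j ≤ 2 - d i := fun s hs => by
    rw [← h1]
    exact Finset.sum_le_sum_of_subset_of_nonneg
      (fun j hj => Finset.mem_erase.2 ⟨fun h => hs (h ▸ hj), Finset.mem_univ j⟩)
      fun j _ _ => hn j
  obtain ⟨j, hj, hj0⟩ := Finset.exists_ne_zero_of_sum_ne_zero
    (s := Finset.univ.erase i) (f := d) (by have := (hc i).1; rw [h1]; linarith)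
  have hij := Finset.ne_of_mem_erase hj
  have h2 : ∑ j ∈ (Finset.univ.erase i).erase j, d j = 2 - d i - d j := by
    rw [← h1, ← Finset.add_sum_erase _ _ hj]
    ring
  obtain ⟨t, ht, ht0⟩ := Finset.exists_ne_zero_of_sum_ne_zero
    (s := (Finset.univ.erase i).erase j) (f := d)
    (by have := (hc i).1; have := (hc j).1; rw [h2]; linarith)
  have htj := Finset.ne_of_mem_erase ht
  have hti := Finset.ne_of_mem_erase (Finset.mem_of_mem_erase ht)
  have h3 : ∑ j ∈ ((Finset.univ.erase i).erase j).erase t, d j = 2 - d i - d j - d t := by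
    rw [← h2, ← Finset.add_sum_erase _ _ ht]
    ring
  have h3n : 0 ≤ ∑ j ∈ ((Finset.univ.erase i).erase j).erase t, d j :=
    Finset.sum_nonneg fun j _ => hn j
  rcases (hc j).2.1 with hj1 | hj1 | hj1
  · exact hj0 hj1
  · rcases (hc t).2.1 with ht1 | ht1 | ht1
    · exact ht0 ht1
    · obtain ⟨w, hw, hw0⟩ := Finset.exists_ne_zero_of_sum_ne_zero
        (s := ((Finset.univ.erase i).erase j).erase t) (f := d)
        (by have := (hc i).1; rw [h3]; linarith)
      have := Finset.single_le_sum (f := d) (fun j _ => hn j) hw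
      rcases (hc w).2.1 with hw1 | hw1 | hw1
      · exact hw0 hw1
      all_goals linarith
    · linarith
  · rcases (hc t).2.1 with ht1 | ht1 | ht1
    · exact ht0 ht1
    all_goals linarith

/-- The numbers `a` for which standard coefficients formed with `a` add up to two. -/
def stdSet : Set ℝ :=
  {a : ℝ | a ∈ Set.Ioc (0 : ℝ) 1 ∧ ∃ (n : ℕ) (m l : Fin n → ℕ),
        (∀ i, 1 ≤ m i) ∧ (∃ i, l i ≠ 0) ∧
        (∀ i, ((m i : ℝ) - 1) / m i + (l i : ℝ) * a / m i ≤ 1) ∧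
        ∑ i, (((m i : ℝ) - 1) / m i + (l i : ℝ) * a / m i) = 2}

lemma isGreatest_stdSet : IsGreatest (stdSet \ {1}) (5 / 6) := by
  constructor
  · refine ⟨⟨by norm_num, 3, ![2, 3, 1], ![0, 0, 1], ?_, ⟨2, by simp⟩, ?_, ?_⟩, by norm_num⟩
    · intro i; fin_cases i <;> simp
    · intro i; fin_cases i <;> norm_num
    · simp only [Fin.sum_univ_three, Matrix.cons_val]; norm_num
  · rintro a ⟨⟨ha, n, m, l, hm, hl, h1, h2⟩, ha1⟩
    by_contra! h
    exact sum_stdCoeff_ne_two h (lt_of_le_of_ne ha.2 ha1) hm hl h1 h2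

/-! ### The two inclusions. -/

section
variable {k : Type u} [Field k] [IsAlgClosed k] [CharZero k]

lemma N₁_subset : N₁ k {1} ⊆ stdSet := by
  rintro a ⟨ha, X, _, p, Δ, hp, hlc, ⟨K, hK, hdeg⟩, m, f, l, hΔ, hl⟩
  refine ⟨ha, Δ.support.card, fun i => m (Δ.support.equivFin.symm i),
    fun i => l (Δ.support.equivFin.symm i) 0, fun i => (hΔ _ (Subtype.coe_prop _)).1, ?_, ?_⟩
  · obtain ⟨x, hx, hx0⟩ := hl 0
    exact ⟨Δ.support.equivFin ⟨x, hx⟩, by simpa using hx0⟩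
  have hval : ∀ x ∈ Δ.support,
      ((m x : ℝ) - 1) / m x + (l x 0 : ℝ) * a / m x = Δ x := by
    intro x hx
    obtain ⟨-, hf, h⟩ := hΔ x hx
    rw [finiteSums_singleton_one, Set.mem_singleton_iff] at hf
    simpa [hf] using h.symm
  refine ⟨fun i => ?_, ?_⟩
  · rw [hval _ (Subtype.coe_prop _)]
    linarith [(hlc (Δ.support.equivFin.symm i)).2]
  have hsum : Δ.deg = 2 := by
    have hpos : 0 < Δ.deg := by
      obtain ⟨x, hx, -⟩ := hl 0
      refine Finset.sum_pos' (fun x _ => (hlc x).1) ⟨x, hx, ?_⟩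
      exact (hlc x).1.lt_of_ne' (Finsupp.mem_support_iff.1 hx)
    rcases deg_canonical p hp hK with h | h
    · rw [h] at hdeg
      push_cast at hdeg
      linarith
    · have : (0 : ℝ) ≤ (K.deg : ℝ) := by exact_mod_cast h
      linarith
  rw [← hsum, CurveDivisor.deg, Finsupp.sum]
  refine Eq.trans ?_ (Finset.sum_coe_sort Δ.support Δ)
  exact Fintype.sum_equiv Δ.support.equivFin.symm _ _ fun i => hval _ (Subtype.coe_prop _)

/-- There are infinitely many closed points, so the terms can be placed at distinct ones. Vanishing
terms drop out of the support, but one with `l i ≠ 0` is positive and stays. -/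
lemma LineGluing.stdSet_subset {Y : Scheme.{u}} {p : Y ⟶ Spec (.of k)} [IsProper p]
    (G : LineGluing p) : stdSet ⊆ N₁ k {1} := by
  rintro a ⟨ha, n, m, l, hm, ⟨i₀, hi₀⟩, hle, hsum⟩
  have := G.isIntegral
  have := G.infinite_closedPoints
  obtain ⟨K, hK, hdeg⟩ := G.exists_isCanonicalDivisor
  let e : Fin n ↪ closedPoints Y := Fin.valEmbedding.trans (Infinite.natEmbedding _)
  let d : Fin n →₀ ℝ := Finsupp.equivFunOnFinite.symm fun i => stdCoeff a (m i) (l i)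
  have hd : ∀ i, d i = stdCoeff a (m i) (l i) := fun i => rfl
  let Δ : CurveDivisor Y ℝ := d.embDomain e
  have hΔ : ∀ i, Δ (e i) = stdCoeff a (m i) (l i) := fun i => Finsupp.embDomain_apply_self e d i
  have hsupp : ∀ x, x ∈ Δ.support → ∃ i, e i = x := by
    intro x hx
    by_contra hx'
    exact Finsupp.mem_support_iff.1 hx (Finsupp.embDomain_of_notMem_range e d x hx')
  refine ⟨ha, Y, G.isIntegral, p, Δ, G.isCompleteNormalCurve, ?_, ⟨K, hK, ?_⟩,
    Function.extend e m 1, 0, fun x _ => Function.extend e l 0 x, ?_, fun _ => ⟨e i₀, ?_, ?_⟩⟩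
  · intro x
    by_cases hx : x ∈ Δ.support
    · obtain ⟨i, rfl⟩ := hsupp x hx
      rw [hΔ]
      exact ⟨stdCoeff_nonneg ha.1.le (hm i) _, sub_nonneg.2 (hle i)⟩
    · rw [Finsupp.notMem_support_iff.1 hx]
      norm_num
  · have : Δ.deg = ∑ i, d i := by
      rw [CurveDivisor.deg, Finsupp.sum_embDomain, Finsupp.sum_fintype _ _ fun _ => rfl]
    rw [hdeg, this]
    push_cast
    rw [show ∑ i, d i = 2 from hsum]
    norm_num
  · intro x hx
    obtain ⟨i, rfl⟩ := hsupp x hx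
    rw [hΔ, e.injective.extend_apply, finiteSums_singleton_one]
    refine ⟨hm i, rfl, ?_⟩
    simp [stdCoeff, e.injective.extend_apply]
  · rw [Finsupp.mem_support_iff, hΔ]
    exact (stdCoeff_pos ha.1 (hm i₀) hi₀).ne'
  · exact (e.injective.extend_apply l 0 i₀).trans_ne hi₀

end

theorem lemma4p6 (k : Type u) [Field k] [IsAlgClosed k] [CharZero k] :
    N₁ k {1} =
      {a : ℝ | a ∈ Set.Ioc (0 : ℝ) 1 ∧ ∃ (n : ℕ) (m l : Fin n → ℕ),
        (∀ i, 1 ≤ m i) ∧ (∃ i, l i ≠ 0) ∧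
        (∀ i, ((m i : ℝ) - 1) / m i + (l i : ℝ) * a / m i ≤ 1) ∧
        ∑ i, (((m i : ℝ) - 1) / m i + (l i : ℝ) * a / m i) = 2} ∧
    IsGreatest (N₁ k {1} \ {1}) (5 / 6) := by
  have h : N₁ k {1} = stdSet :=
    N₁_subset.antisymm (ProjLine.lineGluing k).stdSet_subset
  exact ⟨h, h ▸ isGreatest_stdSet⟩
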